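/- Let $n\ge 2$, write $\langle\xi\rangle=(1+|\xi|^2)^{1/2}$, and let $\widehat u(\xi)=\int_{\mathbb R^n}e^{-i\langle y,\xi\rangle}u(y)\,dy$. Amplitudes. For $1\le p\le\infty$, $m\in\mathbb R$, $0\le\varrho\le1$, the class $L^pS^m_\varrho$ consists of the functions $a:\mathbb R^n\times\mathbb R^n\to\mathbb C$ such that $a(\cdot,\xi)$ is measurable for every $\xi$, $a(x,\cdot)\in C^\infty(\mathbb R^n)$ for a.e. $x$, and for every multi-index $\alpha$ there is a constant $C_\alpha$ with $\|\partial_\xi^\alpha a(\cdot,\xi)\|_{L^p}\le C_\alpha\langle\xi\rangle^{m-\varrho|\alpha|}$ for all $\xi$. Put $|a|_{p,m,N}=\sum_{|\alpha|\le N}\sup_{\xi}\langle\xi\rangle^{\varrho|\alpha|-m}\|\partial_\xi^\alpha a(\cdot,\xi)\|_{L^p}$. Phases. A real-valued function $\varphi\in C^\infty(\mathbb R^n\times(\mathbb R^n\setminus\{0\}))$, positively homogeneous of degree $1$ in $\xi$, belongs to $\Phi^2$ if for all multi-indices $\alpha,\beta$ with $|\alpha|+|\beta|\ge2$ there is a constant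 $B_{\alpha,\beta}$ with $|\xi|^{-1+|\alpha|}|\partial_\xi^\alpha\partial_x^\beta\varphi(x,\xi)|\le B_{\alpha,\beta}$ for all $x$ and all $\xi\ne0$. It satisfies the strong non-degeneracy condition (SND) if there is $c>0$ with $\bigl|\det\bigl(\partial^2\varphi/\partial x_j\partial\xi_k\bigr)(x,\xi)\bigr|\ge c$ for all $x$ and all $\xi\neq0$. Theorem. Let $1\le p,q\le\infty$ and let $0<r\le\infty$ satisfy $\frac1r=\frac1p+\frac1q$ (so $r<1$ is allowed). Let $\varphi\in\Phi^2$ satisfy SND, let $a\in L^pS^m_\varrho$, and suppose there is a compact set $K\subset\mathbb R^n$ with $\operatorname{supp}a(x,\cdot)\subset K$ for a.e. $x$. Then the Fourier integral operator $$T_au(x)=\frac1{(2\pi)^n}\int_{\mathbb R^n}e^{i\varphi(x,\xi)}a(x,\xi)\,\widehat u(\xi)\,d\xi$$ is bounded from $L^q$ to $L^r$: $$\|T_au\|_{L^r}\le C\,|a|_{p,m,N}\,\|u\|_{L^q}\qquad\text{for every Schwartz function }u,$$ where $N$ depends only on $n,p,q$, and $C$ depends only on $n,m,\varrho,p,q$,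 the set $K$, the constants $B_{\alpha,\beta}$ and the constant $c$. Moreover, with $\mathcal K(x,y)=(2\pi)^{-n}\int e^{i\varphi(x,\xi)-i\langle y,\xi\rangle}a(x,\xi)\,d\xi$, for every $u\in L^q$ the integral $\int\mathcal K(x,y)u(y)\,dy$ converges absolutely for a.e. $x$, it equals $T_au(x)$ for a.e. $x$ if $u$ is a Schwartz function, and the operator on all of $L^q$ that it defines satisfies the same estimate. -/

import Mathlib

open MeasureTheory
open scoped ENNReal NNReal ContDiff SchwartzMap

/-- The `i`-th partial derivative of `f : ℝⁿ → F`. -/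
noncomputable def partialDeriv {n : ℕ} {F : Type*} [NormedAddCommGroup F] [NormedSpace ℝ F]
    (i : Fin n) (f : EuclideanSpace ℝ (Fin n) → F) : EuclideanSpace ℝ (Fin n) → F :=
  fun x => fderiv ℝ f x (EuclideanSpace.single i 1)

/-- The multi-index derivative `∂^α f = ∂₀^{α₀} ⋯ ∂ₙ₋₁^{αₙ₋₁} f`. -/
noncomputable def multiDeriv {n : ℕ} {F : Type*} [NormedAddCommGroup F] [NormedSpace ℝ F]
    (α : Fin n → ℕ) (f : EuclideanSpace ℝ (Fin n) → F) : EuclideanSpace ℝ (Fin n) → F :=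
  (List.finRange n).foldr (fun i g => (partialDeriv i)^[α i] g) f

/-- The order `|α|` of a multi-index. -/
def multiOrder {n : ℕ} (α : Fin n → ℕ) : ℕ := ∑ i, α i

/-- The Japanese bracket `⟨ξ⟩ = (1 + |ξ|²)^{1/2}`. -/
noncomputable def japBracket {n : ℕ} (ξ : EuclideanSpace ℝ (Fin n)) : ℝ :=
  Real.sqrt (1 + ‖ξ‖ ^ 2)

/-- The class `L^p S^m_ϱ` of amplitudes that are `L^p` in `x` and smooth in `ξ`. -/
structure AmplitudeClass {n : ℕ} (p : ℝ≥0∞) (m ρ : ℝ)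
    (a : EuclideanSpace ℝ (Fin n) → EuclideanSpace ℝ (Fin n) → ℂ) : Prop where
  /-- `a(·, ξ)` is (Lebesgue) measurable for each `ξ`. -/
  measurable : ∀ ξ, AEStronglyMeasurable (fun x => a x ξ) volume
  /-- `a(x, ·)` is `C^∞` for almost every `x`. -/
  smooth : ∀ᵐ x, ContDiff ℝ ∞ (a x)
  /-- `‖∂_ξ^α a(·, ξ)‖_{L^p} ≤ C_α ⟨ξ⟩^{m - ϱ|α|}`. -/
  bound : ∀ α : Fin n → ℕ, ∃ C : ℝ, ∀ ξ : EuclideanSpace ℝ (Fin n),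
    eLpNorm (fun x => multiDeriv α (a x) ξ) p volume
      ≤ ENNReal.ofReal (C * japBracket ξ ^ (m - ρ * multiOrder α))

/-- The seminorm `|a|_{p,m,s} = ∑_{|α| ≤ s} sup_ξ ⟨ξ⟩^{ϱ|α| - m} ‖∂_ξ^α a(·, ξ)‖_{L^p}`. -/
noncomputable def ampSeminorm {n : ℕ} (p : ℝ≥0∞) (m ρ : ℝ) (s : ℕ)
    (a : EuclideanSpace ℝ (Fin n) → EuclideanSpace ℝ (Fin n) → ℂ) : ℝ≥0∞ :=
  ∑ k ∈ Finset.range (s + 1), ∑ α ∈ Finset.piAntidiag (Finset.univ : Finset (Fin n)) k,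
    ⨆ ξ : EuclideanSpace ℝ (Fin n),
      ENNReal.ofReal (japBracket ξ ^ (ρ * multiOrder α - m)) *
        eLpNorm (fun x => multiDeriv α (a x) ξ) p volume

/-- `φ` belongs to the class `Φ^k`, with the constants `B α β` in its defining estimates.
(`φ ∈ Φ^k` means that this holds for some family `B`.)  The values `φ x 0` play no role. -/
structure PhaseClass {n : ℕ} (k : ℕ) (B : (Fin n → ℕ) → (Fin n → ℕ) → ℝ)
    (φ : EuclideanSpace ℝ (Fin n) → EuclideanSpace ℝ (Fin n) → ℝ) : Prop where
  /-- `φ` is `C^∞` on `ℝⁿ × (ℝⁿ ∖ 0)`. -/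
  smooth : ContDiffOn ℝ ∞ (fun z : EuclideanSpace ℝ (Fin n) × EuclideanSpace ℝ (Fin n) =>
    φ z.1 z.2) (Set.univ ×ˢ {0}ᶜ)
  /-- `φ` is positively homogeneous of degree one in `ξ`. -/
  homogeneous : ∀ x ξ, ξ ≠ 0 → ∀ t : ℝ, 0 < t → φ x (t • ξ) = t * φ x ξ
  /-- `|ξ|^{-1+|α|} |∂_ξ^α ∂_x^β φ(x, ξ)| ≤ B_{α,β}` whenever `|α| + |β| ≥ k`. -/
  bound : ∀ α β : Fin n → ℕ, k ≤ multiOrder α + multiOrder β → ∀ x ξ, ξ ≠ 0 →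
    ‖ξ‖ ^ (-1 + (multiOrder α : ℝ)) *
      |multiDeriv α (fun ξ' => multiDeriv β (fun x' => φ x' ξ') x) ξ| ≤ B α β

/-- The mixed Hessian `(∂²φ / ∂x_j ∂ξ_k)(x, ξ)`. -/
noncomputable def mixedHessian {n : ℕ}
    (φ : EuclideanSpace ℝ (Fin n) → EuclideanSpace ℝ (Fin n) → ℝ)
    (x ξ : EuclideanSpace ℝ (Fin n)) : Matrix (Fin n) (Fin n) ℝ :=
  Matrix.of fun j k => partialDeriv j (fun x' => partialDeriv k (fun ξ' => φ x' ξ') ξ) x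

/-- The strong non-degeneracy condition with lower bound `c` (used with `c > 0`). -/
def StrongNondegenerate {n : ℕ} (c : ℝ)
    (φ : EuclideanSpace ℝ (Fin n) → EuclideanSpace ℝ (Fin n) → ℝ) : Prop :=
  ∀ x ξ, ξ ≠ 0 → c ≤ |(mixedHessian φ x ξ).det|

/-- The Fourier transform `û(ξ) = ∫ e^{-i⟨y,ξ⟩} u(y) dy`. -/
noncomputable def fourierHat {n : ℕ} (u : EuclideanSpace ℝ (Fin n) → ℂ)
    (ξ : EuclideanSpace ℝ (Fin n)) : ℂ :=
  ∫ y, Complex.exp (-Complex.I * (inner ℝ y ξ : ℝ)) * u y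

/-- The Fourier integral operator
`T_a u(x) = (2π)^{-n} ∫ e^{iφ(x,ξ)} a(x,ξ) û(ξ) dξ`. -/
noncomputable def fio {n : ℕ}
    (φ : EuclideanSpace ℝ (Fin n) → EuclideanSpace ℝ (Fin n) → ℝ)
    (a : EuclideanSpace ℝ (Fin n) → EuclideanSpace ℝ (Fin n) → ℂ)
    (u : EuclideanSpace ℝ (Fin n) → ℂ) (x : EuclideanSpace ℝ (Fin n)) : ℂ :=
  (((2 * Real.pi) ^ n)⁻¹ : ℝ) *
    ∫ ξ, Complex.exp (Complex.I * (φ x ξ : ℝ)) * a x ξ * fourierHat u ξ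

/-- The Schwartz kernel `(2π)^{-n} ∫ e^{i(φ(x,ξ) - ⟨y,ξ⟩)} a(x,ξ) dξ` of `T_a`. -/
noncomputable def fioKernel {n : ℕ}
    (φ : EuclideanSpace ℝ (Fin n) → EuclideanSpace ℝ (Fin n) → ℝ)
    (a : EuclideanSpace ℝ (Fin n) → EuclideanSpace ℝ (Fin n) → ℂ)
    (x y : EuclideanSpace ℝ (Fin n)) : ℂ :=
  (((2 * Real.pi) ^ n)⁻¹ : ℝ) *
    ∫ ξ, Complex.exp (Complex.I * (φ x ξ - inner ℝ y ξ : ℝ)) * a x ξ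

/-- The integral operator with the kernel of `T_a`: it makes sense also for functions `u` whose
Fourier transform is not a function. -/
noncomputable def fioExt {n : ℕ}
    (φ : EuclideanSpace ℝ (Fin n) → EuclideanSpace ℝ (Fin n) → ℝ)
    (a : EuclideanSpace ℝ (Fin n) → EuclideanSpace ℝ (Fin n) → ℂ)
    (u : EuclideanSpace ℝ (Fin n) → ℂ) (x : EuclideanSpace ℝ (Fin n)) : ℂ :=
  ∫ y, fioKernel φ a x y * u y

/-! The operator is controlled by its kernel, and the kernel factors into an amplitude majorant and
an integrable bump. Since the amplitude has compact support in `ξ`, the only obstruction to rapid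
decay of the kernel is the singularity of the homogeneous phase at `ξ = 0`.

Fix a unit vector `ζ` and put `ψ(x) = ∇_ξ φ(x, ζ)`. The class `Φ²` gives no bound on first
derivatives of `φ`, but `∇_ξ φ(x, ·)` is homogeneous of degree zero, and in dimension at least two
any two points of the sphere are joined by paths along which the second derivative is bounded. Hence
`θ(x, ξ) = φ(x, ξ) - ⟨ψ(x), ξ⟩` satisfies symbol estimates of order one, uniformly in `x`
(`PhaseClass.reduced_bound`), and so does `e^{iθ} - 1` on bounded sets. This vanishing at the origin
permits `n + 1` integrations by parts in `|ξ| ≳ 1/|z|` and a direct estimate in `|ξ| ≲ 1/|z|`, where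
`z = y - ψ(x)`. The outcome (`exists_kernel_bound`) is decay like `(1 + |z|)^{-(n + 1/2)}`, just
integrable, with a constant `A(x)` that integrates derivatives of `a(x, ·)` of order at most `n + 1`
against the finite measure `|ξ|^{1/2 - n} dξ` on a ball.

Therefore `|T_a u(x)| ≤ C A(x) G(ψ(x))`, where `G` is the convolution of `|u|` with an integrable
weight. Minkowski's inequality gives `A ∈ L^p` and `G ∈ L^q`. The map `ψ` has Jacobian bounded below
by `c`, and it is globally injective (`injective_of_lipschitz_fderiv`), so composition with `ψ` is
bounded on `L^q` with a constant that depends only on `c` and `q`. Hölder's inequality, which needs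
no lower bound on `r`, concludes. -/

/-! ### Commuting directional derivatives on open sets. -/

section IteratedDirectional

variable {V F : Type*} [NormedAddCommGroup V] [NormedSpace ℝ V]
  [NormedAddCommGroup F] [NormedSpace ℝ F]

/-- The iterated directional derivative of `f` along the vectors of a list. -/
noncomputable def iterDir (L : List V) (f : V → F) : V → F :=
  L.foldr (fun v g x => fderiv ℝ g x v) f

theorem iterDir_cons (v : V) (L : List V) (f : V → F) :
    iterDir (v :: L) f = fun x => fderiv ℝ (iterDir L f) x v := rfl

theorem iterDir_append (L M : List V) (f : V → F) :
    iterDir (L ++ M) f = iterDir L (iterDir M f) := by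
  simp [iterDir, List.foldr_append]

theorem ContDiffOn.fderiv_apply_const {U : Set V} (hU : IsOpen U) {f : V → F}
    (hf : ContDiffOn ℝ ∞ f U) (v : V) : ContDiffOn ℝ ∞ (fun x => fderiv ℝ f x v) U :=
  (hf.fderiv_of_isOpen hU (m := ∞) (by simp)).clm_apply contDiffOn_const

theorem contDiffOn_iterDir {U : Set V} (hU : IsOpen U) {f : V → F}
    (hf : ContDiffOn ℝ ∞ f U) (L : List V) : ContDiffOn ℝ ∞ (iterDir L f) U := by
  induction L with
  | nil => exact hf
  | cons v L ih => exact ih.fderiv_apply_const hU v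

theorem iterDir_congr {U : Set V} (hU : IsOpen U) {f g : V → F} (h : Set.EqOn f g U)
    (L : List V) : Set.EqOn (iterDir L f) (iterDir L g) U := by
  induction L with
  | nil => exact h
  | cons v L ih =>
    intro x hx
    simp only [iterDir_cons]
    rw [(ih.eventuallyEq_of_mem (hU.mem_nhds hx)).fderiv_eq]

theorem fderiv_fderiv_apply_comm {f : V → F} {x : V} (hf : ContDiffAt ℝ ∞ f x) (v w : V) :
    fderiv ℝ (fun y => fderiv ℝ f y v) x w = fderiv ℝ (fun y => fderiv ℝ f y w) x v := by
  have hd : DifferentiableAt ℝ (fderiv ℝ f) x :=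
    (hf.fderiv_right (m := 1) (by norm_cast)).differentiableAt (by norm_num)
  have hs := hf.isSymmSndFDerivAt (by simp; norm_cast)
  have key : ∀ u u' : V, fderiv ℝ (fun y => fderiv ℝ f y u) x u' = fderiv ℝ (fderiv ℝ f) x u' u := by
    intro u u'
    rw [fderiv_clm_apply hd (differentiableAt_const u)]
    simp
  rw [key, key, hs.eq]

/-- Permutations are generated by adjacent swaps, and a swap is the symmetry of the second
derivative. Equality on the whole open set, not just at a point, is what survives a further
differentiation. -/
theorem iterDir_perm {U : Set V} (hU : IsOpen U) {f : V → F} (hf : ContDiffOn ℝ ∞ f U)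
    {L M : List V} (h : L.Perm M) : Set.EqOn (iterDir L f) (iterDir M f) U := by
  induction h with
  | nil => exact fun _ _ => rfl
  | cons v _ ih =>
    intro x hx
    simp only [iterDir_cons]
    rw [(ih.eventuallyEq_of_mem (hU.mem_nhds hx)).fderiv_eq]
  | swap v w L =>
    intro x hx
    simp only [iterDir_cons]
    exact fderiv_fderiv_apply_comm
      ((contDiffOn_iterDir hU hf L).contDiffAt (hU.mem_nhds hx)) _ _
  | trans _ _ ih₁ ih₂ => exact ih₁.trans ih₂

end IteratedDirectional

/-! ### Multi-index derivatives versus the full iterated derivative. -/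

section MultiIndex

variable {n : ℕ} {F : Type*} [NormedAddCommGroup F] [NormedSpace ℝ F]

/-- The list in which each index `i` occurs `α i` times. -/
def indexList (α : Fin n → ℕ) : List (Fin n) :=
  (List.finRange n).flatMap fun i => List.replicate (α i) i

/-- The standard basis vectors of `ℝⁿ`. -/
noncomputable def stdVec (i : Fin n) : EuclideanSpace ℝ (Fin n) := EuclideanSpace.single i 1

theorem norm_stdVec (i : Fin n) : ‖stdVec i‖ = 1 := by simp [stdVec]

theorem sum_smul_stdVec (v : EuclideanSpace ℝ (Fin n)) : ∑ i, v i • stdVec i = v := by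
  ext j
  simp [stdVec, Finset.sum_apply, Pi.single_apply]

theorem count_indexList (α : Fin n → ℕ) (i : Fin n) : (indexList α).count i = α i := by
  rw [indexList, List.count_flatMap]
  have : (List.map (List.count i ∘ fun j => List.replicate (α j) j) (List.finRange n)).sum
      = ∑ j, (if j = i then α j else 0) := by
    rw [← List.sum_ofFn, List.ofFn_eq_map]
    congr 1
    apply List.map_congr_left
    intro j _
    simp [List.count_replicate]
  rw [this]
  simp

/-- In list form, any reordering of partial derivatives is a permutation, decided by counting
indices. -/
theorem multiDeriv_eq_iterDir (α : Fin n → ℕ) (f : EuclideanSpace ℝ (Fin n) → F) :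
    multiDeriv α f = iterDir ((indexList α).map stdVec) f := by
  unfold multiDeriv indexList
  induction List.finRange n with
  | nil => rfl
  | cons i L ih =>
    rw [List.foldr_cons, List.flatMap_cons, List.map_append, iterDir_append, ih]
    generalize iterDir _ f = g
    induction α i with
    | zero => rfl
    | succ k ihk => rw [Function.iterate_succ_apply', ihk]; rfl

theorem indexList_count_perm (L : List (Fin n)) : (indexList fun i => L.count i).Perm L := by
  rw [List.perm_iff_count]
  intro a
  rw [count_indexList]

theorem multiOrder_count (L : List (Fin n)) : multiOrder (fun i => L.count i) = L.length := by
  unfold multiOrder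
  induction L with
  | nil => simp
  | cons a L ih => simp [List.count_cons, Finset.sum_add_distrib, ih]

theorem multiDeriv_partialDeriv {U : Set (EuclideanSpace ℝ (Fin n))} (hU : IsOpen U)
    {f : EuclideanSpace ℝ (Fin n) → F} (hf : ContDiffOn ℝ ∞ f U) (α : Fin n → ℕ) (i : Fin n) :
    Set.EqOn (multiDeriv α (partialDeriv i f)) (multiDeriv (α + Pi.single i 1) f) U := by
  have h1 : partialDeriv i f = iterDir [stdVec i] f := rfl
  rw [h1, multiDeriv_eq_iterDir, multiDeriv_eq_iterDir, ← iterDir_append]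
  apply iterDir_perm hU hf
  have : (indexList α).map stdVec ++ [stdVec i] = (indexList α ++ [i]).map stdVec := by simp
  rw [this]
  apply List.Perm.map
  rw [List.perm_iff_count]
  intro a
  rw [count_indexList, List.count_append, count_indexList]
  by_cases h : a = i
  · subst h; simp
  · simp [h, Ne.symm h]

theorem contDiffOn_multiDeriv {U : Set (EuclideanSpace ℝ (Fin n))} (hU : IsOpen U)
    {f : EuclideanSpace ℝ (Fin n) → F} (hf : ContDiffOn ℝ ∞ f U) (α : Fin n → ℕ) :
    ContDiffOn ℝ ∞ (multiDeriv α f) U := by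
  rw [multiDeriv_eq_iterDir]
  exact contDiffOn_iterDir hU hf _

theorem fderiv_eq_sum_partialDeriv (f : EuclideanSpace ℝ (Fin n) → F)
    (x : EuclideanSpace ℝ (Fin n)) :
    fderiv ℝ f x = ∑ i, (EuclideanSpace.proj i : EuclideanSpace ℝ (Fin n) →L[ℝ] ℝ).smulRight
      (partialDeriv i f x) := by
  ext v
  conv_lhs => rw [← sum_smul_stdVec v]
  simp [map_sum, partialDeriv, stdVec]

/-- Induction on the order, with `f` free so that it can be replaced by its partial derivatives. The
differential is `∑ i, T i (∂ᵢ f)` with `T i` linear of norm at most one, so each order costs a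
factor `n`; the shift `α ↦ α + eᵢ` embeds the indices of order `k` into those of order `k + 1`. -/
theorem norm_iteratedFDeriv_le_sum_multiDeriv {U : Set (EuclideanSpace ℝ (Fin n))} (hU : IsOpen U)
    {x : EuclideanSpace ℝ (Fin n)} (hx : x ∈ U) (k : ℕ) :
    ∀ {f : EuclideanSpace ℝ (Fin n) → F}, ContDiffOn ℝ ∞ f U →
    ‖iteratedFDeriv ℝ k f x‖ ≤
      n ^ k * ∑ α ∈ Finset.piAntidiag (Finset.univ : Finset (Fin n)) k, ‖multiDeriv α f x‖ := by
  induction k with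
  | zero =>
    intro f hf
    have : Finset.piAntidiag (Finset.univ : Finset (Fin n)) 0 = {0} := by simp
    rw [this]
    have h0 : multiDeriv (0 : Fin n → ℕ) f = f := by
      rw [multiDeriv_eq_iterDir]
      have : indexList (0 : Fin n → ℕ) = [] := by simp [indexList]
      rw [this]; rfl
    simp [h0]
  | succ k ih =>
    intro f hf
    have hp : ∀ i, ContDiffOn ℝ ∞ (partialDeriv i f) U := fun i => hf.fderiv_apply_const hU _
    let T : Fin n → F →L[ℝ] (EuclideanSpace ℝ (Fin n) →L[ℝ] F) := fun i =>
      ContinuousLinearMap.smulRightL ℝ (EuclideanSpace ℝ (Fin n)) F (EuclideanSpace.proj i)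
    have hT : ∀ i, ‖T i‖ ≤ 1 := by
      intro i
      refine ContinuousLinearMap.opNorm_le_bound _ zero_le_one fun y => ?_
      simp only [T]
      refine ContinuousLinearMap.opNorm_le_bound _ (by positivity) fun v => ?_
      simp only [ContinuousLinearMap.smulRightL_apply_apply, ContinuousLinearMap.smulRight_apply,
        norm_smul]
      have := PiLp.norm_apply_le v i
      change ‖v i‖ * ‖y‖ ≤ 1 * ‖y‖ * ‖v‖
      nlinarith [norm_nonneg y]
    have hfd : fderiv ℝ f = fun y => ∑ i, T i (partialDeriv i f y) := by
      funext y
      rw [fderiv_eq_sum_partialDeriv]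
      rfl
    have hc : ∀ i, ContDiffAt ℝ k (partialDeriv i f) x := fun i =>
      ((hp i).contDiffAt (hU.mem_nhds hx)).of_le (by exact_mod_cast le_top)
    have hle : ∀ i, ‖iteratedFDeriv ℝ k (fun y => T i (partialDeriv i f y)) x‖
        ≤ ‖iteratedFDeriv ℝ k (partialDeriv i f) x‖ := fun i =>
      ((T i).norm_iteratedFDeriv_comp_left (hc i) le_rfl).trans
        (mul_le_of_le_one_left (norm_nonneg _) (hT i))
    have hTc : ∀ i ∈ Finset.univ, ContDiffAt ℝ k (fun y => T i (partialDeriv i f y)) x :=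
      fun i _ => (T i).contDiff.contDiffAt.comp x (hc i)
    rw [← norm_iteratedFDeriv_fderiv, hfd, iteratedFDeriv_fun_sum_apply hTc]
    refine (norm_sum_le _ _).trans ?_
    have hsum : ∀ i : Fin n, ∑ α ∈ Finset.piAntidiag (Finset.univ : Finset (Fin n)) k,
        ‖multiDeriv α (partialDeriv i f) x‖ ≤
        ∑ α ∈ Finset.piAntidiag (Finset.univ : Finset (Fin n)) (k + 1), ‖multiDeriv α f x‖ := by
      intro i
      rw [Finset.sum_congr rfl fun α _ => by rw [multiDeriv_partialDeriv hU hf α i hx]]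
      rw [← Finset.sum_image (f := fun α => ‖multiDeriv α f x‖)
        (g := fun α : Fin n → ℕ => α + Pi.single i 1) (fun _ _ _ _ h => add_right_cancel h)]
      refine Finset.sum_le_sum_of_subset_of_nonneg ?_ fun _ _ _ => norm_nonneg _
      intro β hβ
      obtain ⟨α, hα, rfl⟩ := Finset.mem_image.1 hβ
      rw [Finset.mem_piAntidiag] at hα ⊢
      refine ⟨?_, fun _ _ => Finset.mem_univ _⟩
      simp [Finset.sum_add_distrib, hα.1]
    calc ∑ i, ‖iteratedFDeriv ℝ k (fun y => T i (partialDeriv i f y)) x‖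
        ≤ ∑ _i : Fin n, (n : ℝ) ^ k *
          ∑ α ∈ Finset.piAntidiag (Finset.univ : Finset (Fin n)) (k + 1), ‖multiDeriv α f x‖ := by
          refine Finset.sum_le_sum fun i _ => (hle i).trans ((ih (hp i)).trans ?_)
          exact mul_le_mul_of_nonneg_left (hsum i) (by positivity)
      _ = _ := by
          rw [Finset.sum_const, Finset.card_univ, Fintype.card_fin, nsmul_eq_mul, pow_succ]
          ring

end MultiIndex

/-! ### Global injectivity by a damped Newton flow. -/

section GlobalInjectivity

variable {E : Type*} [NormedAddCommGroup E] [NormedSpace ℝ E]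

/-- The mean value inequality on the segment, applied to `f` minus its linearization at `x`. The
sharp constant `L / 2` is not needed. -/
theorem norm_sub_sub_le_of_lipschitz_fderiv {f : E → E} {A : E → E →L[ℝ] E} {L : ℝ}
    (hf : ∀ x, HasFDerivAt f (A x) x) (hA : ∀ x y, ‖A x - A y‖ ≤ L * ‖x - y‖) (hL : 0 ≤ L)
    (x v : E) : ‖f (x + v) - f x - A x v‖ ≤ L * ‖v‖ ^ 2 := by
  have h := (convex_segment x (x + v)).norm_image_sub_le_of_norm_hasFDerivWithin_le'
    (f := f) (f' := A) (φ := A x) (C := L * ‖v‖) (fun y _ => (hf y).hasFDerivWithinAt) ?_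
    (left_mem_segment ℝ x (x + v)) (right_mem_segment ℝ x (x + v))
  · simpa [pow_two, mul_assoc] using h
  · intro y hy
    refine (hA y x).trans (mul_le_mul_of_nonneg_left ?_ hL)
    have := norm_sub_le_of_mem_segment hy
    simpa using this

/-- A `C¹` self-map of a Banach space whose derivative is Lipschitz and uniformly invertible is
injective: the damped Newton iteration gives a locally constant map onto each fibre. -/
theorem injective_of_lipschitz_fderiv [CompleteSpace E] {f : E → E} {A J : E → E →L[ℝ] E}
    {L M : ℝ} (hf : ∀ x, HasFDerivAt f (A x) x) (hA : ∀ x y, ‖A x - A y‖ ≤ L * ‖x - y‖)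
    (hAJ : ∀ x v, A x (J x v) = v) (hJA : ∀ x v, J x (A x v) = v) (hJ : ∀ x, ‖J x‖ ≤ M)
    (hL : 0 < L) (hM : 0 < M) : Function.Injective f := by
  -- Fibres are uniformly discrete: on a fibre the first-order term is at most the quadratic error,
  -- which gives `‖x - y‖ ≤ L M ‖x - y‖²`.
  have hsep : ∀ x y, f x = f y → ‖x - y‖ < (L * M)⁻¹ → x = y := by
    intro x y hxy hlt
    have h1 := norm_sub_sub_le_of_lipschitz_fderiv hf hA hL.le y (x - y)
    have h2 : ‖x - y‖ ≤ M * ‖A y (x - y)‖ := by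
      calc ‖x - y‖ = ‖J y (A y (x - y))‖ := by rw [hJA]
        _ ≤ ‖J y‖ * ‖A y (x - y)‖ := (J y).le_opNorm _
        _ ≤ _ := mul_le_mul_of_nonneg_right (hJ y) (norm_nonneg _)
    rw [add_sub_cancel, hxy, sub_self, zero_sub, norm_neg] at h1
    have h3 : ‖x - y‖ ≤ (L * M * ‖x - y‖) * ‖x - y‖ := by nlinarith
    have h4 : L * M * ‖x - y‖ < 1 := by
      rw [← mul_inv_cancel₀ (mul_pos hL hM).ne']
      exact mul_lt_mul_of_pos_left hlt (mul_pos hL hM)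
    have h5 : ‖x - y‖ = 0 := by
      by_contra hne
      have : 0 < ‖x - y‖ := lt_of_le_of_ne (norm_nonneg _) (Ne.symm hne)
      nlinarith
    exact sub_eq_zero.1 (norm_eq_zero.1 h5)
  -- By the resolvent identity `J x - J y = J x (A y - A x) J y`, the inverse is Lipschitz.
  have hJc : Continuous J := by
    refine (LipschitzWith.of_dist_le' (K := M * L * M) fun x y => ?_).continuous
    rw [dist_eq_norm, dist_eq_norm]
    refine ContinuousLinearMap.opNorm_le_bound _ (by positivity) fun v => ?_
    have : (J x - J y) v = J x ((A y - A x) (J y v)) := by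
      simp [hAJ, hJA]
    rw [this]
    calc _ ≤ ‖J x‖ * (‖A y - A x‖ * (‖J y‖ * ‖v‖)) := by
          refine (J x).le_opNorm_of_le (((A y - A x)).le_opNorm_of_le ((J y).le_opNorm v))
      _ ≤ M * (L * ‖x - y‖ * (M * ‖v‖)) := by
          have := hA y x
          rw [norm_sub_rev y x] at this
          gcongr
          · exact hJ x
          · exact hJ y
      _ = _ := by ring
  have hfc : Continuous f := continuous_iff_continuousAt.2 fun x => (hf x).continuousAt
  intro p₀ p₁ hp
  set y₀ := f p₀ with hy₀
  -- This value makes the quadratic error of a Newton step with damping `H` at most `(H / 2) e`, so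
  -- the residual `e` shrinks by the factor `1 - H / 2` at any starting point.
  set κ : ℝ := 2 * L * M ^ 2 with hκ
  have hκ0 : 0 < κ := by positivity
  set e : E → ℝ := fun x => ‖f x - y₀‖ with he
  have he0 : ∀ x, 0 ≤ e x := fun x => norm_nonneg _
  set H : ℝ → ℝ := fun s => (max 1 (κ * s))⁻¹ with hH
  have hHpos : ∀ s, 0 < H s := fun s => inv_pos.2 (lt_of_lt_of_le one_pos (le_max_left _ _))
  have hH1 : ∀ s, H s ≤ 1 := fun s => inv_le_one_of_one_le₀ (le_max_left _ _)
  have hHanti : ∀ s t, s ≤ t → H t ≤ H s := by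
    intro s t hst
    exact inv_anti₀ (lt_of_lt_of_le one_pos (le_max_left _ _))
      (max_le_max le_rfl (mul_le_mul_of_nonneg_left hst hκ0.le))
  have hHκ : ∀ s, 0 ≤ s → κ * (H s * s) ≤ 1 := by
    intro s hs
    have : κ * s ≤ max 1 (κ * s) := le_max_right _ _
    calc κ * (H s * s) = (κ * s) * H s := by ring
      _ ≤ max 1 (κ * s) * H s := mul_le_mul_of_nonneg_right this (hHpos s).le
      _ = 1 := mul_inv_cancel₀ (lt_of_lt_of_le one_pos (le_max_left _ _)).ne'
  set N : E → E := fun x => x + -(H (e x) • J x (f x - y₀)) with hN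
  have hec : Continuous e := (hfc.sub continuous_const).norm
  have hHc : Continuous H := by
    refine Continuous.inv₀ (by fun_prop) fun s => ?_
    exact (lt_of_lt_of_le one_pos (le_max_left _ _)).ne'
  have hNc : Continuous N := by
    refine continuous_id.add (((hHc.comp hec).smul ?_).neg)
    exact hJc.clm_apply (hfc.sub continuous_const)
  have hstep : ∀ x, ‖H (e x) • J x (f x - y₀)‖ ≤ H (e x) * (M * e x) := by
    intro x
    rw [norm_smul, Real.norm_of_nonneg (hHpos _).le]
    exact mul_le_mul_of_nonneg_left ((J x).le_of_opNorm_le (hJ x) _) (hHpos _).le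
  have hstep' : ∀ x, dist x (N x) ≤ M * e x := by
    intro x
    rw [dist_eq_norm]
    simp only [hN, sub_add_cancel_left, neg_neg]
    refine (hstep x).trans ?_
    exact mul_le_of_le_one_left (mul_nonneg hM.le (he0 x)) (hH1 _)
  have heN : ∀ x, e (N x) ≤ (1 - H (e x) / 2) * e x := by
    intro x
    have h1 := norm_sub_sub_le_of_lipschitz_fderiv hf hA hL.le x (-(H (e x) • J x (f x - y₀)))
    have h2 : f (N x) - y₀ = (f (N x) - f x - A x (-(H (e x) • J x (f x - y₀)))) +
        (1 - H (e x)) • (f x - y₀) := by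
      simp only [map_neg, map_smul, hAJ, sub_smul, one_smul]
      abel
    have h3 : L * (H (e x) * (M * e x)) ^ 2 ≤ H (e x) / 2 * e x := by
      have := hHκ (e x) (he0 x)
      have h4 : L * (H (e x) * (M * e x)) ^ 2 = (κ * (H (e x) * e x)) * (H (e x) / 2 * e x) := by
        rw [hκ]; ring
      rw [h4]
      exact mul_le_of_le_one_left (mul_nonneg (half_pos (hHpos _)).le (he0 x)) this
    calc e (N x) = ‖f (N x) - y₀‖ := rfl
      _ ≤ L * (H (e x) * (M * e x)) ^ 2 + (1 - H (e x)) * e x := by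
          rw [h2]
          refine (norm_add_le _ _).trans (add_le_add ?_ ?_)
          · refine h1.trans (mul_le_mul_of_nonneg_left ?_ hL.le)
            rw [norm_neg]
            exact pow_le_pow_left₀ (norm_nonneg _) (hstep x) 2
          · rw [norm_smul, Real.norm_of_nonneg (by linarith [hH1 (e x)])]
      _ ≤ _ := by linarith
  -- The damping weakens as the residual falls, so one contraction ratio serves the whole sublevel
  -- set `e ≤ R`. This uniformity is what makes the limit `P` locally constant.
  have hiter : ∀ R x, e x ≤ R → ∀ k, e (N^[k] x) ≤ R * (1 - H R / 2) ^ k := by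
    intro R x hx k
    have hr0 : 0 ≤ 1 - H R / 2 := by linarith [hH1 R]
    have hR : 0 ≤ R := (he0 x).trans hx
    induction k with
    | zero => simpa using hx
    | succ k ih =>
      have hle : e (N^[k] x) ≤ R := ih.trans (mul_le_of_le_one_right hR
        (pow_le_one₀ hr0 (by linarith [hHpos R])))
      rw [Function.iterate_succ_apply']
      calc e (N (N^[k] x)) ≤ (1 - H (e (N^[k] x)) / 2) * e (N^[k] x) := heN _
        _ ≤ (1 - H R / 2) * (R * (1 - H R / 2) ^ k) := by
            have := hHanti _ _ hle
            exact mul_le_mul (by linarith) ih (he0 _) hr0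
        _ = _ := by ring
  have hdist : ∀ R x, e x ≤ R → ∀ k, dist (N^[k] x) (N^[k + 1] x) ≤
      (M * R) * (1 - H R / 2) ^ k := by
    intro R x hx k
    rw [Function.iterate_succ_apply']
    refine (hstep' _).trans ?_
    rw [mul_assoc]
    exact mul_le_mul_of_nonneg_left (hiter R x hx k) hM.le
  have hr1 : ∀ R, 1 - H R / 2 < 1 := fun R => by linarith [hHpos R]
  have hlim : ∀ x, ∃ z, Filter.Tendsto (fun k => N^[k] x) Filter.atTop (nhds z) := fun x =>
    cauchySeq_tendsto_of_complete
      (cauchySeq_of_le_geometric _ _ (hr1 (e x)) (hdist (e x) x le_rfl))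
  choose P hP using hlim
  have hroot : ∀ x, f (P x) = y₀ := by
    intro x
    have h1 : Filter.Tendsto (fun k => e (N^[k] x)) Filter.atTop (nhds (e (P x))) :=
      (hec.tendsto _).comp (hP x)
    have h2 : Filter.Tendsto (fun k => e x * (1 - H (e x) / 2) ^ k) Filter.atTop (nhds 0) := by
      have := (tendsto_pow_atTop_nhds_zero_of_lt_one (r := 1 - H (e x) / 2)
        (by linarith [hH1 (e x)]) (hr1 _)).const_mul (e x)
      simpa using this
    have h3 : e (P x) ≤ 0 := le_of_tendsto_of_tendsto' h1 h2 (hiter _ x le_rfl)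
    exact sub_eq_zero.1 (norm_le_zero_iff.1 h3)
  -- Continuity of finitely many Newton steps and the uniform geometric tail bring `P x` within `(L
  -- M)⁻¹` of `P x₀`. Both lie in the fibre, so they agree by `hsep`. As `P` fixes the fibre and the
  -- space is connected, the fibre is one point.
  have hPloc : IsLocallyConstant P := by
    rw [IsLocallyConstant.iff_eventually_eq]
    intro x₀
    set R := e x₀ + 1 with hR
    set η := (L * M)⁻¹ with hη
    have hη0 : 0 < η := inv_pos.2 (mul_pos hL hM)
    have htail : ∀ x, e x ≤ R → ∀ k, dist (N^[k] x) (P x) ≤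
        (M * R) * (1 - H R / 2) ^ k / (1 - (1 - H R / 2)) := fun x hx k =>
      dist_le_of_le_geometric_of_tendsto _ _ (hr1 R) (hdist R x hx) (hP x) k
    obtain ⟨k, hk⟩ : ∃ k, (M * R) * (1 - H R / 2) ^ k / (1 - (1 - H R / 2)) < η / 3 := by
      have h2 : Filter.Tendsto (fun k => (M * R) * (1 - H R / 2) ^ k / (1 - (1 - H R / 2)))
          Filter.atTop (nhds 0) := by
        have := ((tendsto_pow_atTop_nhds_zero_of_lt_one (r := 1 - H R / 2)
          (by linarith [hH1 R]) (hr1 _)).const_mul (M * R)).div_const (1 - (1 - H R / 2))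
        simpa using this
      exact (h2.eventually_lt_const (by positivity)).exists
    have hk1 : ∀ᶠ x in nhds x₀, dist (N^[k] x) (N^[k] x₀) < η / 3 :=
      Metric.tendsto_nhds.1 ((hNc.iterate k).tendsto x₀) _ (by positivity)
    have hk2 : ∀ᶠ x in nhds x₀, e x < R := (hec.tendsto x₀).eventually_lt_const (by linarith)
    filter_upwards [hk1, hk2] with x hx1 hx2
    refine hsep _ _ ((hroot x).trans (hroot x₀).symm) ?_
    rw [← dist_eq_norm]
    have t1 := htail x hx2.le k
    have t2 := htail x₀ (by linarith) k
    have := dist_triangle4 (P x) (N^[k] x) (N^[k] x₀) (P x₀)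
    rw [dist_comm (P x) (N^[k] x)] at this
    linarith
  have hfix : ∀ x, f x = y₀ → P x = x := by
    intro x hx
    have hNx : N x = x := by simp [hN, hx]
    have : ∀ k, N^[k] x = x := fun k => Function.iterate_fixed hNx k
    exact tendsto_nhds_unique (hP x) (by simp [this])
  have hconst : P p₀ = P p₁ := hPloc.apply_eq_of_preconnectedSpace p₀ p₁
  rw [hfix p₀ rfl, hfix p₁ hp.symm] at hconst
  exact hconst

end GlobalInjectivity

/-! ### Partial derivatives in one variable as derivatives on the product. -/

section Slices

variable {n : ℕ}

/-- The `i`-th basis vector of the first factor of `ℝⁿ × ℝⁿ`. -/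
noncomputable def leftVec (i : Fin n) : EuclideanSpace ℝ (Fin n) × EuclideanSpace ℝ (Fin n) :=
  (stdVec i, 0)

/-- The `i`-th basis vector of the second factor of `ℝⁿ × ℝⁿ`. -/
noncomputable def rightVec (i : Fin n) : EuclideanSpace ℝ (Fin n) × EuclideanSpace ℝ (Fin n) :=
  (0, stdVec i)

/-- The set `ℝⁿ × (ℝⁿ ∖ 0)`. -/
def phaseDomain (n : ℕ) : Set (EuclideanSpace ℝ (Fin n) × EuclideanSpace ℝ (Fin n)) :=
  Set.univ ×ˢ {0}ᶜ

theorem isOpen_phaseDomain : IsOpen (phaseDomain n) :=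
  isOpen_univ.prod isOpen_compl_singleton

theorem mem_phaseDomain {x ξ : EuclideanSpace ℝ (Fin n)} (hξ : ξ ≠ 0) : (x, ξ) ∈ phaseDomain n :=
  ⟨Set.mem_univ _, hξ⟩

variable {f : EuclideanSpace ℝ (Fin n) × EuclideanSpace ℝ (Fin n) → ℝ}

theorem iterDir_slice_right (hf : ContDiffOn ℝ ∞ f (phaseDomain n)) (I : List (Fin n))
    (x : EuclideanSpace ℝ (Fin n)) : Set.EqOn (iterDir (I.map stdVec) fun ξ => f (x, ξ))
      (fun ξ => iterDir (I.map rightVec) f (x, ξ)) {0}ᶜ := by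
  induction I with
  | nil => exact fun _ _ => rfl
  | cons i I ih =>
    intro ξ hξ
    simp only [List.map_cons, iterDir_cons]
    rw [(ih.eventuallyEq_of_mem (isOpen_compl_singleton.mem_nhds hξ)).fderiv_eq]
    have hd : DifferentiableAt ℝ (iterDir (I.map rightVec) f) (x, ξ) :=
      ((contDiffOn_iterDir isOpen_phaseDomain hf _).contDiffAt
        (isOpen_phaseDomain.mem_nhds (mem_phaseDomain hξ))).differentiableAt (by simp)
    have := hd.hasFDerivAt.comp ξ (hasFDerivAt_prodMk_right (𝕜 := ℝ) x ξ)
    rw [show (fun ξ => iterDir (I.map rightVec) f (x, ξ)) =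
      iterDir (I.map rightVec) f ∘ fun ξ => (x, ξ) from rfl, this.fderiv]
    simp [rightVec]

theorem iterDir_slice_left (hf : ContDiffOn ℝ ∞ f (phaseDomain n)) (J : List (Fin n))
    {ξ : EuclideanSpace ℝ (Fin n)} (hξ : ξ ≠ 0) : iterDir (J.map stdVec) (fun x => f (x, ξ)) =
      fun x => iterDir (J.map leftVec) f (x, ξ) := by
  induction J with
  | nil => rfl
  | cons i J ih =>
    funext x
    simp only [List.map_cons, iterDir_cons]
    rw [ih]
    have hd : DifferentiableAt ℝ (iterDir (J.map leftVec) f) (x, ξ) :=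
      ((contDiffOn_iterDir isOpen_phaseDomain hf _).contDiffAt
        (isOpen_phaseDomain.mem_nhds (mem_phaseDomain hξ))).differentiableAt (by simp)
    have := hd.hasFDerivAt.comp x (hasFDerivAt_prodMk_left (𝕜 := ℝ) x ξ)
    rw [show (fun x => iterDir (J.map leftVec) f (x, ξ)) =
      iterDir (J.map leftVec) f ∘ fun x => (x, ξ) from rfl, this.fderiv]
    simp [leftVec]

theorem ContDiffOn.slice_right (hf : ContDiffOn ℝ ∞ f (phaseDomain n))
    (x : EuclideanSpace ℝ (Fin n)) : ContDiffOn ℝ ∞ (fun ξ => f (x, ξ)) {0}ᶜ :=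
  hf.comp (contDiff_prodMk_right x).contDiffOn fun _ hξ => mem_phaseDomain hξ

theorem ContDiffOn.slice_left (hf : ContDiffOn ℝ ∞ f (phaseDomain n))
    {ξ : EuclideanSpace ℝ (Fin n)} (hξ : ξ ≠ 0) : ContDiff ℝ ∞ (fun x => f (x, ξ)) := by
  rw [← contDiffOn_univ]
  exact hf.comp (contDiff_prodMk_left ξ).contDiffOn fun _ _ => mem_phaseDomain hξ

/-- Once all derivatives act on one function of `(x, ξ)`, those in `x` and those in `ξ` may be
interchanged. -/
theorem multiDeriv_multiDeriv_eq_iterDir (hf : ContDiffOn ℝ ∞ f (phaseDomain n))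
    (α β : Fin n → ℕ) (x : EuclideanSpace ℝ (Fin n)) {ξ : EuclideanSpace ℝ (Fin n)} (hξ : ξ ≠ 0) :
    multiDeriv α (fun ξ' => multiDeriv β (fun x' => f (x', ξ')) x) ξ =
      iterDir ((indexList α).map rightVec ++ (indexList β).map leftVec) f (x, ξ) := by
  have h1 : Set.EqOn (fun ξ' => multiDeriv β (fun x' => f (x', ξ')) x)
      (fun ξ' => iterDir ((indexList β).map leftVec) f (x, ξ')) {0}ᶜ := by
    intro ξ' hξ'
    simp only [multiDeriv_eq_iterDir]
    rw [iterDir_slice_left hf _ hξ']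
  rw [multiDeriv_eq_iterDir, iterDir_congr isOpen_compl_singleton h1 _ hξ, iterDir_append]
  exact iterDir_slice_right (contDiffOn_iterDir isOpen_phaseDomain hf _) _ x hξ

end Slices

/-! ### The phase estimates in any order of differentiation. -/

section PhaseBounds

variable {n : ℕ} {B : (Fin n → ℕ) → (Fin n → ℕ) → ℝ}
  {φ : EuclideanSpace ℝ (Fin n) → EuclideanSpace ℝ (Fin n) → ℝ}

theorem PhaseClass.contDiffOn {k : ℕ} (h : PhaseClass k B φ) :
    ContDiffOn ℝ ∞ (fun z : EuclideanSpace ℝ (Fin n) × EuclideanSpace ℝ (Fin n) => φ z.1 z.2)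
      (phaseDomain n) := h.smooth

/-- The class differentiates in `x` before `ξ`, whereas the gradient map requires the opposite
order; hence the arbitrary permutation `L`. Multiplying through by `‖ξ‖` removes the negative power.
-/
theorem PhaseClass.iterDir_bound (h : PhaseClass 2 B φ) (I J : List (Fin n))
    (hIJ : 2 ≤ I.length + J.length)
    {L : List (EuclideanSpace ℝ (Fin n) × EuclideanSpace ℝ (Fin n))}
    (hL : L.Perm (I.map rightVec ++ J.map leftVec)) (x : EuclideanSpace ℝ (Fin n))
    {ξ : EuclideanSpace ℝ (Fin n)} (hξ : ξ ≠ 0) :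
    ‖ξ‖ ^ I.length * |iterDir L (fun z => φ z.1 z.2) (x, ξ)| ≤
      B (fun i => I.count i) (fun i => J.count i) * ‖ξ‖ := by
  have hb := h.bound (fun i => I.count i) (fun i => J.count i)
    (by simpa only [multiOrder_count] using hIJ) x ξ hξ
  have hp : L.Perm ((indexList fun i => I.count i).map rightVec ++
      (indexList fun i => J.count i).map leftVec) :=
    hL.trans (((indexList_count_perm I).symm.map _).append ((indexList_count_perm J).symm.map _))
  rw [multiDeriv_multiDeriv_eq_iterDir h.contDiffOn _ _ x hξ, multiOrder_count,
    ← iterDir_perm isOpen_phaseDomain h.contDiffOn hp (mem_phaseDomain hξ)] at hb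
  have ht : 0 < ‖ξ‖ := norm_pos_iff.2 hξ
  rw [Real.rpow_add ht, Real.rpow_neg_one, Real.rpow_natCast] at hb
  calc _ = ‖ξ‖⁻¹ * ‖ξ‖ ^ I.length * |iterDir L (fun z => φ z.1 z.2) (x, ξ)| * ‖ξ‖ := by
        field_simp
    _ ≤ _ := mul_le_mul_of_nonneg_right hb ht.le

/-- A constant that dominates the pure `ξ`-derivatives of order `k` of a phase. -/
noncomputable def phaseConst (B : (Fin n → ℕ) → (Fin n → ℕ) → ℝ) (k : ℕ) : ℝ :=
  n ^ k * ∑ α ∈ Finset.piAntidiag (Finset.univ : Finset (Fin n)) k, |B α 0|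

theorem phaseConst_nonneg (k : ℕ) : 0 ≤ phaseConst B k :=
  mul_nonneg (by positivity) (Finset.sum_nonneg fun _ _ => abs_nonneg _)

theorem PhaseClass.norm_iteratedFDeriv_le (h : PhaseClass 2 B φ) {k : ℕ} (hk : 2 ≤ k)
    (x : EuclideanSpace ℝ (Fin n)) {ξ : EuclideanSpace ℝ (Fin n)} (hξ : ξ ≠ 0) :
    ‖ξ‖ ^ k * ‖iteratedFDeriv ℝ k (φ x) ξ‖ ≤ phaseConst B k * ‖ξ‖ := by
  have h1 := norm_iteratedFDeriv_le_sum_multiDeriv (isOpen_compl_singleton) (x := ξ) hξ k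
    (h.contDiffOn.slice_right x)
  refine (mul_le_mul_of_nonneg_left h1 (by positivity)).trans ?_
  rw [phaseConst, mul_left_comm, mul_assoc]
  refine mul_le_mul_of_nonneg_left ?_ (by positivity)
  rw [Finset.mul_sum, Finset.sum_mul]
  refine Finset.sum_le_sum fun α hα => ?_
  have hlen : (indexList α).length = k := by
    rw [← multiOrder_count]
    simp only [count_indexList]
    exact (Finset.mem_piAntidiag.1 hα).1
  have h2 := h.iterDir_bound (indexList α) [] (by simp [hlen, hk]) (L := (indexList α).map rightVec)
    (by simp) x hξ
  rw [hlen] at h2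
  simp only [count_indexList, List.count_nil] at h2
  rw [multiDeriv_eq_iterDir, iterDir_slice_right h.contDiffOn _ x hξ, Real.norm_eq_abs]
  exact h2.trans (mul_le_mul_of_nonneg_right (le_abs_self _) (norm_nonneg _))

end PhaseBounds

/-! ### Oscillation of the gradient of a homogeneous function. -/

section Homogeneous

variable {n : ℕ}

/-- With a nonnegative inner product, the squared norm of a convex combination is at least `s² + t²
≥ 1/2`. -/
theorem half_le_norm_of_mem_segment {V : Type*} [NormedAddCommGroup V] [InnerProductSpace ℝ V]
    {ξ η p : V} (hξ : ‖ξ‖ = 1) (hη : ‖η‖ = 1) (h : 0 ≤ inner ℝ ξ η) (hp : p ∈ segment ℝ ξ η) :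
    1 / 2 ≤ ‖p‖ := by
  obtain ⟨s, t, hs, ht, hst, rfl⟩ := hp
  have h1 : ‖s • ξ + t • η‖ ^ 2 = s ^ 2 + 2 * (s * t * inner ℝ ξ η) + t ^ 2 := by
    rw [norm_add_sq_real, norm_smul, norm_smul, hξ, hη, inner_smul_left, inner_smul_right]
    simp only [Real.norm_eq_abs, mul_one, sq_abs]
    simp; ring
  have h2 : 0 ≤ s * t * inner ℝ ξ η := by positivity
  nlinarith [norm_nonneg (s • ξ + t • η), sq_nonneg (s - t)]

variable {g : EuclideanSpace ℝ (Fin n) → ℝ}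

theorem fderiv_smul_of_homogeneous (hd : ∀ ξ, ξ ≠ 0 → DifferentiableAt ℝ g ξ)
    (hg : ∀ ξ, ξ ≠ 0 → ∀ t : ℝ, 0 < t → g (t • ξ) = t * g ξ) {ξ : EuclideanSpace ℝ (Fin n)}
    (hξ : ξ ≠ 0) {t : ℝ} (ht : 0 < t) : fderiv ℝ g (t • ξ) = fderiv ℝ g ξ := by
  have htξ : t • ξ ≠ 0 := smul_ne_zero ht.ne' hξ
  have h1 : HasFDerivAt (fun η => g (t • η)) ((fderiv ℝ g (t • ξ)).comp
      (t • ContinuousLinearMap.id ℝ _)) ξ :=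
    (hd _ htξ).hasFDerivAt.comp ξ ((hasFDerivAt_id ξ).const_smul t)
  have h2 : HasFDerivAt (fun η => t * g η) (t • fderiv ℝ g ξ) ξ :=
    (hd ξ hξ).hasFDerivAt.const_mul t
  have hev : (fun η => g (t • η)) =ᶠ[nhds ξ] fun η => t * g η := by
    filter_upwards [isOpen_compl_singleton.mem_nhds hξ] with η hη using hg η hη t ht
  have h3 := (h1.congr_of_eventuallyEq hev.symm).unique h2
  ext v
  have h4 := DFunLike.congr_fun h3 v
  simp only [ContinuousLinearMap.comp_apply, smul_apply,
    ContinuousLinearMap.id_apply, map_smul, smul_eq_mul] at h4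
  exact mul_left_cancel₀ ht.ne' h4

/-- Euler's identity: differentiate the homogeneity relation in `t` at `t = 1`. -/
theorem fderiv_apply_self_of_homogeneous (hd : ∀ ξ, ξ ≠ 0 → DifferentiableAt ℝ g ξ)
    (hg : ∀ ξ, ξ ≠ 0 → ∀ t : ℝ, 0 < t → g (t • ξ) = t * g ξ) {ξ : EuclideanSpace ℝ (Fin n)}
    (hξ : ξ ≠ 0) : fderiv ℝ g ξ ξ = g ξ := by
  have hd1 : HasFDerivAt g (fderiv ℝ g ξ) ((1 : ℝ) • ξ) := by
    rw [one_smul]; exact (hd ξ hξ).hasFDerivAt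
  have h1 : HasDerivAt (fun t : ℝ => g (t • ξ)) (fderiv ℝ g ξ ξ) 1 := by
    have := hd1.comp_hasDerivAt (1 : ℝ) ((hasDerivAt_id (1 : ℝ)).smul_const ξ)
    simpa [Function.comp_def] using this
  have h2 : HasDerivAt (fun t : ℝ => t * g ξ) (g ξ) 1 := by
    simpa using (hasDerivAt_id (1 : ℝ)).mul_const (g ξ)
  have hev : (fun t : ℝ => g (t • ξ)) =ᶠ[nhds 1] fun t => t * g ξ := by
    filter_upwards [lt_mem_nhds one_pos] with t ht using hg ξ hξ t ht
  exact (h1.congr_of_eventuallyEq hev.symm).unique h2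

/-- The gradient of a function that is homogeneous of degree one oscillates boundedly if its second
derivative is controlled on the unit sphere; the dimension has to be at least two. -/
theorem norm_fderiv_sub_le_of_homogeneous (hn : 2 ≤ n) (hs : ContDiffOn ℝ ∞ g {0}ᶜ)
    (hg : ∀ ξ, ξ ≠ 0 → ∀ t : ℝ, 0 < t → g (t • ξ) = t * g ξ) {C : ℝ} (hC : 0 ≤ C)
    (hb : ∀ ξ, ξ ≠ 0 → ‖ξ‖ ^ 2 * ‖iteratedFDeriv ℝ 2 g ξ‖ ≤ C * ‖ξ‖)
    {ξ : EuclideanSpace ℝ (Fin n)} (hξ : ξ ≠ 0) :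
    ‖fderiv ℝ g ξ - fderiv ℝ g (stdVec ⟨0, by omega⟩)‖ ≤ 8 * C := by
  have hU : IsOpen ({0}ᶜ : Set (EuclideanSpace ℝ (Fin n))) := isOpen_compl_singleton
  have hd : ∀ ξ, ξ ≠ 0 → DifferentiableAt ℝ g ξ := fun ξ hξ =>
    (hs.contDiffAt (hU.mem_nhds hξ)).differentiableAt (by simp)
  have hd2 : ∀ ξ, ξ ≠ 0 → DifferentiableAt ℝ (fderiv ℝ g) ξ := fun ξ hξ =>
    (((hs.contDiffAt (hU.mem_nhds hξ)).fderiv_right (m := 1) (by norm_cast))).differentiableAt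
      (by simp)
  -- The chord has length at most `2` and stays where `‖p‖ ≥ 1/2`; there the second derivative is at
  -- most `C / ‖p‖ ≤ 2 C`.
  have hstep : ∀ ξ η : EuclideanSpace ℝ (Fin n), ‖ξ‖ = 1 → ‖η‖ = 1 → 0 ≤ inner ℝ ξ η →
      ‖fderiv ℝ g ξ - fderiv ℝ g η‖ ≤ 4 * C := by
    intro ξ η hξ hη hin
    have hne : ∀ p ∈ segment ℝ ξ η, 1 / 2 ≤ ‖p‖ := fun p hp =>
      half_le_norm_of_mem_segment hξ hη hin hp
    have := (convex_segment ξ η).norm_image_sub_le_of_norm_fderiv_le (f := fderiv ℝ g)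
      (C := 2 * C) (𝕜 := ℝ) (fun p hp => hd2 p (norm_pos_iff.1 (by linarith [hne p hp]))) ?_
      (right_mem_segment ℝ ξ η) (left_mem_segment ℝ ξ η)
    · refine this.trans ?_
      have : ‖ξ - η‖ ≤ 2 := (norm_sub_le _ _).trans (by linarith)
      nlinarith
    · intro p hp
      have hp2 := hne p hp
      have hp0 : 0 < ‖p‖ := by linarith
      have h1 := hb p (norm_pos_iff.1 hp0)
      have e : ‖fderiv ℝ (fderiv ℝ g) p‖ = ‖iteratedFDeriv ℝ 2 g p‖ := by
        rw [← norm_iteratedFDeriv_fderiv, ← norm_iteratedFDeriv_fderiv, norm_iteratedFDeriv_zero]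
      rw [e]
      have h2 : ‖p‖ * ‖iteratedFDeriv ℝ 2 g p‖ ≤ C := by
        refine le_of_mul_le_mul_left ?_ hp0
        calc _ = ‖p‖ ^ 2 * ‖iteratedFDeriv ℝ 2 g p‖ := by ring
          _ ≤ _ := h1.trans (le_of_eq (mul_comm _ _))
      nlinarith [norm_nonneg (iteratedFDeriv ℝ 2 g p)]
  set e₀ : EuclideanSpace ℝ (Fin n) := stdVec ⟨0, by omega⟩ with he₀
  set e₁ : EuclideanSpace ℝ (Fin n) := stdVec ⟨1, by omega⟩ with he₁
  have h01 : inner ℝ e₁ e₀ = (0 : ℝ) := by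
    simp [he₀, he₁, stdVec, EuclideanSpace.inner_single_left]
  have ht : 0 < ‖ξ‖ := norm_pos_iff.2 hξ
  set η := ‖ξ‖⁻¹ • ξ with hη
  have hη1 : ‖η‖ = 1 := by rw [hη, norm_smul, norm_inv, norm_norm, inv_mul_cancel₀ ht.ne']
  rw [← fderiv_smul_of_homogeneous hd hg hξ (inv_pos.2 ht), ← hη]
  -- The path from `η` to `e₀` passes through `w = ±e₁`, with the sign that makes the angle with `η`
  -- at most a right angle. The vector `e₁` exists because `2 ≤ n`; in dimension one the sphere is
  -- disconnected.
  have key : ∀ w : EuclideanSpace ℝ (Fin n), ‖w‖ = 1 → inner ℝ w e₀ = (0 : ℝ) → 0 ≤ inner ℝ η w →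
      ‖fderiv ℝ g η - fderiv ℝ g e₀‖ ≤ 8 * C := by
    intro w hw hw0 hηw
    have t1 := hstep η w hη1 hw hηw
    have t2 := hstep w e₀ hw (norm_stdVec _) hw0.ge
    calc _ = ‖(fderiv ℝ g η - fderiv ℝ g w) + (fderiv ℝ g w - fderiv ℝ g e₀)‖ := by
          rw [sub_add_sub_cancel]
      _ ≤ _ := (norm_add_le _ _).trans (by linarith)
  by_cases hpos : 0 ≤ inner ℝ η e₁
  · exact key e₁ (norm_stdVec _) h01 hpos
  · refine key (-e₁) (by rw [norm_neg]; exact norm_stdVec _) (by rw [inner_neg_left, h01, neg_zero]) ?_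
    rw [inner_neg_right]; linarith

end Homogeneous

/-! ### The phase minus its linear part is a symbol of order one. -/

section ReducedPhase

variable {n : ℕ} {B : (Fin n → ℕ) → (Fin n → ℕ) → ℝ}
  {φ : EuclideanSpace ℝ (Fin n) → EuclideanSpace ℝ (Fin n) → ℝ}

/-- The gradient `∇_ξ φ(x, ζ)`. -/
noncomputable def phaseGradient (φ : EuclideanSpace ℝ (Fin n) → EuclideanSpace ℝ (Fin n) → ℝ)
    (ζ x : EuclideanSpace ℝ (Fin n)) : EuclideanSpace ℝ (Fin n) :=
  ∑ k, partialDeriv k (φ x) ζ • stdVec k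

theorem inner_phaseGradient (ζ x ξ : EuclideanSpace ℝ (Fin n)) :
    inner ℝ (phaseGradient φ ζ x) ξ = fderiv ℝ (φ x) ζ ξ := by
  rw [fderiv_eq_sum_partialDeriv, phaseGradient, sum_inner]
  simp [inner_smul_left, stdVec, EuclideanSpace.inner_single_left, mul_comm]

theorem iteratedFDeriv_clm_eq_zero {V F : Type*} [NormedAddCommGroup V] [NormedSpace ℝ V]
    [NormedAddCommGroup F] [NormedSpace ℝ F] (L : V →L[ℝ] F) {k : ℕ} (hk : 2 ≤ k) (x : V) :
    iteratedFDeriv ℝ k L x = 0 := by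
  obtain ⟨j, rfl⟩ : ∃ j, k = j + 1 := ⟨k - 1, by omega⟩
  rw [← norm_eq_zero, ← norm_iteratedFDeriv_fderiv]
  have : fderiv ℝ (L : V → F) = fun _ => L := by funext y; exact L.fderiv
  rw [this, iteratedFDeriv_const_of_ne (by omega)]
  simp

/-- Order one is the oscillation bound for the gradient; order zero follows from it by Euler's
identity; from order two on the linear term disappears and the class supplies the bound. Nothing
depends on `x`. -/
theorem PhaseClass.reduced_bound (hn : 2 ≤ n) (h : PhaseClass 2 B φ) (M : ℕ)
    (x : EuclideanSpace ℝ (Fin n)) :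
    ∀ j ≤ M, ∀ ξ, ξ ≠ 0 → ‖ξ‖ ^ j * ‖iteratedFDeriv ℝ j
      (fun ξ => φ x ξ - inner ℝ (phaseGradient φ (stdVec ⟨0, by omega⟩) x) ξ) ξ‖ ≤
        (8 * phaseConst B 2 + ∑ k ∈ Finset.range (M + 1), phaseConst B k) * ‖ξ‖ := by
  intro j hj ξ hξ
  set ζ : EuclideanSpace ℝ (Fin n) := stdVec ⟨0, by omega⟩ with hζ
  set L : EuclideanSpace ℝ (Fin n) →L[ℝ] ℝ := fderiv ℝ (φ x) ζ with hL
  have hU : IsOpen ({0}ᶜ : Set (EuclideanSpace ℝ (Fin n))) := isOpen_compl_singleton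
  have hs : ContDiffOn ℝ ∞ (φ x) {0}ᶜ := h.contDiffOn.slice_right x
  have hd : ∀ ξ, ξ ≠ 0 → DifferentiableAt ℝ (φ x) ξ := fun ξ hξ =>
    (hs.contDiffAt (hU.mem_nhds hξ)).differentiableAt (by simp)
  have hθ : (fun ξ => φ x ξ - inner ℝ (phaseGradient φ ζ x) ξ) = φ x - L := by
    funext η
    rw [inner_phaseGradient]; rfl
  rw [hθ]
  have hgrad : ‖fderiv ℝ (φ x) ξ - L‖ ≤ 8 * phaseConst B 2 :=
    norm_fderiv_sub_le_of_homogeneous hn hs (fun ξ hξ t ht => h.homogeneous x ξ hξ t ht)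
      (phaseConst_nonneg 2) (fun ξ hξ => h.norm_iteratedFDeriv_le le_rfl x hξ) hξ
  have hsum : 0 ≤ ∑ k ∈ Finset.range (M + 1), phaseConst B k :=
    Finset.sum_nonneg fun _ _ => phaseConst_nonneg _
  have hle8 : 8 * phaseConst B 2 ≤
      8 * phaseConst B 2 + ∑ k ∈ Finset.range (M + 1), phaseConst B k := by linarith
  match j, hj with
  | 0, _ =>
    rw [pow_zero, one_mul, norm_iteratedFDeriv_zero]
    have e : (φ x - L) ξ = (fderiv ℝ (φ x) ξ - L) ξ := by
      rw [Pi.sub_apply, sub_apply,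
        fderiv_apply_self_of_homogeneous hd (fun ξ hξ t ht => h.homogeneous x ξ hξ t ht) hξ]
    rw [e]
    exact ((fderiv ℝ (φ x) ξ - L).le_opNorm ξ).trans
      (mul_le_mul_of_nonneg_right (hgrad.trans hle8) (norm_nonneg _))
  | 1, _ =>
    rw [pow_one, mul_comm]
    refine mul_le_mul_of_nonneg_right (le_trans ?_ (hgrad.trans hle8)) (norm_nonneg _)
    rw [← zero_add 1, ← norm_iteratedFDeriv_fderiv, norm_iteratedFDeriv_zero,
      fderiv_sub (hd ξ hξ) L.differentiableAt, L.fderiv]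
  | k + 2, hj =>
    have hm : ∀ m : ℕ, (m : WithTop ℕ∞) ≤ ((⊤ : ℕ∞) : WithTop ℕ∞) := fun m => by exact_mod_cast le_top
    have hc : ContDiffAt ℝ (k + 2 : ℕ) (φ x) ξ :=
      (hs.contDiffAt (hU.mem_nhds hξ)).of_le (hm _)
    rw [iteratedFDeriv_sub_apply hc L.contDiff.contDiffAt,
      iteratedFDeriv_clm_eq_zero L (by omega), sub_zero]
    refine (h.norm_iteratedFDeriv_le (by omega) x hξ).trans
      (mul_le_mul_of_nonneg_right ?_ (norm_nonneg _))
    have : phaseConst B (k + 2) ≤ ∑ k ∈ Finset.range (M + 1), phaseConst B k :=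
      Finset.single_le_sum (f := phaseConst B) (fun _ _ => phaseConst_nonneg _)
        (Finset.mem_range.2 (by omega))
    linarith [phaseConst_nonneg (B := B) 2]

theorem PhaseClass.contDiffOn_reduced (h : PhaseClass 2 B φ) (v x : EuclideanSpace ℝ (Fin n)) :
    ContDiffOn ℝ ∞ (fun ξ => φ x ξ - inner ℝ v ξ) {0}ᶜ :=
  (h.contDiffOn.slice_right x).sub (contDiff_const.inner ℝ contDiff_id).contDiffOn

end ReducedPhase

/-! ### The map `x ↦ ∇_ξ φ(x, ζ)`: injectivity and change of variables. -/

section GradientMap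

variable {n : ℕ} {B : (Fin n → ℕ) → (Fin n → ℕ) → ℝ}
  {φ : EuclideanSpace ℝ (Fin n) → EuclideanSpace ℝ (Fin n) → ℝ}

theorem PhaseClass.partialDeriv_eq (h : PhaseClass 2 B φ) (k : Fin n)
    {ζ : EuclideanSpace ℝ (Fin n)} (hζ : ζ ≠ 0) : (fun x => partialDeriv k (φ x) ζ) =
      fun x => iterDir [rightVec k] (fun z => φ z.1 z.2) (x, ζ) := by
  funext x
  exact iterDir_slice_right h.contDiffOn [k] x hζ

theorem PhaseClass.contDiff_partialDeriv (h : PhaseClass 2 B φ) (k : Fin n)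
    {ζ : EuclideanSpace ℝ (Fin n)} (hζ : ζ ≠ 0) :
    ContDiff ℝ ∞ (fun x => partialDeriv k (φ x) ζ) := by
  rw [h.partialDeriv_eq k hζ]
  exact ContDiffOn.slice_left (contDiffOn_iterDir isOpen_phaseDomain h.contDiffOn _) hζ

/-- One derivative in `ξ` and at least one in `x` make total order two, so `Φ²` applies. Order `1`
bounds the derivative of the gradient map, order `2` makes it Lipschitz. -/
theorem PhaseClass.exists_norm_iteratedFDeriv_partialDeriv_le (h : PhaseClass 2 B φ) (k : Fin n)
    {ζ : EuclideanSpace ℝ (Fin n)} (hζ : ‖ζ‖ = 1) {j : ℕ} (hj : 1 ≤ j) : ∃ C : ℝ, ∀ x,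
      ‖iteratedFDeriv ℝ j (fun x => partialDeriv k (φ x) ζ) x‖ ≤ C := by
  have hζ0 : ζ ≠ 0 := norm_pos_iff.1 (by rw [hζ]; exact one_pos)
  refine ⟨n ^ j * ∑ β ∈ Finset.piAntidiag (Finset.univ : Finset (Fin n)) j,
    B (fun i => [k].count i) β, fun x => ?_⟩
  refine (norm_iteratedFDeriv_le_sum_multiDeriv isOpen_univ (Set.mem_univ x) j
    (h.contDiff_partialDeriv k hζ0).contDiffOn).trans ?_
  refine mul_le_mul_of_nonneg_left (Finset.sum_le_sum fun β hβ => ?_) (by positivity)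
  have hlen : (indexList β).length = j := by
    rw [← multiOrder_count]
    simp only [count_indexList]
    exact (Finset.mem_piAntidiag.1 hβ).1
  have h2 := h.iterDir_bound [k] (indexList β) (by simp [hlen]; omega)
    (L := (indexList β).map leftVec ++ [rightVec k]) List.perm_append_comm x hζ0
  simp only [count_indexList, hζ, one_pow, one_mul, mul_one] at h2
  rw [h.partialDeriv_eq k hζ0, multiDeriv_eq_iterDir, iterDir_slice_left
    (contDiffOn_iterDir isOpen_phaseDomain h.contDiffOn _) _ hζ0, ← iterDir_append]
  exact h2

/-- The derivative of `x ↦ ∇_ξ φ(x, ζ)`. -/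
noncomputable def phaseGradientDeriv
    (φ : EuclideanSpace ℝ (Fin n) → EuclideanSpace ℝ (Fin n) → ℝ)
    (ζ x : EuclideanSpace ℝ (Fin n)) : EuclideanSpace ℝ (Fin n) →L[ℝ] EuclideanSpace ℝ (Fin n) :=
  ∑ k, (fderiv ℝ (fun x => partialDeriv k (φ x) ζ) x).smulRight (stdVec k)

theorem PhaseClass.hasFDerivAt_phaseGradient (h : PhaseClass 2 B φ)
    {ζ : EuclideanSpace ℝ (Fin n)} (hζ : ζ ≠ 0) (x : EuclideanSpace ℝ (Fin n)) :
    HasFDerivAt (phaseGradient φ ζ) (phaseGradientDeriv φ ζ x) x :=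
  HasFDerivAt.fun_sum fun k _ =>
    ((h.contDiff_partialDeriv k hζ).differentiable (by simp) x).hasFDerivAt.smul_const (stdVec k)

theorem det_phaseGradientDeriv (ζ x : EuclideanSpace ℝ (Fin n)) :
    (phaseGradientDeriv φ ζ x).det = (mixedHessian φ x ζ).det := by
  rw [← Matrix.det_transpose, ContinuousLinearMap.det,
    ← LinearMap.det_toMatrix (EuclideanSpace.basisFun (Fin n) ℝ).toBasis]
  congr 1
  ext k j
  rw [LinearMap.toMatrix_apply]
  simp [phaseGradientDeriv, mixedHessian, partialDeriv, stdVec]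

/-- Operators with `‖A‖ ≤ b` and `|det A| ≥ c`, paired with unit vectors, form a compact set on
which `‖A v‖` is continuous and positive, hence bounded below. -/
theorem exists_norm_le_mul_norm_of_det {V : Type*} [NormedAddCommGroup V] [NormedSpace ℝ V]
    [FiniteDimensional ℝ V] (b c : ℝ) (hc : 0 < c) : ∃ M : ℝ, 0 < M ∧ ∀ A : V →L[ℝ] V,
      ‖A‖ ≤ b → c ≤ |A.det| → ∀ v, ‖v‖ ≤ M * ‖A v‖ := by
  have : ProperSpace V := FiniteDimensional.proper ℝ V
  have : ProperSpace (V →L[ℝ] V) := FiniteDimensional.proper ℝ _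
  set S : Set ((V →L[ℝ] V) × V) :=
    (Metric.closedBall 0 b ∩ {A | c ≤ |A.det|}) ×ˢ Metric.sphere 0 1 with hS
  have hScomp : IsCompact S :=
    ((isCompact_closedBall _ _).inter_right (isClosed_le continuous_const
      ContinuousLinearMap.continuous_det.abs)).prod (isCompact_sphere _ _)
  have hcont : Continuous fun w : (V →L[ℝ] V) × V => ‖w.1 w.2‖ :=
    (continuous_fst.clm_apply continuous_snd).norm
  have hpos : ∀ w ∈ S, 0 < ‖w.1 w.2‖ := by
    rintro ⟨A, v⟩ ⟨⟨_, hA⟩, hv⟩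
    rw [norm_pos_iff]
    intro h0
    have hdet : A.det ≠ 0 := by
      intro h; simp only [Set.mem_ofPred_eq, h, abs_zero] at hA; linarith
    have : v = 0 := by
      apply (A.toContinuousLinearEquivOfDetNeZero hdet).injective
      simpa using h0
    rw [mem_sphere_zero_iff_norm, this, norm_zero] at hv
    exact zero_ne_one hv
  rcases S.eq_empty_or_nonempty with hE | hne
  · refine ⟨1, one_pos, fun A hA hAc v => ?_⟩
    by_cases hv : v = 0
    · simp [hv]
    · have : (A, ‖v‖⁻¹ • v) ∈ S := by
        refine ⟨⟨by simpa using hA, hAc⟩, ?_⟩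
        rw [mem_sphere_zero_iff_norm, norm_smul, norm_inv, norm_norm,
          inv_mul_cancel₀ (norm_ne_zero_iff.2 hv)]
      rw [hE] at this
      exact this.elim
  · obtain ⟨w, hw, hmin⟩ := hScomp.exists_isMinOn hne hcont.continuousOn
    refine ⟨‖w.1 w.2‖⁻¹, inv_pos.2 (hpos w hw), fun A hA hAc v => ?_⟩
    by_cases hv : v = 0
    · simp [hv]
    · have hv0 : 0 < ‖v‖ := norm_pos_iff.2 hv
      have hm : (A, ‖v‖⁻¹ • v) ∈ S := by
        refine ⟨⟨by simpa using hA, hAc⟩, ?_⟩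
        rw [mem_sphere_zero_iff_norm, norm_smul, norm_inv, norm_norm, inv_mul_cancel₀ hv0.ne']
      have := hmin hm
      simp only [Set.mem_ofPred_eq, map_smul, norm_smul, norm_inv, norm_norm] at this
      rw [inv_mul_eq_div, le_div_iff₀ (hpos w hw)]
      rwa [inv_mul_eq_div, le_div_iff₀ hv0, mul_comm] at this

theorem PhaseClass.injective_phaseGradient (h : PhaseClass 2 B φ) {c : ℝ} (hc : 0 < c)
    (hnd : StrongNondegenerate c φ) {ζ : EuclideanSpace ℝ (Fin n)} (hζ : ‖ζ‖ = 1) :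
    Function.Injective (phaseGradient φ ζ) := by
  have hζ0 : ζ ≠ 0 := norm_pos_iff.1 (by rw [hζ]; exact one_pos)
  choose b hb using fun k : Fin n => h.exists_norm_iteratedFDeriv_partialDeriv_le k hζ (le_refl 1)
  choose l hl using fun k : Fin n =>
    h.exists_norm_iteratedFDeriv_partialDeriv_le k hζ (one_le_two)
  have hb' : ∀ k x, ‖fderiv ℝ (fun x => partialDeriv k (φ x) ζ) x‖ ≤ b k := by
    intro k x
    have := hb k x
    rwa [← zero_add 1, ← norm_iteratedFDeriv_fderiv, norm_iteratedFDeriv_zero] at this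
  have hl' : ∀ k x y, ‖fderiv ℝ (fun x => partialDeriv k (φ x) ζ) x -
      fderiv ℝ (fun x => partialDeriv k (φ x) ζ) y‖ ≤ l k * ‖x - y‖ := by
    intro k x y
    refine convex_univ.norm_image_sub_le_of_norm_fderiv_le (𝕜 := ℝ) (fun z _ => ?_) (fun z _ => ?_)
      (Set.mem_univ y) (Set.mem_univ x)
    · exact ((h.contDiff_partialDeriv k hζ0).fderiv_right (m := 1) (by norm_cast)).differentiable
        (by simp) z
    · have := hl k z
      rwa [show 2 = 0 + 1 + 1 from rfl, ← norm_iteratedFDeriv_fderiv, ← norm_iteratedFDeriv_fderiv,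
        norm_iteratedFDeriv_zero] at this
  have hA : ∀ x, ‖phaseGradientDeriv φ ζ x‖ ≤ ∑ k, b k := fun x => by
    refine (norm_sum_le _ _).trans (Finset.sum_le_sum fun k _ => ?_)
    rw [ContinuousLinearMap.norm_smulRight_apply, norm_stdVec, mul_one]
    exact hb' k x
  -- The added `1` makes the Lipschitz constant positive, as the injectivity criterion demands.
  have hLip : ∀ x y, ‖phaseGradientDeriv φ ζ x - phaseGradientDeriv φ ζ y‖ ≤
      (∑ k, |l k| + 1) * ‖x - y‖ := by
    intro x y
    have e : phaseGradientDeriv φ ζ x - phaseGradientDeriv φ ζ y =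
        ∑ k, (fderiv ℝ (fun x => partialDeriv k (φ x) ζ) x -
          fderiv ℝ (fun x => partialDeriv k (φ x) ζ) y).smulRight (stdVec k) := by
      rw [phaseGradientDeriv, phaseGradientDeriv, ← Finset.sum_sub_distrib]
      refine Finset.sum_congr rfl fun k _ => ?_
      ext v
      simp [sub_mul]
    rw [e]
    refine (norm_sum_le _ _).trans ?_
    calc _ ≤ ∑ k, |l k| * ‖x - y‖ := by
          refine Finset.sum_le_sum fun k _ => ?_
          rw [ContinuousLinearMap.norm_smulRight_apply, norm_stdVec, mul_one]
          exact (hl' k x y).trans (mul_le_mul_of_nonneg_right (le_abs_self _) (norm_nonneg _))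
      _ ≤ _ := by
          rw [← Finset.sum_mul]
          exact mul_le_mul_of_nonneg_right (by linarith) (norm_nonneg _)
  obtain ⟨M, hM, hMb⟩ := exists_norm_le_mul_norm_of_det (V := EuclideanSpace ℝ (Fin n))
    (∑ k, b k) c hc
  have hdet : ∀ x, c ≤ |(phaseGradientDeriv φ ζ x).det| := fun x => by
    rw [det_phaseGradientDeriv]; exact hnd x ζ hζ0
  have hdet0 : ∀ x, (phaseGradientDeriv φ ζ x).det ≠ 0 := fun x h0 => by
    have := hdet x
    rw [h0, abs_zero] at this
    linarith
  set T := fun x => (phaseGradientDeriv φ ζ x).toContinuousLinearEquivOfDetNeZero (hdet0 x) with hT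
  have hTA : ∀ x v, T x v = phaseGradientDeriv φ ζ x v := fun x v => by simp [hT]
  refine injective_of_lipschitz_fderiv (A := phaseGradientDeriv φ ζ)
    (J := fun x => ((T x).symm : EuclideanSpace ℝ (Fin n) →L[ℝ] EuclideanSpace ℝ (Fin n)))
    (L := ∑ k, |l k| + 1) (M := M)
    (h.hasFDerivAt_phaseGradient hζ0) hLip ?_ ?_ ?_ ?_ hM
  · intro x v
    rw [← hTA]; simp
  · intro x v
    rw [← hTA]; simp
  · intro x
    refine ContinuousLinearMap.opNorm_le_bound _ hM.le fun v => ?_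
    have := hMb _ (hA x) (hdet x) ((T x).symm v)
    rw [← hTA] at this
    simpa using this
  · have : 0 ≤ ∑ k, |l k| := Finset.sum_nonneg fun _ _ => abs_nonneg _
    linarith

/-- Change of variables on `f⁻¹(s)` gives `c μ(f⁻¹(s)) ≤ μ(f(f⁻¹(s))) ≤ μ(s)`. Surjectivity plays no
part, and only `c` enters the bound, not the constants behind injectivity. -/
theorem map_le_smul_of_injective_of_det {V : Type*} [NormedAddCommGroup V] [NormedSpace ℝ V]
    [FiniteDimensional ℝ V] [MeasurableSpace V] [BorelSpace V] (μ : Measure V)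
    [μ.IsAddHaarMeasure] {f : V → V} {f' : V → V →L[ℝ] V} (hf : ∀ x, HasFDerivAt f (f' x) x)
    (hinj : Function.Injective f) {c : ℝ} (hc : 0 < c) (hdet : ∀ x, c ≤ |(f' x).det|) :
    μ.map f ≤ (ENNReal.ofReal c)⁻¹ • μ := by
  have hfm : Measurable f :=
    (continuous_iff_continuousAt.2 fun x => (hf x).continuousAt).measurable
  refine Measure.le_iff.2 fun s hs => ?_
  rw [Measure.map_apply hfm hs, Measure.smul_apply, smul_eq_mul]
  have h1 := lintegral_image_eq_lintegral_abs_det_fderiv_mul μ (hfm hs)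
    (fun x _ => (hf x).hasFDerivWithinAt) hinj.injOn (fun _ => 1)
  have h2 : ENNReal.ofReal c * μ (f ⁻¹' s) ≤ μ s := by
    calc ENNReal.ofReal c * μ (f ⁻¹' s) = ∫⁻ _ in f ⁻¹' s, ENNReal.ofReal c ∂μ := by
          rw [setLIntegral_const]
      _ ≤ ∫⁻ x in f ⁻¹' s, ENNReal.ofReal |(f' x).det| * 1 ∂μ :=
          lintegral_mono fun x => by
            rw [mul_one]; exact ENNReal.ofReal_le_ofReal (hdet x)
      _ = μ (f '' (f ⁻¹' s)) := by rw [← h1, setLIntegral_one]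
      _ ≤ μ s := measure_mono (Set.image_preimage_subset f s)
  have hc0 : ENNReal.ofReal c ≠ 0 := by simpa using hc
  rw [← ENNReal.div_eq_inv_mul, ENNReal.le_div_iff_mul_le (Or.inl hc0)
    (Or.inl ENNReal.ofReal_ne_top), mul_comm]
  exact h2

end GradientMap

/-! ### Symbol estimates for `e^{iθ} - 1`. -/

section SymbolBounds

variable {V : Type*} [NormedAddCommGroup V] [NormedSpace ℝ V]

theorem norm_iteratedFDeriv_mul_le_of_isOpen {U : Set V} (hU : IsOpen U) {f g : V → ℂ}
    (hf : ContDiffOn ℝ ∞ f U) (hg : ContDiffOn ℝ ∞ g U) {x : V} (hx : x ∈ U) (k : ℕ) :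
    ‖iteratedFDeriv ℝ k (fun y => f y * g y) x‖ ≤ ∑ i ∈ Finset.range (k + 1),
      (k.choose i : ℝ) * ‖iteratedFDeriv ℝ i f x‖ * ‖iteratedFDeriv ℝ (k - i) g x‖ := by
  have h := norm_iteratedFDerivWithin_mul_le hf hg hU.uniqueDiffOn hx (n := k)
    (by exact_mod_cast le_top)
  simpa only [iteratedFDerivWithin_of_isOpen _ hU hx] using h

theorem iteratedDeriv_cexp_mul_I_sub_one (t : ℝ) (j : ℕ) (hj : 1 ≤ j) (s : ℝ) :
    ‖iteratedDeriv j (fun s : ℝ => Complex.exp (Complex.I * ((t * s : ℝ) : ℂ)) - 1) s‖ = |t| ^ j := by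
  obtain ⟨k, rfl⟩ : ∃ k, j = k + 1 := ⟨j - 1, by omega⟩
  have key : ∀ k : ℕ, iteratedDeriv (k + 1)
      (fun s : ℝ => Complex.exp (Complex.I * ((t * s : ℝ) : ℂ)) - 1) =
      fun s : ℝ => (Complex.I * t) ^ (k + 1) * Complex.exp (Complex.I * ((t * s : ℝ) : ℂ)) := by
    have hd : ∀ s : ℝ, HasDerivAt (fun s : ℝ => Complex.exp (Complex.I * ((t * s : ℝ) : ℂ)))
        ((Complex.I * t) * Complex.exp (Complex.I * ((t * s : ℝ) : ℂ))) s := by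
      intro s
      have h1 : HasDerivAt (fun s : ℝ => Complex.I * ((t * s : ℝ) : ℂ)) (Complex.I * t) s := by
        have := ((hasDerivAt_id s).const_mul t).ofReal_comp.const_mul Complex.I
        simpa using this
      have := h1.cexp
      rwa [mul_comm] at this
    intro k
    induction k with
    | zero =>
      funext s
      rw [iteratedDeriv_succ, iteratedDeriv_zero]
      simpa using ((hd s).sub_const 1).deriv
    | succ k ih =>
      funext s
      rw [iteratedDeriv_succ, ih]
      rw [((hd s).const_mul ((Complex.I * t) ^ (k + 1))).deriv]
      ring
  rw [key k, norm_mul, norm_pow, norm_mul, Complex.norm_I, one_mul, Complex.norm_real,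
    mul_comm Complex.I, Complex.norm_exp_ofReal_mul_I, mul_one, Real.norm_eq_abs]

theorem norm_cexp_I_mul_sub_one_le (s : ℝ) : ‖Complex.exp (Complex.I * (s : ℂ)) - 1‖ ≤ |s| := by
  simpa using Real.norm_exp_I_mul_ofReal_sub_one_le (x := s)

theorem contDiff_cexp_I_mul (t : ℝ) :
    ContDiff ℝ ∞ (fun s : ℝ => Complex.exp (Complex.I * ((t * s : ℝ) : ℂ)) - 1) := by
  have : ContDiff ℝ ∞ (fun s : ℝ => Complex.ofRealCLM (t * s)) :=
    Complex.ofRealCLM.contDiff.comp (contDiff_const.mul contDiff_id)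
  exact ((contDiff_const.mul this).cexp).sub contDiff_const

/-- If `θ` satisfies symbol estimates of order one away from the origin then so does `e^{iθ} - 1`
on bounded sets. -/
theorem exists_symbolBound_cexp_sub_one (M : ℕ) (C R : ℝ) (hR : 0 ≤ R) :
    ∃ C' : ℝ, 0 ≤ C' ∧ ∀ θ : V → ℝ, ContDiffOn ℝ ∞ θ {0}ᶜ →
      (∀ j ≤ M, ∀ ξ, ξ ≠ 0 → ‖ξ‖ ^ j * ‖iteratedFDeriv ℝ j θ ξ‖ ≤ C * ‖ξ‖) →
      ∀ j ≤ M, ∀ ξ, ξ ≠ 0 → ‖ξ‖ ≤ R →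
        ‖ξ‖ ^ j * ‖iteratedFDeriv ℝ j (fun ξ => Complex.exp (Complex.I * (θ ξ : ℂ)) - 1) ξ‖
          ≤ C' * ‖ξ‖ := by
  set D := max 1 C with hD
  set K := |C| + (1 + R) ^ M with hK
  have hD1 : 1 ≤ D := le_max_left _ _
  have hK0 : 0 ≤ K := by positivity
  refine ⟨M.factorial * K * D ^ M, by positivity, ?_⟩
  intro θ hθ hb j hj ξ hξ hξR
  set t := ‖ξ‖ with ht
  have ht0 : 0 < t := norm_pos_iff.2 hξ
  have hU : IsOpen ({0}ᶜ : Set V) := isOpen_compl_singleton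
  -- With `t = ‖ξ‖` frozen at the given point, `e^{iθ} - 1 = g ∘ f` for `g(s) = e^{its} - 1`. Every
  -- derivative of `g` up to order `j` gains a factor `t` at `f ξ`, order zero thanks to the `-1`,
  -- while that of `f` of order `i ≥ 1` costs `(D / t)^i`. The bound for derivatives of a
  -- composition then yields `t · t^{-j}`.
  set f : V → ℝ := t⁻¹ • θ with hf
  set g : ℝ → ℂ := fun s => Complex.exp (Complex.I * ((t * s : ℝ) : ℂ)) - 1 with hg
  have hfc : ContDiffOn ℝ ∞ f {0}ᶜ := hθ.const_smul t⁻¹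
  have hcomp : (fun ξ => Complex.exp (Complex.I * (θ ξ : ℂ)) - 1) = g ∘ f := by
    funext y
    simp only [hg, hf, Function.comp, Pi.smul_apply, smul_eq_mul]
    rw [mul_inv_cancel_left₀ ht0.ne']
  have hgb : ∀ i ≤ j, ‖iteratedFDerivWithin ℝ i g Set.univ (f ξ)‖ ≤ t * K := by
    intro i hi
    rw [iteratedFDerivWithin_univ]
    rcases Nat.eq_zero_or_pos i with rfl | hi0
    · rw [norm_iteratedFDeriv_zero]
      simp only [hg, hf, Pi.smul_apply, smul_eq_mul]
      rw [mul_inv_cancel_left₀ ht0.ne']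
      refine (norm_cexp_I_mul_sub_one_le _).trans ?_
      have := hb 0 (Nat.zero_le _) ξ hξ
      rw [pow_zero, one_mul, norm_iteratedFDeriv_zero, Real.norm_eq_abs] at this
      refine this.trans ?_
      rw [mul_comm]
      refine mul_le_mul_of_nonneg_left ((le_abs_self C).trans ?_) ht0.le
      rw [hK]; linarith [show 0 ≤ (1 + R) ^ M by positivity]
    · rw [norm_iteratedFDeriv_eq_norm_iteratedDeriv, iteratedDeriv_cexp_mul_I_sub_one t i hi0,
        abs_of_pos ht0]
      obtain ⟨k, rfl⟩ : ∃ k, i = k + 1 := ⟨i - 1, by omega⟩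
      rw [pow_succ, mul_comm]
      refine mul_le_mul_of_nonneg_left ?_ ht0.le
      calc t ^ k ≤ (1 + R) ^ k := pow_le_pow_left₀ ht0.le (by linarith) _
        _ ≤ (1 + R) ^ M := pow_le_pow_right₀ (by linarith) (by omega)
        _ ≤ K := by rw [hK]; linarith [abs_nonneg C]
  have hfb : ∀ i, 1 ≤ i → i ≤ j → ‖iteratedFDerivWithin ℝ i f {0}ᶜ ξ‖ ≤ (D / t) ^ i := by
    intro i hi hij
    rw [iteratedFDerivWithin_of_isOpen _ hU hξ]
    have hsm : ContDiffAt ℝ i θ ξ :=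
      (hθ.contDiffAt (hU.mem_nhds hξ)).of_le (by exact_mod_cast le_top)
    have : iteratedFDeriv ℝ i f ξ = t⁻¹ • iteratedFDeriv ℝ i θ ξ :=
      iteratedFDeriv_const_smul_apply hsm
    rw [this, norm_smul, norm_inv, Real.norm_of_nonneg ht0.le, div_pow, le_div_iff₀ (by positivity)]
    have h1 := hb i (hij.trans hj) ξ hξ
    calc t⁻¹ * ‖iteratedFDeriv ℝ i θ ξ‖ * t ^ i = t⁻¹ * (t ^ i * ‖iteratedFDeriv ℝ i θ ξ‖) := by ring
      _ ≤ t⁻¹ * (C * t) := mul_le_mul_of_nonneg_left h1 (by positivity)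
      _ = C := by field_simp
      _ ≤ D := le_max_right _ _
      _ ≤ D ^ i := le_self_pow₀ hD1 (by omega)
  have h := norm_iteratedFDerivWithin_comp_le (g := g) (f := f) (n := j) (N := ∞)
    ((contDiff_cexp_I_mul t).contDiffOn) hfc (by exact_mod_cast le_top) uniqueDiffOn_univ
    hU.uniqueDiffOn (Set.mapsTo_univ _ _) hξ hgb hfb
  rw [iteratedFDerivWithin_of_isOpen _ hU hξ, ← hcomp] at h
  calc t ^ j * ‖iteratedFDeriv ℝ j (fun ξ => Complex.exp (Complex.I * (θ ξ : ℂ)) - 1) ξ‖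
      ≤ t ^ j * (j.factorial * (t * K) * (D / t) ^ j) := mul_le_mul_of_nonneg_left h (by positivity)
    _ = j.factorial * K * D ^ j * t := by
        rw [div_pow]; field_simp
    _ ≤ _ := by
        have : (j.factorial : ℝ) ≤ M.factorial := by exact_mod_cast Nat.factorial_le hj
        have : D ^ j ≤ D ^ M := pow_le_pow_right₀ hD1 hj
        gcongr

end SymbolBounds

/-! ### A smooth cutoff near the origin and its dilates. -/

section Cutoff

variable {V : Type*} [NormedAddCommGroup V] [InnerProductSpace ℝ V] [FiniteDimensional ℝ V]

/-- The smooth function that vanishes on the unit ball and equals one off the ball of radius two. -/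
noncomputable def highPass (ξ : V) : ℂ :=
  1 - ((⟨1, 2, one_pos, one_lt_two⟩ : ContDiffBump (0 : V)) ξ : ℝ)

theorem contDiff_highPass : ContDiff ℝ ∞ (highPass : V → ℂ) :=
  contDiff_const.sub (Complex.ofRealCLM.contDiff.comp (ContDiffBump.contDiff _))

theorem highPass_eq_zero {ξ : V} (h : ‖ξ‖ ≤ 1) : highPass ξ = 0 := by
  unfold highPass
  rw [ContDiffBump.one_of_mem_closedBall]
  · simp
  · simpa using h

theorem highPass_eq_one {ξ : V} (h : 2 ≤ ‖ξ‖) : highPass ξ = 1 := by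
  unfold highPass
  rw [ContDiffBump.zero_of_le_dist]
  · simp
  · simpa using h

theorem norm_one_sub_highPass_le (ξ : V) : ‖1 - highPass ξ‖ ≤ 1 := by
  unfold highPass
  rw [sub_sub_cancel, Complex.norm_real, Real.norm_of_nonneg (ContDiffBump.nonneg _)]
  exact ContDiffBump.le_one _

theorem norm_highPass_le_one (ξ : V) : ‖highPass ξ‖ ≤ 1 := by
  unfold highPass
  have h0 := (⟨1, 2, one_pos, one_lt_two⟩ : ContDiffBump (0 : V)).nonneg (x := ξ)
  have h1 := (⟨1, 2, one_pos, one_lt_two⟩ : ContDiffBump (0 : V)).le_one (x := ξ)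
  rw [← Complex.ofReal_one, ← Complex.ofReal_sub, Complex.norm_real,
    Real.norm_of_nonneg (by linarith)]
  linarith

/-- The quantity `‖ξ‖^j ‖D^j f(ξ)‖` is invariant under dilation, so `l = 1` suffices; there it is
continuous on the ball of radius two, and the cutoff is constant outside. -/
theorem exists_symbolBound_highPass (V : Type*) [NormedAddCommGroup V] [InnerProductSpace ℝ V]
    [FiniteDimensional ℝ V] (M : ℕ) : ∃ C : ℝ, 0 ≤ C ∧ ∀ l : ℝ, ∀ j ≤ M, ∀ ξ : V,
      ‖ξ‖ ^ j * ‖iteratedFDeriv ℝ j (fun ξ => highPass (l • ξ)) ξ‖ ≤ C := by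
  have h1 : ∀ j : ℕ, ∃ C : ℝ, ∀ y : V, ‖y‖ ^ j * ‖iteratedFDeriv ℝ j (highPass : V → ℂ) y‖ ≤ C := by
    intro j
    have hcont : Continuous fun y : V => ‖y‖ ^ j * ‖iteratedFDeriv ℝ j (highPass : V → ℂ) y‖ :=
      (continuous_norm.pow _).mul (contDiff_highPass.continuous_iteratedFDeriv
        (by exact_mod_cast le_top)).norm
    obtain ⟨C, hC⟩ := (isCompact_closedBall (0 : V) 2).exists_bound_of_continuousOn hcont.continuousOn
    refine ⟨max C 1, fun y => ?_⟩
    by_cases hy : ‖y‖ ≤ 2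
    · exact ((le_abs_self _).trans (hC y (by simpa using hy))).trans (le_max_left _ _)
    · refine le_trans ?_ (le_max_right _ _)
      have hev : (highPass : V → ℂ) =ᶠ[nhds y] fun _ => 1 := by
        filter_upwards [(isOpen_lt continuous_const continuous_norm).mem_nhds (not_le.1 hy)]
          with w hw using highPass_eq_one (le_of_lt hw)
      rw [(hev.iteratedFDeriv ℝ j).self_of_nhds]
      rcases Nat.eq_zero_or_pos j with rfl | hj
      · simp
      · rw [iteratedFDeriv_const_of_ne (by omega)]
        simp
  choose C hC using h1
  refine ⟨∑ j ∈ Finset.range (M + 1), |C j|, Finset.sum_nonneg fun _ _ => abs_nonneg _, ?_⟩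
  intro l j hj ξ
  have hcomp : (fun ξ : V => (highPass (l • ξ) : ℂ)) =
      highPass ∘ (l • ContinuousLinearMap.id ℝ V) := rfl
  rw [hcomp, ContinuousLinearMap.iteratedFDeriv_comp_right _ contDiff_highPass _
    (i := j) (n := ∞) (by exact_mod_cast le_top)]
  have hn : ‖l • ContinuousLinearMap.id ℝ V‖ ≤ |l| := by
    rw [norm_smul, Real.norm_eq_abs]
    exact mul_le_of_le_one_right (abs_nonneg _) ContinuousLinearMap.norm_id_le
  calc _ ≤ ‖ξ‖ ^ j * (‖iteratedFDeriv ℝ j (highPass : V → ℂ) (l • ξ)‖ * |l| ^ j) := by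
        refine mul_le_mul_of_nonneg_left ?_ (by positivity)
        refine (ContinuousMultilinearMap.norm_compContinuousLinearMap_le _ _).trans ?_
        refine mul_le_mul_of_nonneg_left ?_ (norm_nonneg _)
        rw [Finset.prod_const, Finset.card_univ, Fintype.card_fin]
        exact pow_le_pow_left₀ (norm_nonneg _) hn _
    _ = ‖l • ξ‖ ^ j * ‖iteratedFDeriv ℝ j (highPass : V → ℂ) (l • ξ)‖ := by
        rw [norm_smul, Real.norm_eq_abs, mul_pow]; ring
    _ ≤ |C j| := (hC j _).trans (le_abs_self _)
    _ ≤ _ := Finset.single_le_sum (f := fun j => |C j|) (fun _ _ => abs_nonneg _)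
        (Finset.mem_range.2 (by omega))

end Cutoff

/-! ### Decay of oscillatory integrals with smooth amplitude. -/

section FourierDecay

variable {V : Type*} [NormedAddCommGroup V] [InnerProductSpace ℝ V] [FiniteDimensional ℝ V]
  [MeasurableSpace V] [BorelSpace V]

theorem enorm_oscillatoryIntegral_le {f : V → ℂ} (hf : ContDiff ℝ ∞ f) (hc : HasCompactSupport f)
    (M : ℕ) {z : V} (hz : z ≠ 0) :
    ‖∫ ξ, Complex.exp (Complex.I * ((-inner ℝ z ξ : ℝ) : ℂ)) * f ξ‖ₑ ≤
      ENNReal.ofReal ((4 * Real.pi) ^ M * (‖z‖ ^ M)⁻¹) *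
        ∑ k ∈ Finset.range (M + 1), ∫⁻ ξ, ‖iteratedFDeriv ℝ k f ξ‖ₑ := by
  have hint : ∀ k : ℕ, Integrable (iteratedFDeriv ℝ k f) := fun k =>
    (hf.continuous_iteratedFDeriv (by exact_mod_cast le_top)).integrable_of_hasCompactSupport
      (hc.iteratedFDeriv k)
  have h := Real.pow_mul_norm_iteratedFDeriv_fourier_le (f := f) (K := 0) (N := ⊤) hf ?_ (k := 0)
    (n := M) (by simp) (by exact_mod_cast le_top) ((2 * Real.pi)⁻¹ • z)
  swap
  · intro k m hk _
    have : k = 0 := by simpa using hk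
    subst this
    simpa using (hint m).norm
  have hF : FourierTransform.fourier f ((2 * Real.pi)⁻¹ • z) =
      ∫ ξ, Complex.exp (Complex.I * ((-inner ℝ z ξ : ℝ) : ℂ)) * f ξ := by
    rw [Real.fourier_eq']
    congr 1
    funext v
    rw [smul_eq_mul, inner_smul_right, real_inner_comm]
    congr 2
    rw [mul_comm Complex.I]
    congr 2
    field_simp
  rw [norm_iteratedFDeriv_zero, hF, norm_smul, Finset.sum_product] at h
  simp only [zero_add, Finset.range_one, Finset.sum_singleton, pow_zero, one_mul,
    Nat.cast_zero, mul_zero] at h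
  have hπ : 0 < 2 * Real.pi := by positivity
  have hz0 : 0 < ‖z‖ := norm_pos_iff.2 hz
  rw [norm_inv, Real.norm_of_nonneg hπ.le, mul_pow] at h
  have h2 : ‖∫ ξ, Complex.exp (Complex.I * ((-inner ℝ z ξ : ℝ) : ℂ)) * f ξ‖ ≤
      (4 * Real.pi) ^ M * (‖z‖ ^ M)⁻¹ *
        ∑ k ∈ Finset.range (M + 1), ∫ ξ, ‖iteratedFDeriv ℝ k f ξ‖ := by
    -- Each order contributes `2π` from the frequency normalization and `2` from the Fourier decay
    -- estimate with `k = 0`.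
    have h4 : (4 * Real.pi) ^ M = (2 * Real.pi) ^ M * 2 ^ M := by rw [← mul_pow]; ring
    rw [h4]
    have := mul_le_mul_of_nonneg_left h (show 0 ≤ (2 * Real.pi) ^ M * (‖z‖ ^ M)⁻¹ by positivity)
    refine le_trans (le_of_eq ?_) (this.trans (le_of_eq ?_))
    · rw [inv_pow]; field_simp
    · ring
  rw [← ofReal_norm]
  refine (ENNReal.ofReal_le_ofReal h2).trans (le_of_eq ?_)
  rw [ENNReal.ofReal_mul (by positivity), ENNReal.ofReal_sum_of_nonneg
    (fun k _ => integral_nonneg fun _ => norm_nonneg _)]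
  congr 1
  exact Finset.sum_congr rfl fun k _ => ofReal_integral_norm_eq_lintegral_enorm (hint k)

end FourierDecay

/-! ### The singular measure and the integrand away from the origin. -/

section KernelBound

variable {n : ℕ}

/-- The measure `|ξ|^{1/2 - n} dξ` on the ball of radius `R` of `ℝⁿ`. -/
noncomputable def singularMeasure (n : ℕ) (R : ℝ) : Measure (EuclideanSpace ℝ (Fin n)) :=
  (volume.restrict (Metric.closedBall 0 R)).withDensity
    fun ξ => ENNReal.ofReal (‖ξ‖ ^ ((1 : ℝ) / 2 - n))

theorem measurable_singularDensity (n : ℕ) : Measurable fun ξ : EuclideanSpace ℝ (Fin n) =>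
    ENNReal.ofReal (‖ξ‖ ^ ((1 : ℝ) / 2 - n)) :=
  (measurable_norm.pow_const _).ennreal_ofReal

/-- In polar coordinates the density becomes `r^{n-1} r^{1/2-n} = r^{-1/2}`, integrable at zero. -/
theorem isFiniteMeasure_singularMeasure (hn : 1 ≤ n) (R : ℝ) :
    IsFiniteMeasure (singularMeasure n R) := by
  have : Nontrivial (EuclideanSpace ℝ (Fin n)) := by
    apply Module.nontrivial_of_finrank_pos (R := ℝ)
    rw [finrank_euclideanSpace_fin]; omega
  have hint : IntegrableOn (fun ξ : EuclideanSpace ℝ (Fin n) => ‖ξ‖ ^ ((1 : ℝ) / 2 - n))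
      (Metric.closedBall 0 R) := by
    have h1 : IntegrableOn (fun ξ : EuclideanSpace ℝ (Fin n) => ‖ξ‖ ^ ((1 : ℝ) / 2 - n))
        (Metric.ball 0 (|R| + 1)) := by
      rw [integrableOn_fun_norm_addHaar volume (f := fun y : ℝ => y ^ ((1 : ℝ) / 2 - n))]
      have h2 : IntegrableOn (fun y : ℝ => y ^ (-(1 : ℝ) / 2)) (Set.Ioo 0 (|R| + 1)) := by
        rw [intervalIntegral.integrableOn_Ioo_rpow_iff (by positivity)]
        norm_num
      refine h2.congr_fun (fun y hy => ?_) measurableSet_Ioo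
      have hy0 : 0 < y := hy.1
      simp only [finrank_euclideanSpace_fin, smul_eq_mul]
      rw [← Real.rpow_natCast, ← Real.rpow_add hy0, Nat.cast_sub hn]
      congr 1
      push_cast; ring
    refine h1.mono_set fun x hx => ?_
    rw [Metric.mem_closedBall] at hx
    rw [Metric.mem_ball]
    linarith [le_abs_self R]
  exact isFiniteMeasure_withDensity_ofReal hint.2

/-- The sum over `j ≤ n + 1` of the integrals of `|D^j a|` against the singular measure. -/
noncomputable def singularSum (R : ℝ) (a : EuclideanSpace ℝ (Fin n) → ℂ) : ℝ≥0∞ :=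
  ∑ j ∈ Finset.range (n + 2), ∫⁻ ξ, ‖iteratedFDeriv ℝ j a ξ‖ₑ ∂(singularMeasure n R)

/-- Turns the pointwise bounds of the kernel estimate into integrals. The origin is a null set, so
nothing is asked of `F` there. -/
theorem lintegral_enorm_le_singularSum {a : EuclideanSpace ℝ (Fin n) → ℂ} {R : ℝ}
    (hn : 1 ≤ n) (ha : ContDiff ℝ ∞ a) {G : Type*} [NormedAddCommGroup G]
    {F : EuclideanSpace ℝ (Fin n) → G} {c : ℝ} (hc : 0 ≤ c)
    (hF : ∀ ξ, ξ ≠ 0 → ‖ξ‖ ≤ R → ‖F ξ‖ ≤ c * (‖ξ‖ ^ ((1 : ℝ) / 2 - n) *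
      ∑ j ∈ Finset.range (n + 2), ‖iteratedFDeriv ℝ j a ξ‖))
    (hF0 : ∀ ξ, R < ‖ξ‖ → F ξ = 0) :
    ∫⁻ ξ, ‖F ξ‖ₑ ≤ ENNReal.ofReal c * singularSum R a := by
  have : Nontrivial (EuclideanSpace ℝ (Fin n)) := by
    apply Module.nontrivial_of_finrank_pos (R := ℝ)
    rw [finrank_euclideanSpace_fin]; omega
  have hm : ∀ j : ℕ, Measurable fun ξ => ‖iteratedFDeriv ℝ j a ξ‖ₑ := fun j =>
    ((ha.continuous_iteratedFDeriv (by exact_mod_cast le_top)).enorm).measurable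
  have hS : singularSum R a = ∫⁻ ξ in Metric.closedBall 0 R,
      ENNReal.ofReal (‖ξ‖ ^ ((1 : ℝ) / 2 - n)) *
        ∑ j ∈ Finset.range (n + 2), ‖iteratedFDeriv ℝ j a ξ‖ₑ := by
    unfold singularSum singularMeasure
    rw [← lintegral_finsetSum _ fun j _ => hm j]
    rw [lintegral_withDensity_eq_lintegral_mul _ (measurable_singularDensity n)
      (Finset.measurable_sum _ fun j _ => hm j)]
    rfl
  have hm' : Measurable fun ξ : EuclideanSpace ℝ (Fin n) =>
      ENNReal.ofReal (‖ξ‖ ^ ((1 : ℝ) / 2 - n)) *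
        ∑ j ∈ Finset.range (n + 2), ‖iteratedFDeriv ℝ j a ξ‖ₑ :=
    (measurable_singularDensity n).mul (Finset.measurable_sum _ fun j _ => hm j)
  rw [hS, ← lintegral_const_mul _ hm',
    ← lintegral_indicator Metric.isClosed_closedBall.measurableSet]
  refine lintegral_mono_ae ?_
  have hne : ∀ᵐ ξ : EuclideanSpace ℝ (Fin n), ξ ≠ 0 := by
    simp [ae_iff]
  filter_upwards [hne] with ξ hξ
  by_cases hR : ‖ξ‖ ≤ R
  · rw [Set.indicator_of_mem (by simpa using hR), ← ofReal_norm]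
    refine (ENNReal.ofReal_le_ofReal (hF ξ hξ hR)).trans (le_of_eq ?_)
    rw [ENNReal.ofReal_mul hc, ENNReal.ofReal_mul (by positivity),
      ENNReal.ofReal_sum_of_nonneg (fun _ _ => norm_nonneg _)]
    simp only [ofReal_norm]
  · rw [hF0 ξ (not_le.1 hR)]
    simp

theorem iteratedFDeriv_eq_zero_of_tsupport_subset {a : EuclideanSpace ℝ (Fin n) → ℂ} {R : ℝ}
    (hsupp : tsupport a ⊆ Metric.closedBall 0 R) (j : ℕ) {ξ : EuclideanSpace ℝ (Fin n)}
    (hξ : R < ‖ξ‖) : iteratedFDeriv ℝ j a ξ = 0 := by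
  by_contra h
  have : ξ ∈ tsupport a := support_iteratedFDeriv_subset j h
  have := hsupp this
  rw [mem_closedBall_zero_iff] at this
  linarith

theorem eq_zero_of_tsupport_subset {a : EuclideanSpace ℝ (Fin n) → ℂ} {R : ℝ}
    (hsupp : tsupport a ⊆ Metric.closedBall 0 R) {ξ : EuclideanSpace ℝ (Fin n)}
    (hξ : R < ‖ξ‖) : a ξ = 0 := by
  by_contra h
  have := hsupp (subset_tsupport _ h)
  rw [mem_closedBall_zero_iff] at this
  linarith

theorem one_le_mul_rpow_half_sub (hn : 1 ≤ n) {R t : ℝ} (ht : 0 < t) (htR : t ≤ R) (hR : 1 ≤ R) :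
    1 ≤ R ^ n * t ^ ((1 : ℝ) / 2 - n) := by
  have hn' : (1 : ℝ) ≤ n := by exact_mod_cast hn
  have h1 : R ^ ((1 : ℝ) / 2 - n) ≤ t ^ ((1 : ℝ) / 2 - n) :=
    Real.rpow_le_rpow_of_nonpos ht htR (by linarith)
  have h2 : 1 ≤ R ^ n * R ^ ((1 : ℝ) / 2 - n) := by
    rw [← Real.rpow_natCast, ← Real.rpow_add (by linarith)]
    exact Real.one_le_rpow hR (by linarith)
  exact h2.trans (mul_le_mul_of_nonneg_left h1 (by positivity))

/-- The part of the kernel away from the origin. -/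
theorem exists_norm_iteratedFDeriv_highPass_mul_le (C R : ℝ) (hR : 1 ≤ R) :
    ∃ C' : ℝ, 0 ≤ C' ∧ ∀ b a : EuclideanSpace ℝ (Fin n) → ℂ,
      ContDiffOn ℝ ∞ b {0}ᶜ → ContDiff ℝ ∞ a →
      (∀ j ≤ n + 1, ∀ ξ, ξ ≠ 0 → ‖ξ‖ ≤ R → ‖ξ‖ ^ j * ‖iteratedFDeriv ℝ j b ξ‖ ≤ C * ‖ξ‖) →
      ∀ l : ℝ, 1 ≤ l → ∀ k ≤ n + 1, ∀ ξ, ξ ≠ 0 → ‖ξ‖ ≤ R →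
        ‖iteratedFDeriv ℝ k (fun ξ => highPass (l • ξ) * b ξ * a ξ) ξ‖ ≤
          C' * l ^ ((1 : ℝ) / 2) * (‖ξ‖ ^ ((1 : ℝ) / 2 - n) *
            ∑ j ∈ Finset.range (n + 2), ‖iteratedFDeriv ℝ j a ξ‖) := by
  obtain ⟨Cη, hCη0, hCη⟩ := exists_symbolBound_highPass (EuclideanSpace ℝ (Fin n)) (n + 1)
  set D : ℝ := 2 ^ (n + 1) * (Cη * |C|) with hD
  have hD0 : 0 ≤ D := by positivity
  refine ⟨2 ^ (n + 1) * (D * R ^ (n + 1)), by positivity, ?_⟩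
  intro b a hb ha hbb l hl k hk ξ hξ hξR
  set t := ‖ξ‖ with ht
  have ht0 : 0 < t := norm_pos_iff.2 hξ
  have hU : IsOpen ({0}ᶜ : Set (EuclideanSpace ℝ (Fin n))) := isOpen_compl_singleton
  have hηs : ContDiff ℝ ∞ fun ξ : EuclideanSpace ℝ (Fin n) => (highPass (l • ξ) : ℂ) :=
    contDiff_highPass.comp (contDiff_const_smul l)
  by_cases hsmall : l * t < 1
  · have hev : (fun ξ => highPass (l • ξ) * b ξ * a ξ) =ᶠ[nhds ξ] fun _ => (0 : ℂ) := by
      have : IsOpen {w : EuclideanSpace ℝ (Fin n) | l * ‖w‖ < 1} :=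
        isOpen_lt (continuous_const.mul continuous_norm) continuous_const
      filter_upwards [this.mem_nhds hsmall] with w hw
      rw [highPass_eq_zero, zero_mul, zero_mul]
      rw [norm_smul, Real.norm_of_nonneg (by linarith)]
      exact le_of_lt hw
    rw [(hev.iteratedFDeriv ℝ k).self_of_nhds]
    have : iteratedFDeriv ℝ k (fun _ : EuclideanSpace ℝ (Fin n) => (0 : ℂ)) ξ = 0 := by simp
    rw [this, norm_zero]
    have : 0 ≤ l ^ ((1 : ℝ) / 2) := by positivity
    exact mul_nonneg (by positivity) (mul_nonneg (by positivity)
      (Finset.sum_nonneg fun _ _ => norm_nonneg _))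
  · rw [not_lt] at hsmall
    have hηb : ∀ i ≤ n + 1,
        t ^ i * ‖iteratedFDeriv ℝ i (fun ξ => highPass (l • ξ) * b ξ) ξ‖ ≤ D * t := by
      intro i hi
      have h := norm_iteratedFDeriv_mul_le_of_isOpen hU hηs.contDiffOn hb hξ i
      calc t ^ i * ‖iteratedFDeriv ℝ i (fun ξ => highPass (l • ξ) * b ξ) ξ‖
          ≤ t ^ i * ∑ s ∈ Finset.range (i + 1), (i.choose s : ℝ) *
            ‖iteratedFDeriv ℝ s (fun ξ => (highPass (l • ξ) : ℂ)) ξ‖ *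
            ‖iteratedFDeriv ℝ (i - s) b ξ‖ := mul_le_mul_of_nonneg_left h (by positivity)
        _ ≤ ∑ s ∈ Finset.range (i + 1), (i.choose s : ℝ) * (Cη * (|C| * t)) := by
            rw [Finset.mul_sum]
            refine Finset.sum_le_sum fun s hs => ?_
            have hs' : s ≤ i := by simpa [Nat.lt_succ_iff] using hs
            have e1 : t ^ i = t ^ s * t ^ (i - s) := by rw [← pow_add]; congr 1; omega
            have b1 := hCη l s (hs'.trans hi) ξ
            have b2 := (hbb (i - s) (by omega) ξ hξ hξR).trans
              (mul_le_mul_of_nonneg_right (le_abs_self C) ht0.le)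
            rw [e1]
            calc _ = (i.choose s : ℝ) * ((t ^ s *
                  ‖iteratedFDeriv ℝ s (fun ξ => (highPass (l • ξ) : ℂ)) ξ‖) *
                  (t ^ (i - s) * ‖iteratedFDeriv ℝ (i - s) b ξ‖)) := by ring
              _ ≤ _ := by
                refine mul_le_mul_of_nonneg_left ?_ (by positivity)
                exact mul_le_mul b1 b2 (by positivity) hCη0
        _ = 2 ^ i * (Cη * (|C| * t)) := by
            rw [← Finset.sum_mul]
            congr 1
            exact_mod_cast Nat.sum_range_choose i
        _ ≤ 2 ^ (n + 1) * (Cη * (|C| * t)) := by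
            have : (2 : ℝ) ^ i ≤ 2 ^ (n + 1) := pow_le_pow_right₀ one_le_two hi
            gcongr
        _ = D * t := by rw [hD]; ring
    have hpt : ∀ i ≤ n + 1, ‖iteratedFDeriv ℝ i (fun ξ => highPass (l • ξ) * b ξ) ξ‖ ≤
        D * R ^ (n + 1) * l ^ ((1 : ℝ) / 2) * t ^ ((1 : ℝ) / 2 - n) := by
      intro i hi
      have h1 := hηb i hi
      have h2 : 1 ≤ l ^ ((1 : ℝ) / 2) * t ^ ((1 : ℝ) / 2) := by
        rw [← Real.mul_rpow (by linarith) ht0.le]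
        exact Real.one_le_rpow hsmall (by norm_num)
      have h3 : t ^ (n + 1 - i) ≤ R ^ (n + 1) :=
        (pow_le_pow_left₀ ht0.le hξR _).trans (pow_le_pow_right₀ hR (by omega))
      -- Half a power is traded here. The derivative of order `i` is of size `t^{1-i}`, at worst
      -- `t^{-n}`, which is not integrable; but `t^{-n} = t^{1/2-n} t^{-1/2}`, and `l t ≥ 1` on this
      -- region allows `t^{-1/2} ≤ l^{1/2}`.
      have h4 : t = t ^ i * t ^ (n + 1 - i) * (t ^ ((1 : ℝ) / 2 - n) * t ^ (-(1 : ℝ) / 2)) := by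
        rw [← pow_add, ← Real.rpow_add ht0, ← Real.rpow_natCast, ← Real.rpow_add ht0]
        conv_lhs => rw [← Real.rpow_one t]
        congr 1
        have : i + (n + 1 - i) = n + 1 := by omega
        rw [this]; push_cast; ring
      have h5 : t ^ (-(1 : ℝ) / 2) ≤ l ^ ((1 : ℝ) / 2) := by
        have : t ^ (-(1 : ℝ) / 2) * t ^ ((1 : ℝ) / 2) = 1 := by
          rw [← Real.rpow_add ht0]; norm_num
        have hp : 0 < t ^ ((1 : ℝ) / 2) := Real.rpow_pos_of_pos ht0 _
        exact le_of_mul_le_mul_right (this.le.trans h2) hp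
      have hti : 0 < t ^ i := by positivity
      refine le_of_mul_le_mul_left (h1.trans ?_) hti
      calc D * t = D * (t ^ i * t ^ (n + 1 - i) *
            (t ^ ((1 : ℝ) / 2 - n) * t ^ (-(1 : ℝ) / 2))) := by rw [← h4]
        _ ≤ D * (t ^ i * R ^ (n + 1) * (t ^ ((1 : ℝ) / 2 - n) * l ^ ((1 : ℝ) / 2))) := by
            gcongr
        _ = _ := by ring
    have h := norm_iteratedFDeriv_mul_le_of_isOpen hU (hηs.contDiffOn.mul hb)
      ha.contDiffOn hξ k
    refine h.trans ?_
    set S := ∑ j ∈ Finset.range (n + 2), ‖iteratedFDeriv ℝ j a ξ‖ with hS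
    have hS0 : 0 ≤ S := Finset.sum_nonneg fun _ _ => norm_nonneg _
    have hl0 : 0 ≤ l ^ ((1 : ℝ) / 2) := by positivity
    calc _ ≤ ∑ i ∈ Finset.range (k + 1), (k.choose i : ℝ) *
          (D * R ^ (n + 1) * l ^ ((1 : ℝ) / 2) * t ^ ((1 : ℝ) / 2 - n)) * S := by
          refine Finset.sum_le_sum fun i hi => ?_
          have hi' : i ≤ k := by simpa [Nat.lt_succ_iff] using hi
          have hj : ‖iteratedFDeriv ℝ (k - i) a ξ‖ ≤ S :=
            Finset.single_le_sum (f := fun j => ‖iteratedFDeriv ℝ j a ξ‖)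
              (fun _ _ => norm_nonneg _) (Finset.mem_range.2 (by omega))
          exact mul_le_mul (mul_le_mul_of_nonneg_left (hpt i (hi'.trans hk)) (by positivity)) hj
            (norm_nonneg _) (by positivity)
      _ = 2 ^ k * ((D * R ^ (n + 1) * l ^ ((1 : ℝ) / 2) * t ^ ((1 : ℝ) / 2 - n)) * S) := by
          simp_rw [mul_assoc]
          rw [← Finset.sum_mul]
          congr 1
          exact_mod_cast Nat.sum_range_choose k
      _ ≤ 2 ^ (n + 1) * ((D * R ^ (n + 1) * l ^ ((1 : ℝ) / 2) * t ^ ((1 : ℝ) / 2 - n)) * S) := by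
          have : (2 : ℝ) ^ k ≤ 2 ^ (n + 1) := pow_le_pow_right₀ one_le_two hk
          gcongr
      _ = _ := by ring

end KernelBound

/-! ### Decay of the kernel of order `n + 1/2`. -/

section KernelEstimate

variable {n : ℕ}

theorem lintegral_iteratedFDeriv_le_singularSum (hn : 1 ≤ n)
    {a : EuclideanSpace ℝ (Fin n) → ℂ} {R : ℝ} (hR : 1 ≤ R)
    (ha : ContDiff ℝ ∞ a) (hsupp : tsupport a ⊆ Metric.closedBall 0 R) {k : ℕ} (hk : k ≤ n + 1) :
    ∫⁻ ξ, ‖iteratedFDeriv ℝ k a ξ‖ₑ ≤ ENNReal.ofReal (R ^ n) * singularSum R a := by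
  refine lintegral_enorm_le_singularSum hn ha (by positivity) (fun ξ hξ hξR => ?_)
    fun ξ hξ => iteratedFDeriv_eq_zero_of_tsupport_subset hsupp k hξ
  have h1 := one_le_mul_rpow_half_sub hn (norm_pos_iff.2 hξ) hξR hR
  have hj : ‖iteratedFDeriv ℝ k a ξ‖ ≤ ∑ j ∈ Finset.range (n + 2), ‖iteratedFDeriv ℝ j a ξ‖ :=
    Finset.single_le_sum (f := fun j => ‖iteratedFDeriv ℝ j a ξ‖)
      (fun _ _ => norm_nonneg _) (Finset.mem_range.2 (by omega))
  rw [← mul_assoc]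
  exact hj.trans (le_mul_of_one_le_left (Finset.sum_nonneg fun _ _ => norm_nonneg _) h1)

theorem enorm_cexp_mul (s : ℝ) (w : ℂ) : ‖Complex.exp (Complex.I * (s : ℂ)) * w‖ₑ = ‖w‖ₑ := by
  rw [enorm_mul, ← ofReal_norm, mul_comm Complex.I, Complex.norm_exp_ofReal_mul_I]
  simp

theorem enorm_integral_cexp_mul_le {V : Type*} [MeasurableSpace V] (μ : Measure V) (s : V → ℝ)
    (a : V → ℂ) : ‖∫ ξ, Complex.exp (Complex.I * (s ξ : ℂ)) * a ξ ∂μ‖ₑ ≤ ∫⁻ ξ, ‖a ξ‖ₑ ∂μ := by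
  refine (enorm_integral_le_lintegral_enorm _).trans (le_of_eq ?_)
  simp only [enorm_cexp_mul]

theorem sum_range_const_mul_le (M : ℕ) (f : ℕ → ℝ≥0∞) (B : ℝ≥0∞)
    (h : ∀ k ≤ M, f k ≤ B) : ∑ k ∈ Finset.range (M + 1), f k ≤ (M + 1 : ℕ) * B := by
  refine (Finset.sum_le_card_nsmul _ _ B fun k hk => h k ?_).trans (by simp)
  simpa [Nat.lt_succ_iff] using hk

/-- The far part of the kernel. -/
theorem exists_enorm_integral_highPass_le (hn : 1 ≤ n) (C R : ℝ) (hR : 1 ≤ R) :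
    ∃ C' : ℝ, 0 ≤ C' ∧ ∀ b a : EuclideanSpace ℝ (Fin n) → ℂ,
      ContDiffOn ℝ ∞ b {0}ᶜ → ContDiff ℝ ∞ a → tsupport a ⊆ Metric.closedBall 0 R →
      (∀ j ≤ n + 1, ∀ ξ, ξ ≠ 0 → ‖ξ‖ ≤ R → ‖ξ‖ ^ j * ‖iteratedFDeriv ℝ j b ξ‖ ≤ C * ‖ξ‖) →
      ∀ z : EuclideanSpace ℝ (Fin n), 1 ≤ ‖z‖ →
      ‖∫ ξ, Complex.exp (Complex.I * ((-inner ℝ z ξ : ℝ) : ℂ)) *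
        (highPass (‖z‖ • ξ) * b ξ * a ξ)‖ₑ ≤
        ENNReal.ofReal (C' * ‖z‖ ^ (-(n + 1 / 2 : ℝ))) * singularSum R a := by
  obtain ⟨C₁, hC₁0, hC₁⟩ := exists_norm_iteratedFDeriv_highPass_mul_le (n := n) C R hR
  refine ⟨(4 * Real.pi) ^ (n + 1) * ((n + 2 : ℕ) * C₁), by positivity, ?_⟩
  intro b a hb ha hsupp hbb z hz
  have hz0 : 0 < ‖z‖ := by linarith
  set f : EuclideanSpace ℝ (Fin n) → ℂ := fun ξ => highPass (‖z‖ • ξ) * b ξ * a ξ with hf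
  have hfs : tsupport f ⊆ Metric.closedBall 0 R := by
    refine (tsupport_mul_subset_right (f := fun ξ => highPass (‖z‖ • ξ) * b ξ) (g := a)).trans hsupp
  have hfc : HasCompactSupport f :=
    (isCompact_closedBall (0 : EuclideanSpace ℝ (Fin n)) R).of_isClosed_subset
      (isClosed_tsupport _) hfs
  have hU : IsOpen ({0}ᶜ : Set (EuclideanSpace ℝ (Fin n))) := isOpen_compl_singleton
  -- The cutoff vanishes identically near the origin, the only point where `b` may fail to be
  -- smooth.
  have hfd : ContDiff ℝ ∞ f := by
    rw [contDiff_iff_contDiffAt]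
    intro ξ
    by_cases hξ : ξ = 0
    · subst hξ
      have hev : f =ᶠ[nhds 0] fun _ => (0 : ℂ) := by
        have : IsOpen {w : EuclideanSpace ℝ (Fin n) | ‖z‖ * ‖w‖ < 1} :=
          isOpen_lt (continuous_const.mul continuous_norm) continuous_const
        filter_upwards [this.mem_nhds (by simp)] with w hw
        simp only [hf]
        rw [highPass_eq_zero, zero_mul, zero_mul]
        rw [norm_smul, norm_norm]
        exact le_of_lt hw
      exact contDiffAt_const.congr_of_eventuallyEq hev
    · exact (((contDiff_highPass.comp (contDiff_const_smul ‖z‖)).contDiffAt).mul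
        (hb.contDiffAt (hU.mem_nhds hξ))).mul ha.contDiffAt
  refine (enorm_oscillatoryIntegral_le hfd hfc (n + 1) (norm_pos_iff.1 hz0)).trans ?_
  have hk : ∀ k ≤ n + 1, ∫⁻ ξ, ‖iteratedFDeriv ℝ k f ξ‖ₑ ≤
      ENNReal.ofReal (C₁ * ‖z‖ ^ ((1 : ℝ) / 2)) * singularSum R a := fun k hk =>
    lintegral_enorm_le_singularSum hn ha (by positivity)
      (fun ξ hξ hξR => hC₁ b a hb ha hbb ‖z‖ hz k hk ξ hξ hξR)
      fun ξ hξ => iteratedFDeriv_eq_zero_of_tsupport_subset hfs k hξ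
  refine (mul_le_mul_right (sum_range_const_mul_le (n + 1) _ _ hk) _).trans (le_of_eq ?_)
  rw [← ENNReal.ofReal_natCast, ← mul_assoc, ← mul_assoc, ← ENNReal.ofReal_mul (by positivity),
    ← ENNReal.ofReal_mul (by positivity)]
  congr 2
  -- The `n + 1` integrations by parts win `‖z‖^{-(n+1)}`, of which the cutoff at scale `1/‖z‖`
  -- loses `‖z‖^{1/2}`.
  have : ‖z‖ ^ (-(n + 1 / 2 : ℝ)) = (‖z‖ ^ (n + 1))⁻¹ * ‖z‖ ^ ((1 : ℝ) / 2) := by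
    rw [← Real.rpow_natCast, ← Real.rpow_neg hz0.le, ← Real.rpow_add hz0]
    congr 1; push_cast; ring
  rw [this]; ring

/-- The near part of the kernel. -/
theorem lintegral_lowPass_le (hn : 1 ≤ n) {C R : ℝ} (hC : 0 ≤ C)
    {b a : EuclideanSpace ℝ (Fin n) → ℂ} (ha : ContDiff ℝ ∞ a)
    (hsupp : tsupport a ⊆ Metric.closedBall 0 R)
    (hb : ∀ ξ, ξ ≠ 0 → ‖ξ‖ ≤ R → ‖b ξ‖ ≤ C * ‖ξ‖) {l : ℝ} (hl : 0 < l) :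
    ∫⁻ ξ, ‖(1 - highPass (l • ξ)) * b ξ * a ξ‖ₑ ≤
      ENNReal.ofReal (C * 2 ^ (n + 1) * l ^ (-(n + 1 / 2 : ℝ))) * singularSum R a := by
  refine lintegral_enorm_le_singularSum hn ha (by positivity) (fun ξ hξ hξR => ?_)
    fun ξ hξ => by rw [eq_zero_of_tsupport_subset hsupp hξ, mul_zero]
  have ht : 0 < ‖ξ‖ := norm_pos_iff.2 hξ
  have hj : ‖a ξ‖ ≤ ∑ j ∈ Finset.range (n + 2), ‖iteratedFDeriv ℝ j a ξ‖ := by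
    refine le_trans ?_ (Finset.single_le_sum (f := fun j => ‖iteratedFDeriv ℝ j a ξ‖)
      (fun _ _ => norm_nonneg _) (Finset.mem_range.2 (show 0 < n + 2 by omega)))
    rw [norm_iteratedFDeriv_zero]
  set S := ∑ j ∈ Finset.range (n + 2), ‖iteratedFDeriv ℝ j a ξ‖
  by_cases h2 : 2 ≤ l * ‖ξ‖
  · rw [highPass_eq_one (by rw [norm_smul, Real.norm_of_nonneg hl.le]; exact h2)]
    simp only [sub_self, zero_mul, norm_zero]
    exact mul_nonneg (by positivity) (mul_nonneg (by positivity) ((norm_nonneg _).trans hj))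
  · rw [not_le] at h2
    -- Write `‖ξ‖ = ‖ξ‖^{n+1/2} ‖ξ‖^{1/2-n}` and use `‖ξ‖ < 2 / l` in the first factor. The power
    -- `2^{n+1/2}` is rounded up.
    have hkey : ‖ξ‖ ≤ 2 ^ (n + 1) * l ^ (-(n + 1 / 2 : ℝ)) * ‖ξ‖ ^ ((1 : ℝ) / 2 - n) := by
      have e1 : ‖ξ‖ = ‖ξ‖ ^ (n + 1 / 2 : ℝ) * ‖ξ‖ ^ ((1 : ℝ) / 2 - n) := by
        rw [← Real.rpow_add ht]
        conv_lhs => rw [← Real.rpow_one ‖ξ‖]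
        congr 1; ring
      have e2 : ‖ξ‖ ^ (n + 1 / 2 : ℝ) ≤ 2 ^ (n + 1) * l ^ (-(n + 1 / 2 : ℝ)) := by
        have h3 : ‖ξ‖ ≤ 2 * l⁻¹ := by
          rw [← div_eq_mul_inv, le_div_iff₀ hl]; linarith
        calc ‖ξ‖ ^ (n + 1 / 2 : ℝ) ≤ (2 * l⁻¹) ^ (n + 1 / 2 : ℝ) :=
              Real.rpow_le_rpow ht.le h3 (by positivity)
          _ = 2 ^ (n + 1 / 2 : ℝ) * l ^ (-(n + 1 / 2 : ℝ)) := by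
              rw [Real.mul_rpow (by norm_num) (by positivity), Real.inv_rpow hl.le,
                ← Real.rpow_neg hl.le]
          _ ≤ _ := by
              refine mul_le_mul_of_nonneg_right ?_ (by positivity)
              rw [← Real.rpow_natCast]
              refine Real.rpow_le_rpow_of_exponent_le one_le_two ?_
              push_cast; linarith
      conv_lhs => rw [e1]
      exact mul_le_mul_of_nonneg_right e2 (by positivity)
    rw [norm_mul, norm_mul]
    calc ‖1 - highPass (l • ξ)‖ * ‖b ξ‖ * ‖a ξ‖ ≤ 1 * (C * ‖ξ‖) * S := by
          have := norm_one_sub_highPass_le (l • ξ)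
          have := hb ξ hξ hξR
          gcongr
      _ ≤ 1 * (C * (2 ^ (n + 1) * l ^ (-(n + 1 / 2 : ℝ)) * ‖ξ‖ ^ ((1 : ℝ) / 2 - n))) * S := by
          have : 0 ≤ S := (norm_nonneg _).trans hj
          gcongr
      _ = _ := by ring

/-- The kernel estimate: an oscillatory integral whose phase is a symbol of order one near the
origin and whose amplitude is smooth with support in a fixed ball decays like `|z|^{-n - 1/2}`. -/
theorem exists_kernel_bound (hn : 1 ≤ n) (C R : ℝ) (hR : 1 ≤ R) :
    ∃ C' : ℝ, 0 ≤ C' ∧ ∀ (θ : EuclideanSpace ℝ (Fin n) → ℝ) (a : EuclideanSpace ℝ (Fin n) → ℂ),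
      ContDiffOn ℝ ∞ θ {0}ᶜ → ContDiff ℝ ∞ a → tsupport a ⊆ Metric.closedBall 0 R →
      (∀ j ≤ n + 1, ∀ ξ, ξ ≠ 0 → ‖ξ‖ ^ j * ‖iteratedFDeriv ℝ j θ ξ‖ ≤ C * ‖ξ‖) →
      ∀ z : EuclideanSpace ℝ (Fin n),
      ‖∫ ξ, Complex.exp (Complex.I * ((θ ξ - inner ℝ z ξ : ℝ) : ℂ)) * a ξ‖ₑ ≤
        ENNReal.ofReal (C' * (1 + ‖z‖) ^ (-(n + 1 / 2 : ℝ))) * singularSum R a := by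
  obtain ⟨C₁, hC₁0, hC₁⟩ := exists_symbolBound_cexp_sub_one
    (V := EuclideanSpace ℝ (Fin n)) (n + 1) C R (by linarith)
  obtain ⟨C₂, hC₂0, hC₂⟩ := exists_enorm_integral_highPass_le hn C₁ R hR
  set C₃ : ℝ := (4 * Real.pi) ^ (n + 1) * ((n + 2 : ℕ) * R ^ n) with hC₃
  have hR0 : 0 ≤ R := by linarith
  -- `R ^ n` covers `‖z‖ ≤ 1`; the other three constants cover the three pieces for `‖z‖ > 1`; `2 ^
  -- (n + 1)` pays for replacing `‖z‖` by `1 + ‖z‖`.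
  refine ⟨2 ^ (n + 1) * (R ^ n + (C₂ + (C₁ * 2 ^ (n + 1) + C₃))), by positivity, ?_⟩
  intro θ a hθ ha hsupp hb z
  set b : EuclideanSpace ℝ (Fin n) → ℂ := fun ξ => Complex.exp (Complex.I * (θ ξ : ℂ)) - 1 with hbdef
  have hU : IsOpen ({0}ᶜ : Set (EuclideanSpace ℝ (Fin n))) := isOpen_compl_singleton
  have hbs : ContDiffOn ℝ ∞ b {0}ᶜ :=
    ((contDiffOn_const.mul (Complex.ofRealCLM.contDiff.comp_contDiffOn hθ)).cexp).sub
      contDiffOn_const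
  have hbb := hC₁ θ hθ hb
  have hb0 : ∀ ξ, ξ ≠ 0 → ‖ξ‖ ≤ R → ‖b ξ‖ ≤ C₁ * ‖ξ‖ := by
    intro ξ hξ hξR
    have := hbb 0 (by omega) ξ hξ hξR
    rwa [pow_zero, one_mul, norm_iteratedFDeriv_zero] at this
  have hac : HasCompactSupport a :=
    (isCompact_closedBall (0 : EuclideanSpace ℝ (Fin n)) R).of_isClosed_subset
      (isClosed_tsupport _) hsupp
  by_cases hz : ‖z‖ ≤ 1
  · refine (enorm_integral_cexp_mul_le _ _ _).trans ?_
    have h0 := lintegral_iteratedFDeriv_le_singularSum hn hR ha hsupp (k := 0) (by omega)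
    have e0 : ∀ ξ, ‖iteratedFDeriv ℝ 0 a ξ‖ₑ = ‖a ξ‖ₑ := fun ξ => by
      rw [← ofReal_norm, norm_iteratedFDeriv_zero, ofReal_norm]
    simp only [e0] at h0
    refine h0.trans (mul_le_mul_left (ENNReal.ofReal_le_ofReal ?_) _)
    have h1 : 1 ≤ (2 : ℝ) ^ (n + 1) * (1 + ‖z‖) ^ (-(n + 1 / 2 : ℝ)) := by
      have h2 : (2 : ℝ) ^ (-(n + 1 / 2 : ℝ)) ≤ (1 + ‖z‖) ^ (-(n + 1 / 2 : ℝ)) :=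
        Real.rpow_le_rpow_of_nonpos (by positivity) (by linarith) (by linarith [n.cast_nonneg (α := ℝ)])
      have h3 : (1 : ℝ) ≤ 2 ^ (n + 1) * 2 ^ (-(n + 1 / 2 : ℝ)) := by
        rw [← Real.rpow_natCast, ← Real.rpow_add two_pos]
        refine Real.one_le_rpow one_le_two ?_
        push_cast; linarith
      exact h3.trans (mul_le_mul_of_nonneg_left h2 (by positivity))
    have hw : 0 ≤ (1 + ‖z‖) ^ (-(n + 1 / 2 : ℝ)) := by positivity
    calc R ^ n ≤ R ^ n * (2 ^ (n + 1) * (1 + ‖z‖) ^ (-(n + 1 / 2 : ℝ))) :=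
          le_mul_of_one_le_right (by positivity) h1
      _ ≤ (R ^ n + (C₂ + (C₁ * 2 ^ (n + 1) + C₃))) *
          (2 ^ (n + 1) * (1 + ‖z‖) ^ (-(n + 1 / 2 : ℝ))) := by
          refine mul_le_mul_of_nonneg_right ?_ (by positivity)
          have : 0 ≤ C₂ + (C₁ * 2 ^ (n + 1) + C₃) := by positivity
          linarith
      _ = _ := by ring
  · rw [not_le] at hz
    have hz0 : 0 < ‖z‖ := by linarith
    set l := ‖z‖ with hl
    -- With `η` the cutoff at scale `1/l`, `e^{iθ} = ηb + (1 - η)b + 1`: integration by parts for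
    -- the first term, size and smallness of support for the second, and smoothness of `a` alone for
    -- the third.
    have hsplit : ∀ ξ, Complex.exp (Complex.I * ((θ ξ - inner ℝ z ξ : ℝ) : ℂ)) * a ξ =
        Complex.exp (Complex.I * ((-inner ℝ z ξ : ℝ) : ℂ)) * (highPass (l • ξ) * b ξ * a ξ) +
        (Complex.exp (Complex.I * ((-inner ℝ z ξ : ℝ) : ℂ)) *
          ((1 - highPass (l • ξ)) * b ξ * a ξ) +
        Complex.exp (Complex.I * ((-inner ℝ z ξ : ℝ) : ℂ)) * a ξ) := by
      intro ξ
      have : Complex.exp (Complex.I * ((θ ξ - inner ℝ z ξ : ℝ) : ℂ)) =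
          Complex.exp (Complex.I * ((-inner ℝ z ξ : ℝ) : ℂ)) * (b ξ + 1) := by
        rw [hbdef]
        simp only [sub_add_cancel]
        rw [← Complex.exp_add]
        congr 1; push_cast; ring
      rw [this]; ring
    have hcexp : Continuous fun ξ : EuclideanSpace ℝ (Fin n) =>
        Complex.exp (Complex.I * ((-inner ℝ z ξ : ℝ) : ℂ)) := by fun_prop
    have hbm : AEStronglyMeasurable b volume := by
      have : Nontrivial (EuclideanSpace ℝ (Fin n)) := by
        apply Module.nontrivial_of_finrank_pos (R := ℝ)
        rw [finrank_euclideanSpace_fin]; omega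
      have h1 := hbs.continuousOn.aestronglyMeasurable (μ := volume) hU.measurableSet
      rwa [Measure.restrict_eq_self_of_ae_mem] at h1
      simp [ae_iff]
    have hint : ∀ g : EuclideanSpace ℝ (Fin n) → ℂ, AEStronglyMeasurable g volume →
        (∀ ξ, ‖g ξ‖ ≤ 1) → Integrable (fun ξ =>
          Complex.exp (Complex.I * ((-inner ℝ z ξ : ℝ) : ℂ)) * (g ξ * b ξ * a ξ)) := by
      intro g hg hg1
      have hai : Integrable a := ha.continuous.integrable_of_hasCompactSupport hac
      have h2 : Integrable (fun ξ =>
          (Complex.exp (Complex.I * ((-inner ℝ z ξ : ℝ) : ℂ)) * (g ξ * b ξ)) * a ξ) := by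
        refine hai.bdd_mul (c := 2)
          (hcexp.aestronglyMeasurable.mul (hg.mul hbm)) (Filter.Eventually.of_forall fun ξ => ?_)
        rw [norm_mul, norm_mul, mul_comm Complex.I, Complex.norm_exp_ofReal_mul_I, one_mul]
        have : ‖b ξ‖ ≤ 2 := by
          refine (norm_sub_le _ _).trans ?_
          rw [mul_comm Complex.I, Complex.norm_exp_ofReal_mul_I, norm_one]; norm_num
        calc ‖g ξ‖ * ‖b ξ‖ ≤ 1 * 2 := mul_le_mul (hg1 ξ) this (norm_nonneg _) zero_le_one
          _ = 2 := one_mul _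
      refine h2.congr (Filter.Eventually.of_forall fun ξ => ?_)
      simp only [mul_assoc]
    have hηc : Continuous fun ξ : EuclideanSpace ℝ (Fin n) => (highPass (l • ξ) : ℂ) :=
      contDiff_highPass.continuous.comp (continuous_const_smul l)
    have hη1 : ∀ ξ : EuclideanSpace ℝ (Fin n), ‖(highPass (l • ξ) : ℂ)‖ ≤ 1 := fun ξ => norm_highPass_le_one _
    have i1 := hint (fun ξ => highPass (l • ξ)) hηc.aestronglyMeasurable hη1
    have i2 := hint (fun ξ => 1 - highPass (l • ξ))
      (continuous_const.sub hηc).aestronglyMeasurable fun ξ => norm_one_sub_highPass_le _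
    have i3 : Integrable (fun ξ => Complex.exp (Complex.I * ((-inner ℝ z ξ : ℝ) : ℂ)) * a ξ) :=
      (hcexp.mul ha.continuous).integrable_of_hasCompactSupport hac.mul_left
    simp_rw [hsplit]
    have e1 := integral_add i1 (i2.add i3)
    simp only [Pi.add_apply] at e1
    rw [e1, integral_add i2 i3]
    have b1 := hC₂ b a hbs ha hsupp hbb z hz.le
    have b2 := (enorm_integral_cexp_mul_le volume (fun ξ => -inner ℝ z ξ)
      (fun ξ => (1 - highPass (l • ξ)) * b ξ * a ξ)).trans
        (lintegral_lowPass_le hn hC₁0 ha hsupp hb0 hz0)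
    have b3 : ‖∫ ξ, Complex.exp (Complex.I * ((-inner ℝ z ξ : ℝ) : ℂ)) * a ξ‖ₑ ≤
        ENNReal.ofReal (C₃ * l ^ (-(n + 1 / 2 : ℝ))) * singularSum R a := by
      refine (enorm_oscillatoryIntegral_le ha hac (n + 1) (norm_pos_iff.1 hz0)).trans ?_
      refine (mul_le_mul_right (sum_range_const_mul_le (n + 1) _ _ fun k hk =>
        lintegral_iteratedFDeriv_le_singularSum hn hR ha hsupp hk) _).trans ?_
      rw [← ENNReal.ofReal_natCast, ← mul_assoc, ← mul_assoc,
        ← ENNReal.ofReal_mul (by positivity), ← ENNReal.ofReal_mul (by positivity)]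
      refine mul_le_mul_left (ENNReal.ofReal_le_ofReal ?_) _
      have : (l ^ (n + 1))⁻¹ ≤ l ^ (-(n + 1 / 2 : ℝ)) := by
        rw [← Real.rpow_natCast, ← Real.rpow_neg hz0.le]
        refine Real.rpow_le_rpow_of_exponent_le hz.le ?_
        push_cast; linarith
      calc _ = C₃ * (l ^ (n + 1))⁻¹ := by rw [hC₃]; push_cast; ring
        _ ≤ _ := mul_le_mul_of_nonneg_left this (by positivity)
    refine (enorm_add_le _ _).trans ((add_le_add b1 ((enorm_add_le _ _).trans
      (add_le_add b2 b3))).trans ?_)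
    rw [← add_mul, ← add_mul, ← ENNReal.ofReal_add (by positivity) (by positivity),
      ← ENNReal.ofReal_add (by positivity) (by positivity)]
    refine mul_le_mul_left (ENNReal.ofReal_le_ofReal ?_) _
    have hw : l ^ (-(n + 1 / 2 : ℝ)) ≤ 2 ^ (n + 1) * (1 + l) ^ (-(n + 1 / 2 : ℝ)) := by
      have h2 : (2 * l) ^ (-(n + 1 / 2 : ℝ)) ≤ (1 + l) ^ (-(n + 1 / 2 : ℝ)) :=
        Real.rpow_le_rpow_of_nonpos (by positivity) (by linarith) (by linarith [n.cast_nonneg (α := ℝ)])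
      rw [Real.mul_rpow two_pos.le hz0.le] at h2
      have h3 : (1 : ℝ) ≤ 2 ^ (n + 1) * 2 ^ (-(n + 1 / 2 : ℝ)) := by
        rw [← Real.rpow_natCast, ← Real.rpow_add two_pos]
        refine Real.one_le_rpow one_le_two ?_
        push_cast; linarith
      calc l ^ (-(n + 1 / 2 : ℝ)) ≤ (2 ^ (n + 1) * 2 ^ (-(n + 1 / 2 : ℝ))) * l ^ (-(n + 1 / 2 : ℝ)) :=
            le_mul_of_one_le_left (by positivity) h3
        _ = 2 ^ (n + 1) * (2 ^ (-(n + 1 / 2 : ℝ)) * l ^ (-(n + 1 / 2 : ℝ))) := by ring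
        _ ≤ _ := mul_le_mul_of_nonneg_left h2 (by positivity)
    calc _ = (C₂ + (C₁ * 2 ^ (n + 1) + C₃)) * l ^ (-(n + 1 / 2 : ℝ)) := by ring
      _ ≤ (R ^ n + (C₂ + (C₁ * 2 ^ (n + 1) + C₃))) *
          (2 ^ (n + 1) * (1 + l) ^ (-(n + 1 / 2 : ℝ))) := by
          refine mul_le_mul ?_ hw (by positivity) (by positivity)
          linarith [show 0 ≤ R ^ n by positivity]
      _ = _ := by ring

end KernelEstimate

/-! ### Minkowski and Hölder inequalities for `[0, ∞]`-valued functions. -/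

section LpInequalities

variable {α β : Type*} [MeasurableSpace α] [MeasurableSpace β]

/-- Minkowski's integral inequality for a finite measure and uniformly bounded norms. -/
theorem eLpNorm_lintegral_le_of_forall_le {μ : Measure α} [SFinite μ] {ν : Measure β}
    [IsFiniteMeasure ν] {g : α → β → ℝ≥0∞} (hg : Measurable (Function.uncurry g)) {p : ℝ≥0∞}
    (hp : 1 ≤ p) {S : ℝ≥0∞} (hS : ∀ᵐ y ∂ν, eLpNorm (fun x => g x y) p μ ≤ S) :
    eLpNorm (fun x => ∫⁻ y, g x y ∂ν) p μ ≤ ν Set.univ * S := by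
  have hgx : ∀ x, Measurable (g x) := fun x => hg.comp measurable_prodMk_left
  rcases eq_or_ne p ⊤ with rfl | hpt
  · rw [eLpNorm_exponent_top]
    have h1 : ∀ᵐ y ∂ν, ∀ᵐ x ∂μ, g x y ≤ S := by
      filter_upwards [hS] with y hy
      rw [eLpNorm_exponent_top] at hy
      filter_upwards [enorm_ae_le_eLpNormEssSup (fun x => g x y) μ] with x hx
      exact (by simpa using hx : g x y ≤ _).trans hy
    -- For `p = ∞` the two almost-everywhere quantifiers are exchanged by Fubini for null sets.
    have h2 : ∀ᵐ x ∂μ, ∀ᵐ y ∂ν, g x y ≤ S :=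
      (Measure.ae_ae_comm (p := fun x y => g x y ≤ S)
        (measurableSet_le hg measurable_const)).2 h1
    refine essSup_le_of_ae_le _ ?_
    filter_upwards [h2] with x hx
    rw [enorm_eq_self]
    refine (lintegral_mono_ae hx).trans ?_
    rw [lintegral_const, mul_comm]
  · have hp0 : p ≠ 0 := (zero_lt_one.trans_le hp).ne'
    set s := p.toReal with hs
    have hs1 : 1 ≤ s := by
      rw [hs, ← ENNReal.toReal_one]
      exact ENNReal.toReal_mono hpt hp
    have hs0 : 0 < s := by linarith
    -- Jensen's inequality for a finite measure. With a uniform bound on the slices, Tonelli then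
    -- suffices.
    have hJ : ∀ x, (∫⁻ y, g x y ∂ν) ^ s ≤ ν Set.univ ^ (s - 1) * ∫⁻ y, g x y ^ s ∂ν := by
      intro x
      have h := eLpNorm_le_eLpNorm_mul_rpow_measure_univ (μ := ν) hp
        (hgx x).aemeasurable.aestronglyMeasurable
      rw [eLpNorm_one_eq_lintegral_enorm, eLpNorm_eq_lintegral_rpow_enorm_toReal hp0 hpt] at h
      simp only [enorm_eq_self, ENNReal.toReal_one, ← hs] at h
      refine (ENNReal.rpow_le_rpow h hs0.le).trans (le_of_eq ?_)
      rw [ENNReal.mul_rpow_of_nonneg _ _ hs0.le, ← ENNReal.rpow_mul, ← ENNReal.rpow_mul,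
        one_div_mul_cancel hs0.ne', ENNReal.rpow_one, mul_comm]
      congr 2
      field_simp
    rw [eLpNorm_eq_lintegral_rpow_enorm_toReal hp0 hpt]
    simp only [enorm_eq_self, ← hs]
    have hfin : ∫⁻ x, (∫⁻ y, g x y ∂ν) ^ s ∂μ ≤ (ν Set.univ * S) ^ s := by
      calc ∫⁻ x, (∫⁻ y, g x y ∂ν) ^ s ∂μ
          ≤ ∫⁻ x, ν Set.univ ^ (s - 1) * ∫⁻ y, g x y ^ s ∂ν ∂μ := lintegral_mono hJ
        _ = ν Set.univ ^ (s - 1) * ∫⁻ x, ∫⁻ y, g x y ^ s ∂ν ∂μ :=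
            lintegral_const_mul _ ((hg.pow_const s).lintegral_prod_right')
        _ = ν Set.univ ^ (s - 1) * ∫⁻ y, ∫⁻ x, g x y ^ s ∂μ ∂ν := by
            rw [lintegral_lintegral_swap (hg.pow_const s).aemeasurable]
        _ ≤ ν Set.univ ^ (s - 1) * ∫⁻ _, S ^ s ∂ν := by
            refine mul_le_mul_right (lintegral_mono_ae ?_) _
            filter_upwards [hS] with y hy
            rw [eLpNorm_eq_lintegral_rpow_enorm_toReal hp0 hpt] at hy
            simp only [enorm_eq_self, ← hs] at hy
            have := ENNReal.rpow_le_rpow hy hs0.le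
            rwa [← ENNReal.rpow_mul, one_div_mul_cancel hs0.ne', ENNReal.rpow_one] at this
        _ = (ν Set.univ * S) ^ s := by
            rw [lintegral_const, ENNReal.mul_rpow_of_nonneg _ _ hs0.le, mul_comm (S ^ s), ← mul_assoc]
            congr 1
            conv_lhs => rw [← ENNReal.rpow_one (ν Set.univ), ← ENNReal.rpow_mul, one_mul]
            rw [← ENNReal.rpow_add_of_nonneg _ _ (by linarith) zero_le_one, sub_add_cancel]
    have := ENNReal.rpow_le_rpow hfin (show 0 ≤ 1 / s by positivity)
    rwa [← ENNReal.rpow_mul (ν Set.univ * S), mul_one_div_cancel hs0.ne', ENNReal.rpow_one] at this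

theorem ae_lt_top_of_eLpNorm_lt_top {μ : Measure α} {f : α → ℝ≥0∞} (hf : Measurable f)
    {p : ℝ≥0∞} (hp : p ≠ 0) (h : eLpNorm f p μ < ⊤) : ∀ᵐ x ∂μ, f x < ⊤ := by
  rcases eq_or_ne p ⊤ with rfl | hpt
  · rw [eLpNorm_exponent_top] at h
    filter_upwards [enorm_ae_le_eLpNormEssSup f μ] with x hx
    exact lt_of_le_of_lt (by simpa using hx) h
  · have h1 := lintegral_rpow_enorm_lt_top_of_eLpNorm_lt_top hp hpt h
    simp only [enorm_eq_self] at h1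
    filter_upwards [ae_lt_top (hf.pow_const _) h1.ne] with x hx
    rwa [ENNReal.rpow_lt_top_iff_of_pos (ENNReal.toReal_pos hp hpt)] at hx

/-- Hölder's inequality for functions with values in `[0, ∞]`. -/
theorem eLpNorm_mul_le_of_holderTriple {μ : Measure α} {f g : α → ℝ≥0∞} (hf : Measurable f)
    (hg : Measurable g) {p q r : ℝ≥0∞} [ENNReal.HolderTriple p q r]
    (hft : ∀ᵐ x ∂μ, f x < ⊤) (hgt : ∀ᵐ x ∂μ, g x < ⊤) :
    eLpNorm (fun x => f x * g x) r μ ≤ eLpNorm f p μ * eLpNorm g q μ := by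
  -- Almost-everywhere finiteness lets `toReal` preserve the norms, so Hölder's inequality for real
  -- functions applies, also with `r < 1`.
  have e : ∀ {h : α → ℝ≥0∞}, (∀ᵐ x ∂μ, h x < ⊤) → ∀ s, eLpNorm (fun x => (h x).toReal) s μ =
      eLpNorm h s μ := by
    intro h hh s
    refine eLpNorm_congr_enorm_ae ?_
    filter_upwards [hh] with x hx
    rw [enorm_eq_self, Real.enorm_of_nonneg ENNReal.toReal_nonneg, ENNReal.ofReal_toReal hx.ne]
  have hfg : ∀ᵐ x ∂μ, f x * g x < ⊤ := by
    filter_upwards [hft, hgt] with x h1 h2 using ENNReal.mul_lt_top h1 h2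
  have h := eLpNorm_le_eLpNorm_mul_eLpNorm_of_nnnorm (μ := μ) (p := p) (q := q) (r := r)
    hf.ennreal_toReal.aestronglyMeasurable hg.ennreal_toReal.aestronglyMeasurable
    (fun a b : ℝ => a * b) 1 (Filter.Eventually.of_forall fun x => by simp)
  rw [e hft, e hgt, ENNReal.coe_one, one_mul] at h
  rw [← e hfg]
  simpa only [ENNReal.toReal_mul] using h

end LpInequalities

/-! ### A representative of the amplitude that is regular for every `x`. -/

section Regularization

variable {n : ℕ}

/-- A family of compactly supported smooth functions of `ξ` that depends measurably on `x`. -/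
structure IsRegularFamily (K : Set (EuclideanSpace ℝ (Fin n)))
    (a : EuclideanSpace ℝ (Fin n) → EuclideanSpace ℝ (Fin n) → ℂ) : Prop where
  measurable : ∀ ξ, Measurable fun x => a x ξ
  smooth : ∀ x, ContDiff ℝ ∞ (a x)
  support : ∀ x, tsupport (a x) ⊆ K

/-- The null set on which `a(·, ξ)` differs from a measurable function depends on `ξ`. A countable
dense set of `ξ` leaves a single null set, and continuity in `ξ` recovers the remaining values as
limits. -/
theorem exists_isRegularFamily {K : Set (EuclideanSpace ℝ (Fin n))}
    {a : EuclideanSpace ℝ (Fin n) → EuclideanSpace ℝ (Fin n) → ℂ}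
    (hm : ∀ ξ, AEStronglyMeasurable (fun x => a x ξ) volume)
    (hs : ∀ᵐ x, ContDiff ℝ ∞ (a x)) (hK : ∀ᵐ x, tsupport (a x) ⊆ K) :
    ∃ b, IsRegularFamily K b ∧ ∀ᵐ x, b x = a x := by
  classical
  set D := TopologicalSpace.denseSeq (EuclideanSpace ℝ (Fin n)) with hD
  have hgood : ∀ᵐ x, ContDiff ℝ ∞ (a x) ∧ tsupport (a x) ⊆ K ∧
      ∀ i, a x (D i) = (hm (D i)).mk _ x := by
    filter_upwards [hs, hK, ae_all_iff.2 fun i => (hm (D i)).ae_eq_mk] with x h1 h2 h3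
    exact ⟨h1, h2, h3⟩
  set N := toMeasurable volume {x | ¬ (ContDiff ℝ ∞ (a x) ∧ tsupport (a x) ⊆ K ∧
      ∀ i, a x (D i) = (hm (D i)).mk _ x)} with hN
  have hN0 : volume N = 0 := by
    rw [hN, measure_toMeasurable]; exact hgood
  have hNm : MeasurableSet N := measurableSet_toMeasurable _ _
  have hgoodN : ∀ x, x ∉ N → ContDiff ℝ ∞ (a x) ∧ tsupport (a x) ⊆ K ∧
      ∀ i, a x (D i) = (hm (D i)).mk _ x := by
    intro x hx
    by_contra h
    exact hx (subset_toMeasurable _ _ h)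
  have hbs : ∀ x, ContDiff ℝ ∞ (if x ∈ N then (0 : EuclideanSpace ℝ (Fin n) → ℂ) else a x) := by
    intro x
    split_ifs with h
    · exact contDiff_const
    · exact (hgoodN x h).1
  refine ⟨fun x => if x ∈ N then 0 else a x, ⟨fun ξ => ?_, hbs, fun x => ?_⟩, ?_⟩
  · obtain ⟨y, hy, hlim⟩ := mem_closure_iff_seq_limit.1
      (TopologicalSpace.denseRange_denseSeq (EuclideanSpace ℝ (Fin n)) ξ)
    choose i hi using hy
    refine measurable_of_tendsto_metrizable (f := fun j x => if x ∈ N then (0 : ℂ)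
      else (hm (D (i j))).mk _ x) (fun j => Measurable.ite hNm measurable_const
        (hm (D (i j))).stronglyMeasurable_mk.measurable) ?_
    rw [tendsto_pi_nhds]
    intro x
    have h1 : Filter.Tendsto (fun j => (if x ∈ N then (0 : EuclideanSpace ℝ (Fin n) → ℂ) else a x)
        (y j)) Filter.atTop (nhds ((if x ∈ N then (0 : EuclideanSpace ℝ (Fin n) → ℂ) else a x) ξ)) :=
      ((hbs x).continuous.tendsto ξ).comp hlim
    refine h1.congr fun j => ?_
    by_cases hx : x ∈ N
    · simp [hx]
    · simp only [hx, if_false]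
      rw [← hi j]
      exact (hgoodN x hx).2.2 (i j)
  · by_cases hx : x ∈ N
    · simp [hx, tsupport]
    · simp only [hx, if_false]
      exact (hgoodN x hx).2.1
  · have : ∀ᵐ x, x ∉ N := measure_eq_zero_iff_ae_notMem.1 hN0
    filter_upwards [this] with x hx
    simp [hx]

/-- Derivatives are pointwise limits of difference quotients, so measurability in `x` passes to
them. With continuity in `ξ` this later yields joint measurability. -/
theorem measurable_iterDir_of_measurable {b : EuclideanSpace ℝ (Fin n) → EuclideanSpace ℝ (Fin n) → ℂ}
    (hm : ∀ ξ, Measurable fun x => b x ξ) (hs : ∀ x, ContDiff ℝ ∞ (b x))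
    (L : List (EuclideanSpace ℝ (Fin n))) :
    (∀ ξ, Measurable fun x => iterDir L (b x) ξ) ∧ ∀ x, ContDiff ℝ ∞ (iterDir L (b x)) := by
  have hsm : ∀ x, ContDiff ℝ ∞ (iterDir L (b x)) := fun x => by
    rw [← contDiffOn_univ]
    exact contDiffOn_iterDir isOpen_univ (hs x).contDiffOn L
  refine ⟨?_, hsm⟩
  clear hsm
  induction L with
  | nil => exact hm
  | cons v L ih =>
    intro ξ
    have hd : ∀ x, DifferentiableAt ℝ (iterDir L (b x)) ξ := fun x => by
      have : ContDiff ℝ ∞ (iterDir L (b x)) := by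
        rw [← contDiffOn_univ]
        exact contDiffOn_iterDir isOpen_univ (hs x).contDiffOn L
      exact this.differentiable (by simp) ξ
    refine measurable_of_tendsto_metrizable (f := fun (k : ℕ) x => (k : ℝ) •
      (iterDir L (b x) (ξ + (k : ℝ)⁻¹ • v) - iterDir L (b x) ξ))
      (fun k => ((ih _).sub (ih _)).const_smul (k : ℝ)) ?_
    rw [tendsto_pi_nhds]
    intro x
    refine (hd x).hasFDerivAt.lim v (c := fun k : ℕ => (k : ℝ)) ?_
    simpa using tendsto_natCast_atTop_atTop (R := ℝ)

theorem IsRegularFamily.measurable_multiDeriv {K : Set (EuclideanSpace ℝ (Fin n))}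
    {a : EuclideanSpace ℝ (Fin n) → EuclideanSpace ℝ (Fin n) → ℂ} (h : IsRegularFamily K a)
    (α : Fin n → ℕ) : Measurable (Function.uncurry fun x ξ => multiDeriv α (a x) ξ) := by
  obtain ⟨h1, h2⟩ := measurable_iterDir_of_measurable h.measurable h.smooth
    ((indexList α).map stdVec)
  simp only [multiDeriv_eq_iterDir]
  have := measurable_uncurry_of_continuous_of_measurable
    (u := fun ξ x => iterDir ((indexList α).map stdVec) (a x) ξ) (fun x => (h2 x).continuous) h1
  exact this.comp measurable_swap

theorem IsRegularFamily.measurable_uncurry {K : Set (EuclideanSpace ℝ (Fin n))}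
    {a : EuclideanSpace ℝ (Fin n) → EuclideanSpace ℝ (Fin n) → ℂ} (h : IsRegularFamily K a) :
    Measurable (Function.uncurry a) := by
  have := measurable_uncurry_of_continuous_of_measurable
    (u := fun ξ x => a x ξ) (fun x => (h.smooth x).continuous) h.measurable
  exact this.comp measurable_swap

end Regularization

/-! ### Amplitude seminorms on bounded frequency sets. -/

section Seminorms

variable {n : ℕ} {p : ℝ≥0∞} {m ρ : ℝ}

theorem ampSeminorm_congr {a b : EuclideanSpace ℝ (Fin n) → EuclideanSpace ℝ (Fin n) → ℂ}
    (h : ∀ᵐ x, b x = a x) (s : ℕ) : ampSeminorm p m ρ s b = ampSeminorm p m ρ s a := by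
  unfold ampSeminorm
  refine Finset.sum_congr rfl fun k _ => Finset.sum_congr rfl fun α _ => iSup_congr fun ξ => ?_
  congr 1
  refine eLpNorm_congr_ae ?_
  filter_upwards [h] with x hx
  rw [hx]

theorem one_le_japBracket (ξ : EuclideanSpace ℝ (Fin n)) : 1 ≤ japBracket ξ := by
  rw [japBracket, Real.one_le_sqrt]
  linarith [sq_nonneg ‖ξ‖]

theorem japBracket_le (ξ : EuclideanSpace ℝ (Fin n)) : japBracket ξ ≤ 1 + ‖ξ‖ := by
  rw [japBracket, Real.sqrt_le_left (by positivity)]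
  nlinarith [norm_nonneg ξ]

theorem AmplitudeClass.ampSeminorm_lt_top
    {a : EuclideanSpace ℝ (Fin n) → EuclideanSpace ℝ (Fin n) → ℂ}
    (h : AmplitudeClass p m ρ a) (s : ℕ) : ampSeminorm p m ρ s a < ⊤ := by
  refine ENNReal.sum_lt_top.2 fun k _ => ENNReal.sum_lt_top.2 fun α _ => ?_
  obtain ⟨C, hC⟩ := h.bound α
  refine lt_of_le_of_lt (iSup_le fun ξ => ?_) (ENNReal.ofReal_lt_top (r := C))
  have hj : 0 < japBracket ξ := by linarith [one_le_japBracket ξ]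
  refine (mul_le_mul_right (hC ξ) _).trans (le_of_eq ?_)
  rw [← ENNReal.ofReal_mul (by positivity), mul_left_comm, ← Real.rpow_add hj]
  simp

/-- For bounded `ξ` the weight is bounded below. Since `ρ ≥ 0` the power `-ρ|α|` can only help and
is dropped, and `|m|` covers both signs of `m`; hence the constant is independent of `α` and `ρ`. -/
theorem eLpNorm_multiDeriv_le_ampSeminormTerm
    {a : EuclideanSpace ℝ (Fin n) → EuclideanSpace ℝ (Fin n) → ℂ} (hρ : 0 ≤ ρ) (α : Fin n → ℕ)
    {R : ℝ} {ξ : EuclideanSpace ℝ (Fin n)} (hξ : ‖ξ‖ ≤ R) :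
    eLpNorm (fun x => multiDeriv α (a x) ξ) p volume ≤ ENNReal.ofReal ((1 + R) ^ |m|) *
      ⨆ ξ : EuclideanSpace ℝ (Fin n), ENNReal.ofReal (japBracket ξ ^ (ρ * multiOrder α - m)) *
        eLpNorm (fun x => multiDeriv α (a x) ξ) p volume := by
  have h1 := one_le_japBracket ξ
  have hj : 0 < japBracket ξ := by linarith
  have h2 : 1 ≤ (1 + R) ^ |m| * japBracket ξ ^ (ρ * multiOrder α - m) := by
    have e1 : japBracket ξ ^ (m - ρ * multiOrder α) ≤ (1 + R) ^ |m| := by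
      calc japBracket ξ ^ (m - ρ * multiOrder α) ≤ japBracket ξ ^ |m| := by
            refine Real.rpow_le_rpow_of_exponent_le h1 ?_
            have : 0 ≤ ρ * multiOrder α := by positivity
            linarith [le_abs_self m]
        _ ≤ _ := Real.rpow_le_rpow hj.le ((japBracket_le ξ).trans (by linarith)) (abs_nonneg _)
    have e2 : japBracket ξ ^ (m - ρ * multiOrder α) * japBracket ξ ^ (ρ * multiOrder α - m) = 1 := by
      rw [← Real.rpow_add hj]; simp
    exact e2.ge.trans (mul_le_mul_of_nonneg_right e1 (by positivity))
  have h3 := le_iSup (fun ξ : EuclideanSpace ℝ (Fin n) =>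
    ENNReal.ofReal (japBracket ξ ^ (ρ * multiOrder α - m)) *
        eLpNorm (fun x => multiDeriv α (a x) ξ) p volume) ξ
  have hR : 0 ≤ R := (norm_nonneg _).trans hξ
  calc _ ≤ ENNReal.ofReal ((1 + R) ^ |m| * japBracket ξ ^ (ρ * multiOrder α - m)) *
        eLpNorm (fun x => multiDeriv α (a x) ξ) p volume :=
        le_mul_of_one_le_left (by positivity) (by rwa [ENNReal.one_le_ofReal])
    _ = ENNReal.ofReal ((1 + R) ^ |m|) * (ENNReal.ofReal (japBracket ξ ^ (ρ * multiOrder α - m)) *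
        eLpNorm (fun x => multiDeriv α (a x) ξ) p volume) := by
        rw [ENNReal.ofReal_mul (by positivity), mul_assoc]
    _ ≤ _ := mul_le_mul_right h3 _

end Seminorms

/-! ### The amplitude factor in the kernel bound lies in `L^p`. -/

section AmplitudeMajorant

variable {n : ℕ}

/-- The sum over `|α| ≤ n + 1` of the integrals of `|∂^α a|` against the singular measure. -/
noncomputable def derivSum (R : ℝ) (a : EuclideanSpace ℝ (Fin n) → ℂ) : ℝ≥0∞ :=
  ∑ k ∈ Finset.range (n + 1 + 1), ∑ α ∈ Finset.piAntidiag (Finset.univ : Finset (Fin n)) k,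
    ∫⁻ ξ, ‖multiDeriv α a ξ‖ₑ ∂(singularMeasure n R)

theorem singularSum_le_derivSum (hn : 1 ≤ n) (R : ℝ) {a : EuclideanSpace ℝ (Fin n) → ℂ}
    (ha : ContDiff ℝ ∞ a) : singularSum R a ≤ (n : ℝ≥0∞) ^ (n + 1) * derivSum R a := by
  have hm : ∀ α : Fin n → ℕ, Measurable fun ξ => ‖multiDeriv α a ξ‖ₑ := fun α =>
    (((contDiffOn_univ.1 (contDiffOn_multiDeriv isOpen_univ ha.contDiffOn α)).continuous).enorm).measurable
  rw [singularSum, derivSum, Finset.mul_sum]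
  refine Finset.sum_le_sum fun k hk => ?_
  rw [← lintegral_finsetSum _ fun α _ => hm α,
    ← lintegral_const_mul _ (Finset.measurable_sum _ fun α _ => hm α)]
  refine lintegral_mono fun ξ => ?_
  have h := norm_iteratedFDeriv_le_sum_multiDeriv isOpen_univ (Set.mem_univ ξ) k ha.contDiffOn
  rw [← ofReal_norm]
  refine (ENNReal.ofReal_le_ofReal h).trans ?_
  rw [ENNReal.ofReal_mul (by positivity), ENNReal.ofReal_pow (by positivity),
    ENNReal.ofReal_natCast, ENNReal.ofReal_sum_of_nonneg fun _ _ => norm_nonneg _]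
  simp only [ofReal_norm]
  refine mul_le_mul_left (pow_le_pow_right₀ (by exact_mod_cast hn) ?_) _
  have := Finset.mem_range.1 hk
  omega

theorem measurable_derivSum (hn : 1 ≤ n) (R : ℝ) {K : Set (EuclideanSpace ℝ (Fin n))}
    {a : EuclideanSpace ℝ (Fin n) → EuclideanSpace ℝ (Fin n) → ℂ} (h : IsRegularFamily K a) :
    Measurable fun x => derivSum R (a x) := by
  have := isFiniteMeasure_singularMeasure hn R
  refine Finset.measurable_sum _ fun k _ => Finset.measurable_sum _ fun α _ => ?_
  exact (h.measurable_multiDeriv α).enorm.lintegral_prod_right'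

/-- Minkowski's inequality moves the `L^p` norm inside the finite singular measure, where each slice
is controlled by the seminorm. -/
theorem eLpNorm_derivSum_le (hn : 1 ≤ n) (R : ℝ) {K : Set (EuclideanSpace ℝ (Fin n))}
    {a : EuclideanSpace ℝ (Fin n) → EuclideanSpace ℝ (Fin n) → ℂ} (h : IsRegularFamily K a)
    {p : ℝ≥0∞} (hp : 1 ≤ p) {m ρ : ℝ} (hρ : 0 ≤ ρ) :
    eLpNorm (fun x => derivSum R (a x)) p volume ≤ singularMeasure n R Set.univ *
      ENNReal.ofReal ((1 + R) ^ |m|) * ampSeminorm p m ρ (n + 1) a := by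
  have := isFiniteMeasure_singularMeasure hn R
  have hmeas : ∀ α : Fin n → ℕ, Measurable fun x =>
      ∫⁻ ξ, ‖multiDeriv α (a x) ξ‖ₑ ∂(singularMeasure n R) := fun α =>
    (h.measurable_multiDeriv α).enorm.lintegral_prod_right'
  have hball : ∀ᵐ ξ ∂(singularMeasure n R), ‖ξ‖ ≤ R := by
    have h1 : ∀ᵐ ξ ∂(volume.restrict (Metric.closedBall (0 : EuclideanSpace ℝ (Fin n)) R)),
        ‖ξ‖ ≤ R := by
      filter_upwards [ae_restrict_mem Metric.isClosed_closedBall.measurableSet] with ξ hξ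
      simpa using hξ
    exact (withDensity_absolutelyContinuous _ _).ae_le h1
  have hterm : ∀ α : Fin n → ℕ, eLpNorm (fun x =>
      ∫⁻ ξ, ‖multiDeriv α (a x) ξ‖ₑ ∂(singularMeasure n R)) p volume ≤
      singularMeasure n R Set.univ * ENNReal.ofReal ((1 + R) ^ |m|) *
      ⨆ ξ : EuclideanSpace ℝ (Fin n), ENNReal.ofReal (japBracket ξ ^ (ρ * multiOrder α - m)) *
        eLpNorm (fun x => multiDeriv α (a x) ξ) p volume := by
    intro α
    rw [mul_assoc]
    refine eLpNorm_lintegral_le_of_forall_le (g := fun x ξ => ‖multiDeriv α (a x) ξ‖ₑ)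
      (h.measurable_multiDeriv α).enorm hp ?_
    filter_upwards [hball] with ξ hξ
    rw [eLpNorm_enorm]
    exact eLpNorm_multiDeriv_le_ampSeminormTerm hρ α hξ
  have e : (fun x => derivSum R (a x)) = ∑ k ∈ Finset.range (n + 1 + 1),
      ∑ α ∈ Finset.piAntidiag (Finset.univ : Finset (Fin n)) k, fun x =>
        ∫⁻ ξ, ‖multiDeriv α (a x) ξ‖ₑ ∂(singularMeasure n R) := by
    funext x
    simp only [derivSum, Finset.sum_apply]
  rw [e, ampSeminorm, Finset.mul_sum]
  refine (eLpNorm_sum_le (fun k _ => ?_) hp).trans (Finset.sum_le_sum fun k _ => ?_)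
  · exact Finset.aestronglyMeasurable_sum _ fun α _ =>
      (hmeas α).aemeasurable.aestronglyMeasurable
  · rw [Finset.mul_sum]
    exact (eLpNorm_sum_le (fun α _ => (hmeas α).aemeasurable.aestronglyMeasurable) hp).trans
      (Finset.sum_le_sum fun α _ => hterm α)

end AmplitudeMajorant

/-! ### Convolution with the decay weight. -/

section Weight

variable {n : ℕ}

/-- The integrable weight `(1 + |z|)^{-(n + 1/2)}`. -/
noncomputable def decayWeight (z : EuclideanSpace ℝ (Fin n)) : ℝ≥0∞ :=
  ENNReal.ofReal ((1 + ‖z‖) ^ (-(n + 1 / 2 : ℝ)))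

theorem measurable_decayWeight : Measurable (decayWeight (n := n)) :=
  ((measurable_const.add measurable_norm).pow_const _).ennreal_ofReal

theorem lintegral_decayWeight_lt_top : ∫⁻ z : EuclideanSpace ℝ (Fin n), decayWeight z < ⊤ := by
  have h : Integrable (fun z : EuclideanSpace ℝ (Fin n) => (1 + ‖z‖) ^ (-(n + 1 / 2 : ℝ))) :=
    integrable_one_add_norm (by rw [finrank_euclideanSpace_fin]; linarith)
  exact h.lintegral_lt_top

/-- The average of `|u|` around `z` with respect to the decay weight. -/
noncomputable def weightedAverage (u : EuclideanSpace ℝ (Fin n) → ℂ)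
    (z : EuclideanSpace ℝ (Fin n)) : ℝ≥0∞ := ∫⁻ y, ‖u (y + z)‖ₑ * decayWeight y

theorem measurable_weightedAverage {u : EuclideanSpace ℝ (Fin n) → ℂ} (hu : Measurable u) :
    Measurable (weightedAverage u) := by
  refine Measurable.lintegral_prod_right' (f := fun w : EuclideanSpace ℝ (Fin n) ×
    EuclideanSpace ℝ (Fin n) => ‖u (w.2 + w.1)‖ₑ * decayWeight w.2) ?_
  exact ((hu.comp (measurable_snd.add measurable_fst)).enorm).mul
    (measurable_decayWeight.comp measurable_snd)

/-- Young's inequality, obtained as Minkowski's inequality for the finite measure with the weight as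
density; translations preserve the `L^q` norm. -/
theorem eLpNorm_weightedAverage_le {u : EuclideanSpace ℝ (Fin n) → ℂ} (hu : Measurable u)
    {q : ℝ≥0∞} (hq : 1 ≤ q) : eLpNorm (weightedAverage u) q volume ≤
      (∫⁻ z : EuclideanSpace ℝ (Fin n), decayWeight z) * eLpNorm u q volume := by
  set ν := (volume : Measure (EuclideanSpace ℝ (Fin n))).withDensity decayWeight with hν
  have : IsFiniteMeasure ν := isFiniteMeasure_withDensity lintegral_decayWeight_lt_top.ne
  have e : weightedAverage u = fun z => ∫⁻ y, ‖u (y + z)‖ₑ ∂ν := by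
    funext z
    have hm : Measurable fun y => ‖u (y + z)‖ₑ := (hu.comp (measurable_id.add_const z)).enorm
    rw [hν, lintegral_withDensity_eq_lintegral_mul _ measurable_decayWeight hm]
    exact lintegral_congr fun y => mul_comm _ _
  have hmass : ν Set.univ = ∫⁻ z : EuclideanSpace ℝ (Fin n), decayWeight z := by
    rw [hν, withDensity_apply _ MeasurableSet.univ, Measure.restrict_univ]
  rw [e, ← hmass]
  refine eLpNorm_lintegral_le_of_forall_le (g := fun z y => ‖u (y + z)‖ₑ)
    (hu.comp (measurable_snd.add measurable_fst)).enorm hq (Filter.Eventually.of_forall fun y => ?_)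
  rw [eLpNorm_enorm]
  exact (eLpNorm_comp_measurePreserving hu.aestronglyMeasurable
    (measurePreserving_add_left volume y)).le

theorem lintegral_enorm_mul_decayWeight_sub (u : EuclideanSpace ℝ (Fin n) → ℂ)
    (z : EuclideanSpace ℝ (Fin n)) :
    ∫⁻ y, ‖u y‖ₑ * decayWeight (y - z) = weightedAverage u z := by
  have h := lintegral_sub_right_eq_self (μ := volume) (fun y => ‖u (y + z)‖ₑ * decayWeight y) z
  simpa only [sub_add_cancel, weightedAverage] using h

end Weight

/-! ### Kernel majorization and boundedness of the operator. -/

section FourierIntegral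

variable {n : ℕ} {B : (Fin n → ℕ) → (Fin n → ℕ) → ℝ}
  {φ : EuclideanSpace ℝ (Fin n) → EuclideanSpace ℝ (Fin n) → ℝ}
  {a : EuclideanSpace ℝ (Fin n) → EuclideanSpace ℝ (Fin n) → ℂ}
  {K : Set (EuclideanSpace ℝ (Fin n))}

open Classical in
/-- The phase with the irrelevant values at `ξ = 0` replaced by `0`. -/
noncomputable def zeroedPhase (φ : EuclideanSpace ℝ (Fin n) → EuclideanSpace ℝ (Fin n) → ℝ)
    (x ξ : EuclideanSpace ℝ (Fin n)) : ℝ := if ξ = 0 then 0 else φ x ξ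

theorem ae_ne_zero (hn : 1 ≤ n) : ∀ᵐ ξ : EuclideanSpace ℝ (Fin n), ξ ≠ 0 := by
  have : Nontrivial (EuclideanSpace ℝ (Fin n)) := by
    apply Module.nontrivial_of_finrank_pos (R := ℝ)
    rw [finrank_euclideanSpace_fin]; omega
  simp [ae_iff]

theorem fioKernel_zeroedPhase (hn : 1 ≤ n) : fioKernel (zeroedPhase φ) a = fioKernel φ a := by
  funext x y
  unfold fioKernel
  congr 1
  refine integral_congr_ae ?_
  filter_upwards [ae_ne_zero hn] with ξ hξ
  simp [zeroedPhase, hξ]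

theorem fio_zeroedPhase (hn : 1 ≤ n) (u : EuclideanSpace ℝ (Fin n) → ℂ) :
    fio (zeroedPhase φ) a u = fio φ a u := by
  funext x
  unfold fio
  congr 1
  refine integral_congr_ae ?_
  filter_upwards [ae_ne_zero hn] with ξ hξ
  simp [zeroedPhase, hξ]

/-- The values `φ x 0` are arbitrary and may be nonmeasurable in `x`. Zeroing them leaves a function
continuous on an open set and constant off it, and changes no integral in `ξ`. -/
theorem PhaseClass.measurable_zeroedPhase (h : PhaseClass 2 B φ) :
    Measurable (Function.uncurry (zeroedPhase φ)) := by
  classical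
  have h1 : Measurable ((phaseDomain n).piecewise
      (fun z : EuclideanSpace ℝ (Fin n) × EuclideanSpace ℝ (Fin n) => φ z.1 z.2) fun _ => 0) :=
    h.contDiffOn.continuousOn.measurable_piecewise continuousOn_const
      isOpen_phaseDomain.measurableSet
  convert h1 using 1
  funext z
  by_cases hz : z.2 = 0
  · simp [Function.uncurry, zeroedPhase, phaseDomain, hz, Set.piecewise]
  · simp [Function.uncurry, zeroedPhase, phaseDomain, hz, Set.piecewise]

theorem PhaseClass.stronglyMeasurable_fioKernel (hn : 1 ≤ n) (h : PhaseClass 2 B φ)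
    (ha : IsRegularFamily K a) : StronglyMeasurable (Function.uncurry (fioKernel φ a)) := by
  rw [← fioKernel_zeroedPhase hn]
  unfold fioKernel
  refine StronglyMeasurable.const_mul (f := fun z : EuclideanSpace ℝ (Fin n) ×
    EuclideanSpace ℝ (Fin n) => ∫ ξ, Complex.exp (Complex.I *
      ((zeroedPhase φ z.1 ξ - inner ℝ z.2 ξ : ℝ) : ℂ)) * a z.1 ξ) ?_ _
  refine StronglyMeasurable.integral_prod_right ?_
  have m1 : Measurable fun w : (EuclideanSpace ℝ (Fin n) × EuclideanSpace ℝ (Fin n)) ×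
      EuclideanSpace ℝ (Fin n) => zeroedPhase φ w.1.1 w.2 :=
    h.measurable_zeroedPhase.comp ((measurable_fst.comp measurable_fst).prodMk measurable_snd)
  have m2 : Measurable fun w : (EuclideanSpace ℝ (Fin n) × EuclideanSpace ℝ (Fin n)) ×
      EuclideanSpace ℝ (Fin n) => a w.1.1 w.2 :=
    ha.measurable_uncurry.comp ((measurable_fst.comp measurable_fst).prodMk measurable_snd)
  have m3 : Measurable fun w : (EuclideanSpace ℝ (Fin n) × EuclideanSpace ℝ (Fin n)) ×
      EuclideanSpace ℝ (Fin n) => (inner ℝ w.1.2 w.2 : ℝ) :=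
    (measurable_snd.comp measurable_fst).inner measurable_snd
  exact ((Complex.measurable_exp.comp (measurable_const.mul
    (Complex.measurable_ofReal.comp (m1.sub m3)))).mul m2).stronglyMeasurable

theorem enorm_inv_two_pi_pow_le_one : ‖(((2 * Real.pi) ^ n)⁻¹ : ℂ)‖ₑ ≤ 1 := by
  rw [← ofReal_norm, ENNReal.ofReal_le_one, norm_inv, norm_pow]
  refine inv_le_one_of_one_le₀ (one_le_pow₀ ?_)
  rw [← Complex.ofReal_ofNat, ← Complex.ofReal_mul, Complex.norm_real,
    Real.norm_of_nonneg (by positivity)]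
  linarith [Real.pi_gt_three]

/-- The pointwise bound for the kernel. -/
theorem exists_enorm_fioKernel_le (hn : 2 ≤ n) (B : (Fin n → ℕ) → (Fin n → ℕ) → ℝ) (R : ℝ)
    (hR : 1 ≤ R) : ∃ C : ℝ≥0∞, C < ⊤ ∧
      ∀ φ : EuclideanSpace ℝ (Fin n) → EuclideanSpace ℝ (Fin n) → ℝ, PhaseClass 2 B φ →
      ∀ a : EuclideanSpace ℝ (Fin n) → EuclideanSpace ℝ (Fin n) → ℂ,
      ∀ x, ContDiff ℝ ∞ (a x) → tsupport (a x) ⊆ Metric.closedBall 0 R → ∀ y,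
      ‖fioKernel φ a x y‖ₑ ≤
        C * derivSum R (a x) * decayWeight (y - phaseGradient φ (stdVec ⟨0, by omega⟩) x) := by
  have hn1 : 1 ≤ n := by omega
  obtain ⟨C, hC0, hC⟩ := exists_kernel_bound hn1
    (8 * phaseConst B 2 + ∑ k ∈ Finset.range (n + 1 + 1), phaseConst B k) R hR
  refine ⟨ENNReal.ofReal C * (n : ℝ≥0∞) ^ (n + 1), ENNReal.mul_lt_top ENNReal.ofReal_lt_top
    (ENNReal.pow_lt_top (ENNReal.natCast_lt_top n)), ?_⟩
  intro φ hφ a x ha hsupp y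
  set v := phaseGradient φ (stdVec ⟨0, by omega⟩) x with hv
  have h := hC (fun ξ => φ x ξ - inner ℝ v ξ) (a x) (hφ.contDiffOn_reduced v x) ha hsupp
    (hφ.reduced_bound hn (n + 1) x) (y - v)
  -- The linear part of the phase is absorbed into the frequency, which moves the centre of the
  -- kernel to `v`.
  have e : ∀ ξ, φ x ξ - inner ℝ v ξ - inner ℝ (y - v) ξ = φ x ξ - inner ℝ y ξ := by
    intro ξ; rw [inner_sub_left]; ring
  simp only [e] at h
  unfold fioKernel
  rw [enorm_mul]
  push_cast
  calc _ ≤ 1 * (ENNReal.ofReal (C * (1 + ‖y - v‖) ^ (-(n + 1 / 2 : ℝ))) * singularSum R (a x)) := by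
        refine mul_le_mul' ?_ ?_
        · exact enorm_inv_two_pi_pow_le_one
        · push_cast at h
          exact h
    _ ≤ ENNReal.ofReal (C * (1 + ‖y - v‖) ^ (-(n + 1 / 2 : ℝ))) *
          ((n : ℝ≥0∞) ^ (n + 1) * derivSum R (a x)) := by
        rw [one_mul]
        exact mul_le_mul_right (singularSum_le_derivSum hn1 R ha) _
    _ = _ := by
        rw [ENNReal.ofReal_mul hC0, decayWeight]
        ring

/-- Fubini: the double integrand is a unimodular factor times the tensor product of two integrable
functions, `a x` and `u`. -/
theorem PhaseClass.fio_eq_fioExt (hn : 1 ≤ n) (h : PhaseClass 2 B φ) (ha : IsRegularFamily K a)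
    (hK : IsCompact K) {u : EuclideanSpace ℝ (Fin n) → ℂ} (hu : Integrable u) :
    fio φ a u = fioExt φ a u := by
  rw [← fio_zeroedPhase hn]
  funext x
  unfold fioExt
  rw [← fioKernel_zeroedPhase hn]
  unfold fio fioKernel fourierHat
  set P := zeroedPhase φ with hP
  have hac : HasCompactSupport (a x) := hK.of_isClosed_subset (isClosed_tsupport _) (ha.support x)
  have hai : Integrable (a x) := (ha.smooth x).continuous.integrable_of_hasCompactSupport hac
  have hPm : Measurable (P x) := h.measurable_zeroedPhase.comp measurable_prodMk_left
  have hint : Integrable (Function.uncurry fun ξ y : EuclideanSpace ℝ (Fin n) =>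
      Complex.exp (Complex.I * ((P x ξ - inner ℝ y ξ : ℝ) : ℂ)) * (a x ξ * u y))
      (volume.prod volume) := by
    refine (hai.mul_prod hu).bdd_mul (c := 1) ?_ (Filter.Eventually.of_forall fun w => ?_)
    · have m1 : Measurable fun w : EuclideanSpace ℝ (Fin n) × EuclideanSpace ℝ (Fin n) =>
          (inner ℝ w.2 w.1 : ℝ) := measurable_snd.inner measurable_fst
      exact (Complex.measurable_exp.comp (measurable_const.mul (Complex.measurable_ofReal.comp
        ((hPm.comp measurable_fst).sub m1)))).aestronglyMeasurable
    · rw [mul_comm Complex.I, Complex.norm_exp_ofReal_mul_I]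
  have hswap := integral_integral_swap hint
  have l1 : ∀ ξ, Complex.exp (Complex.I * ((P x ξ : ℝ) : ℂ)) * a x ξ *
      (∫ y, Complex.exp (-Complex.I * ((inner ℝ y ξ : ℝ) : ℂ)) * u y) =
      ∫ y, Complex.exp (Complex.I * ((P x ξ - inner ℝ y ξ : ℝ) : ℂ)) * (a x ξ * u y) := by
    intro ξ
    rw [← integral_const_mul]
    refine integral_congr_ae (Filter.Eventually.of_forall fun y => ?_)
    have : Complex.exp (Complex.I * ((P x ξ - inner ℝ y ξ : ℝ) : ℂ)) =
        Complex.exp (Complex.I * ((P x ξ : ℝ) : ℂ)) *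
          Complex.exp (-Complex.I * ((inner ℝ y ξ : ℝ) : ℂ)) := by
      rw [← Complex.exp_add]; congr 1; push_cast; ring
    simp only [this]; ring
  have l2 : ∀ y, (((2 * Real.pi) ^ n)⁻¹ : ℝ) * (∫ ξ, Complex.exp (Complex.I *
      ((P x ξ - inner ℝ y ξ : ℝ) : ℂ)) * a x ξ) * u y = (((2 * Real.pi) ^ n)⁻¹ : ℝ) *
      ∫ ξ, Complex.exp (Complex.I * ((P x ξ - inner ℝ y ξ : ℝ) : ℂ)) * (a x ξ * u y) := by
    intro y
    rw [mul_assoc, ← integral_mul_const]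
    simp only [mul_assoc]
  simp_rw [l1, l2]
  rw [hswap, integral_const_mul]

theorem eLpNorm_comp_le_of_map_le {μ ν : Measure (EuclideanSpace ℝ (Fin n))}
    {ψ : EuclideanSpace ℝ (Fin n) → EuclideanSpace ℝ (Fin n)} (hψ : Measurable ψ) {c : ℝ≥0∞}
    (hmap : μ.map ψ ≤ c • ν) {G : EuclideanSpace ℝ (Fin n) → ℝ≥0∞} (hG : Measurable G) (q : ℝ≥0∞) :
    eLpNorm (fun x => G (ψ x)) q μ ≤ c ^ (1 / q).toReal * eLpNorm G q ν := by
  have h := eLpNorm_map_measure (p := q) (μ := μ) (f := ψ) (g := G)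
    hG.aemeasurable.aestronglyMeasurable hψ.aemeasurable
  rw [show (fun x => G (ψ x)) = G ∘ ψ from rfl, ← h]
  exact (eLpNorm_mono_measure G hmap).trans (eLpNorm_smul_measure_le c G q ν)

/-- The estimates for the kernel operator with an amplitude that is smooth for every `x`. -/
theorem fioExt_bound (hn : 2 ≤ n) {p q r : ℝ≥0∞} (hp : 1 ≤ p) (hq : 1 ≤ q)
    (hr : r⁻¹ = q⁻¹ + p⁻¹) (m : ℝ) {ρ : ℝ} (hρ : 0 ≤ ρ) {R : ℝ} (hR : 1 ≤ R)
    (B : (Fin n → ℕ) → (Fin n → ℕ) → ℝ) {c : ℝ} (hc : 0 < c) :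
    ∃ C : ℝ≥0, ∀ φ : EuclideanSpace ℝ (Fin n) → EuclideanSpace ℝ (Fin n) → ℝ,
      PhaseClass 2 B φ → StrongNondegenerate c φ →
      ∀ a : EuclideanSpace ℝ (Fin n) → EuclideanSpace ℝ (Fin n) → ℂ,
        IsRegularFamily (Metric.closedBall 0 R) a → ampSeminorm p m ρ (n + 1) a < ⊤ →
        ∀ u : EuclideanSpace ℝ (Fin n) → ℂ, MemLp u q volume →
          (∀ᵐ x, Integrable (fun y => fioKernel φ a x y * u y) volume) ∧
          MemLp (fioExt φ a u) r volume ∧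
          eLpNorm (fioExt φ a u) r volume ≤
            C * ampSeminorm p m ρ (n + 1) a * eLpNorm u q volume := by
  have hn1 : 1 ≤ n := by omega
  have hp0 : p ≠ 0 := (zero_lt_one.trans_le hp).ne'
  have hq0 : q ≠ 0 := (zero_lt_one.trans_le hq).ne'
  have : ENNReal.HolderTriple p q r := ⟨by rw [hr, add_comm]⟩
  have hfinν := isFiniteMeasure_singularMeasure hn1 R
  obtain ⟨C₁, hC₁t, hC₁⟩ := exists_enorm_fioKernel_le hn B R hR
  set C₂ : ℝ≥0∞ := singularMeasure n R Set.univ * ENNReal.ofReal ((1 + R) ^ |m|) with hC₂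
  set C₃ : ℝ≥0∞ := (ENNReal.ofReal c)⁻¹ ^ (1 / q).toReal *
    ∫⁻ z : EuclideanSpace ℝ (Fin n), decayWeight z with hC₃
  have hC₂t : C₂ < ⊤ := ENNReal.mul_lt_top (measure_lt_top _ _) ENNReal.ofReal_lt_top
  have hC₃t : C₃ < ⊤ := by
    refine ENNReal.mul_lt_top (ENNReal.rpow_lt_top_of_nonneg ENNReal.toReal_nonneg ?_)
      lintegral_decayWeight_lt_top
    simpa using hc
  have hCt : C₁ * C₂ * C₃ < ⊤ := ENNReal.mul_lt_top (ENNReal.mul_lt_top hC₁t hC₂t) hC₃t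
  refine ⟨(C₁ * C₂ * C₃).toNNReal, ?_⟩
  rw [ENNReal.coe_toNNReal hCt.ne]
  intro φ hφ hnd a ha hat u hu
  set ζ : EuclideanSpace ℝ (Fin n) := stdVec ⟨0, by omega⟩ with hζ
  have hζ1 : ‖ζ‖ = 1 := norm_stdVec _
  have hζ0 : ζ ≠ 0 := norm_pos_iff.1 (by rw [hζ1]; exact one_pos)
  set ψ := phaseGradient φ ζ with hψ
  have hψm : Measurable ψ :=
    (continuous_iff_continuousAt.2 fun x => (hφ.hasFDerivAt_phaseGradient hζ0 x).continuousAt).measurable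
  have hmap : (volume : Measure (EuclideanSpace ℝ (Fin n))).map ψ ≤
      (ENNReal.ofReal c)⁻¹ • volume :=
    map_le_smul_of_injective_of_det volume (hφ.hasFDerivAt_phaseGradient hζ0)
      (hφ.injective_phaseGradient hc hnd hζ1) hc
      fun x => by rw [det_phaseGradientDeriv]; exact hnd x ζ hζ0
  -- A measurable representative is needed since the weighted average is composed with `ψ`; the
  -- kernel integrals do not see the change.
  set u' := hu.1.mk u with hu'
  have huu : u =ᵐ[volume] u' := hu.1.ae_eq_mk
  have hu'm : Measurable u' := hu.1.stronglyMeasurable_mk.measurable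
  have hnorm : eLpNorm u' q volume = eLpNorm u q volume := eLpNorm_congr_ae huu.symm
  have hGm := measurable_weightedAverage hu'm
  have hAm := measurable_derivSum hn1 R ha
  have hGψm : Measurable fun x => weightedAverage u' (ψ x) := hGm.comp hψm
  have hGψ : eLpNorm (fun x => weightedAverage u' (ψ x)) q volume ≤ C₃ * eLpNorm u q volume := by
    refine (eLpNorm_comp_le_of_map_le hψm hmap hGm q).trans ?_
    rw [hC₃, mul_assoc, ← hnorm]
    exact mul_le_mul_right (eLpNorm_weightedAverage_le hu'm hq) _
  have hA : eLpNorm (fun x => derivSum R (a x)) p volume ≤ C₂ * ampSeminorm p m ρ (n + 1) a :=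
    eLpNorm_derivSum_le hn1 R ha hp hρ
  -- Finiteness almost everywhere of both factors serves twice: for Hölder's inequality and for
  -- absolute convergence of the kernel integral.
  have hGt := ae_lt_top_of_eLpNorm_lt_top hGψm hq0
    (hGψ.trans_lt (ENNReal.mul_lt_top hC₃t hu.2))
  have hAt := ae_lt_top_of_eLpNorm_lt_top hAm hp0 (hA.trans_lt (ENNReal.mul_lt_top hC₂t hat))
  have hKm := hφ.stronglyMeasurable_fioKernel hn1 ha
  have hpt : ∀ x, ∫⁻ y, ‖fioKernel φ a x y * u y‖ₑ ≤
      C₁ * (derivSum R (a x) * weightedAverage u' (ψ x)) := by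
    intro x
    calc ∫⁻ y, ‖fioKernel φ a x y * u y‖ₑ
        ≤ ∫⁻ y, C₁ * derivSum R (a x) * (‖u' y‖ₑ * decayWeight (y - ψ x)) := by
          refine lintegral_mono_ae ?_
          filter_upwards [huu] with y hy
          rw [enorm_mul, hy]
          refine (mul_le_mul_left (hC₁ φ hφ a x (ha.smooth x) (ha.support x) y) _).trans
            (le_of_eq ?_)
          ring
      _ = C₁ * derivSum R (a x) * ∫⁻ y, ‖u' y‖ₑ * decayWeight (y - ψ x) :=
          lintegral_const_mul _ (hu'm.enorm.mul
            (measurable_decayWeight.comp (measurable_id.sub_const _)))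
      _ = _ := by rw [lintegral_enorm_mul_decayWeight_sub, mul_assoc]
  have hmeas : AEStronglyMeasurable (fioExt φ a u) volume := by
    have e : fioExt φ a u = fioExt φ a u' := by
      funext x
      refine integral_congr_ae ?_
      filter_upwards [huu] with y hy
      rw [hy]
    rw [e]
    refine StronglyMeasurable.aestronglyMeasurable ?_
    refine StronglyMeasurable.integral_prod_right (f := fun x y => fioKernel φ a x y * u' y) ?_
    exact hKm.mul (hu'm.comp measurable_snd).stronglyMeasurable
  have hle : eLpNorm (fioExt φ a u) r volume ≤
      C₁ * C₂ * C₃ * ampSeminorm p m ρ (n + 1) a * eLpNorm u q volume := by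
    have hH : eLpNorm (fun x => derivSum R (a x) * weightedAverage u' (ψ x)) r volume ≤ _ :=
      eLpNorm_mul_le_of_holderTriple (p := p) (q := q) hAm hGψm hAt hGt
    have h1 : eLpNorm (fioExt φ a u) r volume ≤ C₁ *
        eLpNorm (fun x => derivSum R (a x) * weightedAverage u' (ψ x)) r volume := by
      have h2 := eLpNorm_le_nnreal_smul_eLpNorm_of_ae_le_mul' (μ := volume) (f := fioExt φ a u)
        (g := fun x => derivSum R (a x) * weightedAverage u' (ψ x)) (c := C₁.toNNReal)
        (Filter.Eventually.of_forall fun x => ?_) r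
      · rwa [ENNReal.smul_def, ENNReal.coe_toNNReal hC₁t.ne, smul_eq_mul] at h2
      · rw [ENNReal.coe_toNNReal hC₁t.ne, enorm_eq_self]
        exact (enorm_integral_le_lintegral_enorm _).trans (hpt x)
    refine h1.trans ((mul_le_mul_right (hH.trans (mul_le_mul' hA hGψ)) _).trans (le_of_eq ?_))
    ring
  refine ⟨?_, ⟨hmeas, hle.trans_lt ?_⟩, hle⟩
  · filter_upwards [hGt, hAt] with x h1 h2
    refine ⟨?_, (hpt x).trans_lt (ENNReal.mul_lt_top hC₁t (ENNReal.mul_lt_top h2 h1))⟩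
    exact (hKm.comp_measurable measurable_prodMk_left).aestronglyMeasurable.mul hu.1
  · exact ENNReal.mul_lt_top (ENNReal.mul_lt_top hCt hat) hu.2

end FourierIntegral

/-! ### Transfer to the given amplitude. -/

theorem theorem4p1 (n : ℕ) (hn : 2 ≤ n) (p q r : ℝ≥0∞) (hp : 1 ≤ p) (hq : 1 ≤ q)
    (hr : r⁻¹ = q⁻¹ + p⁻¹) :
    ∃ N : ℕ, ∀ (m ρ : ℝ), 0 ≤ ρ → ρ ≤ 1 →
      ∀ K : Set (EuclideanSpace ℝ (Fin n)), IsCompact K →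
      ∀ (B : (Fin n → ℕ) → (Fin n → ℕ) → ℝ) (c : ℝ), 0 < c →
      ∃ C : ℝ≥0,
        ∀ φ : EuclideanSpace ℝ (Fin n) → EuclideanSpace ℝ (Fin n) → ℝ,
          PhaseClass 2 B φ → StrongNondegenerate c φ →
        ∀ a : EuclideanSpace ℝ (Fin n) → EuclideanSpace ℝ (Fin n) → ℂ,
          AmplitudeClass p m ρ a → (∀ᵐ x, tsupport (a x) ⊆ K) →
          -- the a priori estimate for Schwartz functions
          (∀ u : 𝓢(EuclideanSpace ℝ (Fin n), ℂ),
            MemLp (fio φ a u) r volume ∧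
            eLpNorm (fio φ a u) r volume
              ≤ C * ampSeminorm p m ρ N a * eLpNorm u q volume) ∧
          -- the kernel operator extends it to all of `L^q`
          (∀ u : 𝓢(EuclideanSpace ℝ (Fin n), ℂ),
            fio φ a u =ᵐ[volume] fioExt φ a u) ∧
          (∀ u : EuclideanSpace ℝ (Fin n) → ℂ, MemLp u q volume →
            (∀ᵐ x, Integrable (fun y => fioKernel φ a x y * u y) volume) ∧
            MemLp (fioExt φ a u) r volume ∧
            eLpNorm (fioExt φ a u) r volume
              ≤ C * ampSeminorm p m ρ N a * eLpNorm u q volume) := by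
  -- `n + 1` is the number of integrations by parts, whatever `p` and `q`.
  refine ⟨n + 1, fun m ρ hρ _ K hK B c hc => ?_⟩
  obtain ⟨R₀, hR₀⟩ := hK.isBounded.subset_closedBall 0
  set R := max 1 R₀ with hR
  have hKR : K ⊆ Metric.closedBall 0 R :=
    hR₀.trans (Metric.closedBall_subset_closedBall (le_max_right _ _))
  obtain ⟨C, hC⟩ := fioExt_bound hn hp hq hr m hρ (le_max_left 1 R₀) B hc
  refine ⟨C, fun φ hφ hnd a ha hsupp => ?_⟩
  -- Replacing `a` by `b` alters the kernel and both operators only for `x` in a null set, and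
  -- leaves the seminorms unchanged.
  obtain ⟨b, hb, hba⟩ := exists_isRegularFamily ha.measurable ha.smooth
    (hsupp.mono fun x hx => hx.trans hKR)
  have hsemi : ampSeminorm p m ρ (n + 1) b = ampSeminorm p m ρ (n + 1) a := ampSeminorm_congr hba _
  have hker : ∀ᵐ x, fioKernel φ b x = fioKernel φ a x := by
    filter_upwards [hba] with x hx
    funext y
    simp only [fioKernel, hx]
  have hext : ∀ u : EuclideanSpace ℝ (Fin n) → ℂ, fioExt φ b u =ᵐ[volume] fioExt φ a u := by
    intro u
    filter_upwards [hker] with x hx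
    simp only [fioExt, hx]
  have hfio : ∀ u : EuclideanSpace ℝ (Fin n) → ℂ, fio φ b u =ᵐ[volume] fio φ a u := by
    intro u
    filter_upwards [hba] with x hx
    simp only [fio, hx]
  have hmain : ∀ u : EuclideanSpace ℝ (Fin n) → ℂ, MemLp u q volume →
      (∀ᵐ x, Integrable (fun y => fioKernel φ a x y * u y) volume) ∧
      MemLp (fioExt φ a u) r volume ∧
      eLpNorm (fioExt φ a u) r volume ≤
        C * ampSeminorm p m ρ (n + 1) a * eLpNorm u q volume := by
    intro u hu
    obtain ⟨h1, h2, h3⟩ := hC φ hφ hnd b hb (by rw [hsemi]; exact ha.ampSeminorm_lt_top _) u hu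
    refine ⟨?_, h2.ae_eq (hext u), ?_⟩
    · filter_upwards [h1, hker] with x hx1 hx2
      rwa [hx2] at hx1
    · rwa [eLpNorm_congr_ae (hext u), hsemi] at h3
  have heq : ∀ u : 𝓢(EuclideanSpace ℝ (Fin n), ℂ), fio φ a u =ᵐ[volume] fioExt φ a u := by
    intro u
    refine (hfio u).symm.trans (Filter.EventuallyEq.trans ?_ (hext u))
    rw [hφ.fio_eq_fioExt (by omega) hb (isCompact_closedBall _ _) u.integrable]
  refine ⟨fun u => ?_, heq, hmain⟩
  obtain ⟨-, h2, h3⟩ := hmain u (u.memLp q volume)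
  exact ⟨h2.ae_eq (heq u).symm, by rwa [eLpNorm_congr_ae (heq u)]⟩
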